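/- A planar map is a proper embedding of a connected planar graph (loops and multiple edges allowed) in the oriented sphere, up to orientation preserving homeomorphism. It is rooted by orienting one edge, the root-edge; the root-vertex is the origin of this edge, and the root-face is the face to its right. The atomic map, with one vertex and no edge, is counted as a rooted planar map, with root-vertex degree and root-face degree $0$. Let $\mathcal M$ be the set of rooted planar maps. For $M\in\mathcal M$, let $\mathrm e(M)$, $\mathrm v(M)$, $\mathrm{dv}(M)$, $\mathrm{df}(M)$ be the number of edges, the number of vertices, the degree of the root-vertex and the degree of the root-face of $M$ (counted with multiplicity), and let $P_M(q,\nu)$ be the Potts polynomial of the underlying graph: the polynomial in $q$ and $\nu$ whose value at every $q\in\mathbb N$ is $\sum_{c:V(M)\to\{1,\dots,q\}}\nu^{m(c)}$, where $m(c)$ is the number of edges whose endpoints have the same colour (it is a multiple of $q$). Let $$M(x,y)\equiv M(q,\nu,t,w;x,y)=\frac1q\sum_{M\in\mathcal M}t^{\mathrm e(M)}w^{\mathrm v(M)-1}x^{\mathrm{dv}(M)}y^{\mathrm{df}(M)}P_M(q,\nu),$$ a power series in $t$ with coefficients in $\mathbb Q[q,\nu,w,x,y]$. Then $$\begin{aligned}M(x,y)={}&1+xywt\bigl(qy+(\nu-1)(y-1)\bigr)M(x,y)M(1,y)+xyt(x\nu-1)M(x,y)M(x,1)\\&+xywt(\nu-1)\frac{xM(x,y)-M(1,y)}{x-1}+xyt\,\frac{yM(x,y)-M(x,1)}{y-1}.\end{aligned}$$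 -/

import Mathlib

open Polynomial PowerSeries
open scoped Graph

noncomputable section

/-! ## The Potts polynomial of a finite multigraph -/

section Potts

universe u v u' v'

/-- The set of monochromatic edges of a colouring `c` of the vertices of a multigraph `G`:
the edges whose two endpoints share the same colour (every loop is monochromatic). -/
def monochromaticEdges {V : Type u} {E : Type v} (G : Graph V E) {q : ℕ}
    (c : V(G) → Fin q) : Set E :=
  {e | ∃ a b : V(G), G.IsLink e a b ∧ c a = c b}

/-- The partition function of the `q`-state Potts model on `G`, as a polynomial in `ν`:
the sum over all colourings `c` of the vertices in `q` colours of `ν ^ m(c)`, where `m(c)` is the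
number of monochromatic edges. -/
def pottsPartition {V : Type u} {E : Type v} [Finite V] [Finite E] (G : Graph V E) (q : ℕ) :
    ℚ[X] :=
  ∑ᶠ c : V(G) → Fin q, Polynomial.X ^ (monochromaticEdges G c).ncard

/-- Two endpoints of an edge of `S` are related. -/
def linkedBy {V : Type u} {E : Type v} (G : Graph V E) (S : Finset E) (a b : V(G)) : Prop :=
  ∃ e ∈ S, G.IsLink e a b

theorem card_colourings {V : Type u} {E : Type v} [Finite V] (G : Graph V E)
    (S : Finset E) (hS : ∀ e ∈ S, e ∈ E(G)) (q : ℕ) :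
    Nat.card {c : V(G) → Fin q // ∀ e ∈ S, e ∈ monochromaticEdges G c} =
      q ^ Nat.card (Quot (linkedBy G S)) := by
  have e : {c : V(G) → Fin q // ∀ e ∈ S, e ∈ monochromaticEdges G c} ≃
      (Quot (linkedBy G S) → Fin q) :=
    { toFun := fun c => Quot.lift c.1 (by
        rintro a b ⟨e, he, hl⟩
        obtain ⟨a', b', hl', hc⟩ := c.2 e he
        rcases hl.eq_and_eq_or_eq_and_eq hl' with ⟨h1, h2⟩ | ⟨h1, h2⟩
        · rw [Subtype.ext h1, Subtype.ext h2, hc]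
        · rw [Subtype.ext h1, Subtype.ext h2, hc])
      invFun := fun f => ⟨fun a => f (Quot.mk _ a), by
        intro e he
        obtain ⟨a, b, hl⟩ := Graph.exists_isLink_of_mem_edgeSet (hS e he)
        exact ⟨⟨a, hl.left_mem⟩, ⟨b, hl.right_mem⟩, hl,
          congrArg f (Quot.sound ⟨e, he, hl⟩)⟩⟩
      left_inv := fun c => rfl
      right_inv := fun f => by
        funext a
        induction a using Quot.ind
        rfl }
  rw [Nat.card_congr e, Nat.card_fun, Nat.card_eq_fintype_card, Fintype.card_fin]

/-- The partition functions for `q = 0, 1, 2, …` are the values at the natural numbers of one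
polynomial in `q`. -/
theorem exists_pottsPolynomial {V : Type u} {E : Type v} [Finite V] [Finite E]
    (G : Graph V E) :
    ∃ P : ℚ[X][X], ∀ q : ℕ, P.eval (q : ℚ[X]) = pottsPartition G q := by
  classical
  have := Fintype.ofFinite E
  have := Fintype.ofFinite V(G)
  refine ⟨∑ S : Finset E with (∀ e ∈ S, e ∈ E(G)), Polynomial.C ((Polynomial.X - 1) ^ S.card) *
    Polynomial.X ^ Nat.card (Quot (linkedBy G S)), fun q => ?_⟩
  rw [pottsPartition, finsum_eq_sum_of_fintype, Polynomial.eval_finsetSum]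
  have key : ∀ c : V(G) → Fin q,
      (Polynomial.X : ℚ[X]) ^ (monochromaticEdges G c).ncard =
        ∑ S : Finset E with (∀ e ∈ S, e ∈ E(G)),
          if (∀ e ∈ S, e ∈ monochromaticEdges G c) then (Polynomial.X - 1) ^ S.card else 0 := by
    intro c
    rw [← Finset.sum_filter, Finset.filter_filter, Set.ncard_eq_toFinset_card']
    have h := Finset.sum_pow_mul_eq_add_pow (Polynomial.X - 1 : ℚ[X]) 1
      (monochromaticEdges G c).toFinset
    rw [sub_add_cancel] at h
    rw [← h]
    refine Finset.sum_congr ?_ (by simp)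
    ext S
    simp only [Finset.mem_powerset, Finset.mem_filter, Finset.mem_univ, true_and]
    constructor
    · intro hS
      have hS' : ∀ e ∈ S, e ∈ monochromaticEdges G c := fun e he => by simpa using hS he
      refine ⟨fun e he => ?_, hS'⟩
      obtain ⟨a, b, hl, -⟩ := hS' e he
      exact hl.edge_mem
    · rintro ⟨-, hS⟩ e he
      simpa using hS e he
  rw [Finset.sum_congr rfl fun c _ => key c, Finset.sum_comm]
  refine Finset.sum_congr rfl fun S hS => ?_
  rw [← Finset.sum_filter, Finset.sum_const, nsmul_eq_mul]
  have := card_colourings G S (by simpa using hS) q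
  rw [Nat.card_eq_fintype_card, Fintype.card_subtype] at this
  rw [this]
  simp [mul_comm]

/-- The Potts polynomial of `G`: the polynomial in `q`, with coefficients in `ℚ[ν]`, whose value
at each natural number `q` is the partition function of the `q`-state Potts model. -/
def pottsPolynomial {V : Type u} {E : Type v} [Finite V] [Finite E] (G : Graph V E) : ℚ[X][X] :=
  (exists_pottsPolynomial G).choose

theorem pottsPolynomial_eval {V : Type u} {E : Type v} [Finite V] [Finite E] (G : Graph V E)
    (q : ℕ) : (pottsPolynomial G).eval (q : ℚ[X]) = pottsPartition G q :=
  (exists_pottsPolynomial G).choose_spec q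

theorem pottsPolynomial_unique {V : Type u} {E : Type v} [Finite V] [Finite E] (G : Graph V E)
    (P : ℚ[X][X]) (hP : ∀ q : ℕ, P.eval (q : ℚ[X]) = pottsPartition G q) :
    P = pottsPolynomial G := by
  refine Polynomial.eq_of_infinite_eval_eq _ _
    ((Set.infinite_range_of_injective (Nat.cast_injective (R := ℚ[X]))).mono ?_)
  rintro _ ⟨q, rfl⟩
  exact (hP q).trans (pottsPolynomial_eval G q).symm

/-- The Potts polynomial of a graph with at least one vertex is a multiple of `q`. -/
theorem X_mul_divX_pottsPolynomial {V : Type u} {E : Type v} [Finite V] [Finite E]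
    (G : Graph V E) [Nonempty V(G)] :
    Polynomial.X * (pottsPolynomial G).divX = pottsPolynomial G := by
  have h0 : (pottsPolynomial G).coeff 0 = 0 := by
    have h := pottsPolynomial_eval G 0
    rw [Nat.cast_zero, ← Polynomial.coeff_zero_eq_eval_zero] at h
    have : IsEmpty (V(G) → Fin 0) := ⟨fun c => (c (Classical.arbitrary _)).elim0⟩
    rw [h, pottsPartition, finsum_of_isEmpty]
  have h := Polynomial.X_mul_divX_add (pottsPolynomial G)
  rwa [h0, Polynomial.C_0, add_zero] at h

theorem pottsPolynomial_congr {V : Type u} {E : Type v} {V' : Type u'} {E' : Type v'}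
    [Finite V] [Finite E] [Finite V'] [Finite E'] (G : Graph V E) (G' : Graph V' E')
    (f : V(G) ≃ V(G')) (g : E ≃ E')
    (h : ∀ e (a b : V(G)), G.IsLink e a b ↔ G'.IsLink (g e) (f a) (f b)) :
    pottsPolynomial G = pottsPolynomial G' := by
  refine pottsPolynomial_unique _ _ fun q => (pottsPolynomial_eval G q).trans ?_
  refine finsum_eq_of_bijective (fun c => c ∘ f.symm)
    (Equiv.arrowCongr f (Equiv.refl _)).bijective fun c => ?_
  congr 1
  rw [← Set.ncard_image_of_injective _ g.injective]
  congr 1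
  ext e'
  constructor
  · rintro ⟨e, ⟨a, b, hl, hc⟩, rfl⟩
    exact ⟨f a, f b, (h e a b).1 hl, by simpa using hc⟩
  · rintro ⟨a, b, hl, hc⟩
    exact ⟨g.symm e', ⟨f.symm a, f.symm b, (h _ _ _).2 (by simpa using hl), hc⟩, by simp⟩

end Potts

/-! ## Rooted planar maps -/

universe u v

/-- A non-atomic rooted planar map, described by its darts (half-edges).

* `rot` sends each dart to the next dart in counterclockwise order around its origin, so that the
  vertices are the cycles of `rot`;
* `opp` exchanges the two darts of each edge, so that the edges are the cycles of `opp`;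
* `rot * opp` sends a dart `d`, oriented away from its origin, to the next dart along the
  boundary of the face that lies to the right of `d`, so that the faces are the cycles of
  `rot * opp`;
* the root-edge is oriented from the origin of the dart `root`;
* `connected` says that the underlying graph is connected;
* `euler` says, by Euler's relation `v + f = e + 2` (with `2 e` darts), that the surface
  is the sphere. -/
structure DartMap (D : Type u) [Finite D] where
  rot : Equiv.Perm D
  opp : Equiv.Perm D
  root : D
  opp_opp : ∀ d, opp (opp d) = d
  opp_ne : ∀ d, opp d ≠ d
  connected : ∀ d d', ∃ g ∈ Subgroup.closure {rot, opp}, g d = d'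
  euler : 2 * (Nat.card (Quotient (Equiv.Perm.SameCycle.setoid rot)) +
      Nat.card (Quotient (Equiv.Perm.SameCycle.setoid (rot * opp)))) = Nat.card D + 4

namespace DartMap

/-- The vertices. -/
abbrev Vertex {D : Type u} [Finite D] (m : DartMap D) : Type u :=
  Quotient (Equiv.Perm.SameCycle.setoid m.rot)

/-- The edges. -/
abbrev Edge {D : Type u} [Finite D] (m : DartMap D) : Type u :=
  Quotient (Equiv.Perm.SameCycle.setoid m.opp)

/-- The origin of a dart. -/
def origin {D : Type u} [Finite D] (m : DartMap D) (d : D) : m.Vertex :=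
  Quotient.mk _ d

/-- The edge that contains a dart. -/
def edge {D : Type u} [Finite D] (m : DartMap D) (d : D) : m.Edge :=
  Quotient.mk _ d

theorem eq_or_eq_opp_of_edge_eq {D : Type u} [Finite D] (m : DartMap D) {d d' : D}
    (h : m.edge d = m.edge d') : d' = d ∨ d' = m.opp d := by
  obtain ⟨n, hn⟩ : m.opp.SameCycle d d' := Quotient.exact h
  have h2 : m.opp ^ (2 : ℤ) = 1 := by
    ext x
    simp [zpow_ofNat, pow_two, m.opp_opp]
  rcases Int.even_or_odd' n with ⟨k, rfl | rfl⟩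
  · left
    simpa [zpow_mul, h2] using hn.symm
  · right
    simpa [zpow_add, zpow_mul, h2] using hn.symm

/-- The underlying multigraph of a map. -/
def graph {D : Type u} [Finite D] (m : DartMap D) : Graph m.Vertex m.Edge where
  vertexSet := Set.univ
  IsLink e a b := ∃ d, m.edge d = e ∧ m.origin d = a ∧ m.origin (m.opp d) = b
  isLink_symm := by
    refine fun e _ => ⟨?_⟩
    rintro a b ⟨d, rfl, rfl, rfl⟩
    refine ⟨m.opp d, Quotient.sound ?_, rfl, by rw [m.opp_opp]⟩
    exact ⟨1, by simp [m.opp_opp]⟩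
  eq_or_eq_of_isLink_of_isLink := by
    rintro e a b a' b' ⟨d, rfl, rfl, rfl⟩ ⟨d', he, rfl, rfl⟩
    rcases m.eq_or_eq_opp_of_edge_eq he with rfl | rfl
    · exact Or.inl rfl
    · exact Or.inr rfl
  left_mem_of_isLink := fun _ _ _ _ => Set.mem_univ _

/-- The number of vertices. -/
def numVertices {D : Type u} [Finite D] (m : DartMap D) : ℕ := Nat.card m.Vertex

/-- The degree of the root-vertex, that is, of the origin of the root-edge. -/
def rootVertexDegree {D : Type u} [Finite D] (m : DartMap D) : ℕ :=
  {d | m.rot.SameCycle m.root d}.ncard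

/-- The degree of the root-face, that is, of the face to the right of the root-edge. -/
def rootFaceDegree {D : Type u} [Finite D] (m : DartMap D) : ℕ :=
  {d | (m.rot * m.opp).SameCycle m.root d}.ncard

/-- Isomorphism of rooted maps: a bijection between the darts that preserves the rotations, the
edges and the root. It represents an orientation-preserving homeomorphism of the sphere. -/
def Iso {D : Type u} {D' : Type v} [Finite D] [Finite D'] (m : DartMap D) (m' : DartMap D') :
    Prop :=
  ∃ π : D ≃ D', (∀ d, π (m.rot d) = m'.rot (π d)) ∧ (∀ d, π (m.opp d) = m'.opp (π d)) ∧
    π m.root = m'.root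

theorem sameCycle_iff {D : Type u} {D' : Type v} (π : D ≃ D') (s : Equiv.Perm D)
    (s' : Equiv.Perm D') (h : ∀ d, π (s d) = s' (π d)) (a b : D) :
    s.SameCycle a b ↔ s'.SameCycle (π a) (π b) := by
  have hs : s' = π.permCongr s := by
    ext d
    simp [h]
  have hp : ∀ n : ℤ, s' ^ n = π.permCongr (s ^ n) := fun n => by
    rw [hs]
    exact (map_zpow π.permCongrHom s n).symm
  constructor
  · rintro ⟨n, rfl⟩
    exact ⟨n, by simp [hp]⟩
  · rintro ⟨n, hn⟩
    refine ⟨n, π.injective ?_⟩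
    simpa [hp] using hn

/-- The bijection between cycles induced by a conjugation. -/
def cyclesCongr {D : Type u} {D' : Type v} (π : D ≃ D') (s : Equiv.Perm D)
    (s' : Equiv.Perm D') (h : ∀ d, π (s d) = s' (π d)) :
    Quotient (Equiv.Perm.SameCycle.setoid s) ≃ Quotient (Equiv.Perm.SameCycle.setoid s') :=
  Quotient.congr π (sameCycle_iff π s s' h)

theorem Iso.numVertices_eq {D : Type u} {D' : Type v} [Finite D] [Finite D'] {m : DartMap D}
    {m' : DartMap D'} (h : m.Iso m') : m.numVertices = m'.numVertices := by
  obtain ⟨π, h1, -, -⟩ := h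
  exact Nat.card_congr (cyclesCongr π _ _ h1)

theorem ncard_cycle_eq {D : Type u} {D' : Type v} (π : D ≃ D') (s : Equiv.Perm D)
    (s' : Equiv.Perm D') (h : ∀ d, π (s d) = s' (π d)) (r : D) :
    {d | s.SameCycle r d}.ncard = {d | s'.SameCycle (π r) d}.ncard := by
  rw [← Set.ncard_image_of_injective _ π.injective]
  congr 1
  ext d
  constructor
  · rintro ⟨d, hd, rfl⟩
    exact (sameCycle_iff π s s' h _ _).1 hd
  · intro hd
    exact ⟨π.symm d, (sameCycle_iff π s s' h _ _).2 (by simpa using hd), by simp⟩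

theorem Iso.rootVertexDegree_eq {D : Type u} {D' : Type v} [Finite D] [Finite D']
    {m : DartMap D} {m' : DartMap D'} (h : m.Iso m') :
    m.rootVertexDegree = m'.rootVertexDegree := by
  obtain ⟨π, h1, -, h3⟩ := h
  rw [rootVertexDegree, rootVertexDegree, ← h3]
  exact ncard_cycle_eq π _ _ h1 _

theorem Iso.rootFaceDegree_eq {D : Type u} {D' : Type v} [Finite D] [Finite D']
    {m : DartMap D} {m' : DartMap D'} (h : m.Iso m') :
    m.rootFaceDegree = m'.rootFaceDegree := by
  obtain ⟨π, h1, h2, h3⟩ := h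
  rw [rootFaceDegree, rootFaceDegree, ← h3]
  exact ncard_cycle_eq π _ _ (fun d => by simp [h1, h2]) _

theorem Iso.pottsPolynomial_eq {D : Type u} {D' : Type v} [Finite D] [Finite D']
    {m : DartMap D} {m' : DartMap D'} (h : m.Iso m') :
    pottsPolynomial m.graph = pottsPolynomial m'.graph := by
  obtain ⟨π, h1, h2, -⟩ := h
  let f := cyclesCongr π _ _ h1
  let g := cyclesCongr π _ _ h2
  have hf : ∀ d, f (m.origin d) = m'.origin (π d) := fun d => rfl
  have hg : ∀ d, g (m.edge d) = m'.edge (π d) := fun d => rfl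
  refine pottsPolynomial_congr _ _
    ((Equiv.Set.univ _).trans (f.trans (Equiv.Set.univ _).symm)) g fun e a b => ?_
  change (∃ d, m.edge d = e ∧ m.origin d = a.1 ∧ m.origin (m.opp d) = b.1) ↔
    (∃ d, m'.edge d = g e ∧ m'.origin d = f a.1 ∧ m'.origin (m'.opp d) = f b.1)
  constructor
  · rintro ⟨d, he, ha, hb⟩
    exact ⟨π d, by rw [← he, hg], by rw [← ha, hf], by rw [← hb, hf, h2]⟩
  · rintro ⟨d, he, ha, hb⟩
    obtain ⟨d, rfl⟩ := π.surjective d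
    rw [← h2] at hb
    exact ⟨d, g.injective (by rw [hg, he]), f.injective (by rw [hf, ha]),
      f.injective (by rw [hf, hb])⟩

/-- Maps on `D`, up to isomorphism. -/
def isoSetoid (D : Type u) [Finite D] : Setoid (DartMap D) where
  r := Iso
  iseqv :=
    { refl := fun _ => ⟨Equiv.refl _, fun _ => rfl, fun _ => rfl, rfl⟩
      symm := by
        rintro m m' ⟨π, h1, h2, h3⟩
        exact ⟨π.symm, fun d => π.injective (by simp [h1]), fun d => π.injective (by simp [h2]),
          by simp [← h3]⟩
      trans := by
        rintro m m' m'' ⟨π, h1, h2, h3⟩ ⟨ρ, k1, k2, k3⟩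
        exact ⟨π.trans ρ, fun d => by simp [h1, k1], fun d => by simp [h2, k2],
          by simp [h3, k3]⟩ }

instance (D : Type u) [Finite D] : Finite (DartMap D) :=
  Finite.of_injective
    (fun m : DartMap D => ((m.rot : D → D), (m.opp : D → D), m.root)) (by
      intro m m' h
      cases m
      cases m'
      simp only [Prod.mk.injEq, DFunLike.coe_fn_eq] at h
      obtain ⟨rfl, rfl, rfl⟩ := h
      rfl)

instance {D : Type u} [Finite D] (m : DartMap D) : Nonempty V(m.graph) :=
  ⟨⟨m.origin m.root, Set.mem_univ _⟩⟩

end DartMap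

/-- The set of rooted planar maps with `n` edges, up to isomorphism: for `n = 0` the atomic map
only, and otherwise the isomorphism classes of rooted planar maps with `2 n` darts. -/
def RootedPlanarMap : ℕ → Type
  | 0 => Unit
  | n + 1 => Quotient (DartMap.isoSetoid (Fin (2 * (n + 1))))

namespace RootedPlanarMap

instance finite : (n : ℕ) → Finite (RootedPlanarMap n)
  | 0 => inferInstanceAs (Finite Unit)
  | n + 1 => inferInstanceAs (Finite (Quotient (DartMap.isoSetoid (Fin (2 * (n + 1))))))

instance (n : ℕ) : Fintype (RootedPlanarMap n) := Fintype.ofFinite _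

/-- The graph with one vertex and no edge, which underlies the atomic map. -/
def atomicGraph : Graph Unit Empty where
  vertexSet := Set.univ
  IsLink _ _ _ := False
  isLink_symm := fun e => e.elim
  eq_or_eq_of_isLink_of_isLink := fun e => e.elim
  left_mem_of_isLink := fun e => e.elim

instance : Nonempty V(atomicGraph) := ⟨⟨(), Set.mem_univ _⟩⟩

/-- The number of vertices. -/
def numVertices : {n : ℕ} → RootedPlanarMap n → ℕ
  | 0, _ => 1
  | _ + 1, m => Quotient.lift DartMap.numVertices (fun _ _ => DartMap.Iso.numVertices_eq) m

/-- The degree of the root-vertex (`0` for the atomic map). -/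
def rootVertexDegree : {n : ℕ} → RootedPlanarMap n → ℕ
  | 0, _ => 0
  | _ + 1, m => Quotient.lift DartMap.rootVertexDegree (fun _ _ => DartMap.Iso.rootVertexDegree_eq) m

/-- The degree of the root-face (`0` for the atomic map). -/
def rootFaceDegree : {n : ℕ} → RootedPlanarMap n → ℕ
  | 0, _ => 0
  | _ + 1, m => Quotient.lift DartMap.rootFaceDegree (fun _ _ => DartMap.Iso.rootFaceDegree_eq) m

/-- The Potts polynomial of the underlying graph. -/
def potts : {n : ℕ} → RootedPlanarMap n → ℚ[X][X]
  | 0, _ => pottsPolynomial atomicGraph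
  | _ + 1, m =>
    Quotient.lift (fun m => pottsPolynomial m.graph) (fun _ _ => DartMap.Iso.pottsPolynomial_eq) m

/-- The Potts polynomial, divided by `q`. -/
def pottsDivQ {n : ℕ} (m : RootedPlanarMap n) : ℚ[X][X] := m.potts.divX

theorem q_mul_pottsDivQ : {n : ℕ} → (m : RootedPlanarMap n) →
    Polynomial.X * m.pottsDivQ = m.potts
  | 0, _ => X_mul_divX_pottsPolynomial atomicGraph
  | _ + 1, m => by
    induction m using Quotient.ind with
    | _ m => exact X_mul_divX_pottsPolynomial m.graph

end RootedPlanarMap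

/-! ## The Potts generating function -/

/-- The names of the indeterminates, apart from `t`. -/
inductive PottsVar
  | q | nu | w | x | y

/-- The ring `ℚ[q, ν, w, x, y]`. -/
abbrev PottsRing : Type := MvPolynomial PottsVar ℚ

/-- The inclusion of `ℚ[ν][q]` in `ℚ[q, ν, w, x, y]`. -/
def pottsIncl : ℚ[X][X] →+* PottsRing :=
  Polynomial.eval₂RingHom
    (Polynomial.aeval (MvPolynomial.X PottsVar.nu : PottsRing)).toRingHom
    (MvPolynomial.X PottsVar.q)

/-- The Potts generating function of planar maps `M(a, b)`: the power series in `t`, with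
coefficients in `ℚ[q, ν, w, x, y]`, equal to
`(1 / q) ∑_M t ^ e(M) w ^ (v(M) - 1) a ^ dv(M) b ^ df(M) P_M(q, ν)`,
where `dv` and `df` are the degrees of the root-vertex and of the root-face. With `a`, `b` the
indeterminates `x`, `y` it is `M(x, y)`; with one of them replaced by `1` it is `M(1, y)` or
`M(x, 1)`. -/
def pottsGF (a b : PottsRing) : PottsRing⟦X⟧ :=
  PowerSeries.mk fun n => ∑ m : RootedPlanarMap n,
    MvPolynomial.X PottsVar.w ^ (m.numVertices - 1) * a ^ m.rootVertexDegree *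
      b ^ m.rootFaceDegree * pottsIncl m.pottsDivQ

/-- The normalisation by `1 / q` in `pottsGF`. -/
theorem q_mul_pottsGF (a b : PottsRing) :
    PowerSeries.C (MvPolynomial.X PottsVar.q) * pottsGF a b =
      PowerSeries.mk fun n => ∑ m : RootedPlanarMap n,
        MvPolynomial.X PottsVar.w ^ (m.numVertices - 1) * a ^ m.rootVertexDegree *
          b ^ m.rootFaceDegree * pottsIncl m.potts := by
  ext1 n
  rw [PowerSeries.coeff_C_mul, pottsGF, PowerSeries.coeff_mk, PowerSeries.coeff_mk,
    Finset.mul_sum]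
  refine Finset.sum_congr rfl fun m _ => ?_
  rw [← m.q_mul_pottsDivQ, map_mul, pottsIncl, Polynomial.coe_eval₂RingHom,
    Polynomial.eval₂_X]
  ring

/-- `M(a, b)` is obtained from `M(x, y)` by the substitution `x ↦ a`, `y ↦ b`. -/
theorem map_pottsGF (f : PottsRing →ₐ[ℚ] PottsRing)
    (hq : f (MvPolynomial.X PottsVar.q) = MvPolynomial.X PottsVar.q)
    (hν : f (MvPolynomial.X PottsVar.nu) = MvPolynomial.X PottsVar.nu)
    (hw : f (MvPolynomial.X PottsVar.w) = MvPolynomial.X PottsVar.w) :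
    PowerSeries.map (f : PottsRing →+* PottsRing)
        (pottsGF (MvPolynomial.X PottsVar.x) (MvPolynomial.X PottsVar.y)) =
      pottsGF (f (MvPolynomial.X PottsVar.x)) (f (MvPolynomial.X PottsVar.y)) := by
  have h : ∀ P, f (pottsIncl P) = pottsIncl P := fun P => by
    have : ((f : PottsRing →+* PottsRing).comp pottsIncl) = pottsIncl := by
      ext1
      · ext1
        · exact Subsingleton.elim _ _
        · simp [pottsIncl, hν]
      · simp [pottsIncl, hq]
    exact congrArg (fun g => g P) this
  ext1 n
  simp [pottsGF, hw, h]

/-- The fraction field of `ℚ[q, ν, w, x, y][[t]]`, in which the divided differences are formed. -/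
abbrev PottsField : Type := FractionRing PottsRing⟦X⟧

/-- The inclusion of `ℚ[q, ν, w, x, y]` in the fraction field of `ℚ[q, ν, w, x, y][[t]]`. -/
def pottsConst : PottsRing →+* PottsField :=
  (algebraMap PottsRing⟦X⟧ PottsField).comp PowerSeries.C

theorem pottsConst_injective : Function.Injective pottsConst :=
  (IsFractionRing.injective PottsRing⟦X⟧ PottsField).comp PowerSeries.C_injective

/-- In particular the denominators `x - 1` and `y - 1` do not vanish. -/
theorem pottsConst_X_sub_one_ne_zero (i : PottsVar) :
    pottsConst (MvPolynomial.X i) - 1 ≠ 0 := by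
  rw [sub_ne_zero, ← map_one pottsConst]
  refine pottsConst_injective.ne fun h => ?_
  have := congrArg (MvPolynomial.eval (fun _ => (0 : ℚ))) h
  simp at this

end

/-! A rooted map is encoded as a map with a dangling half-edge, the leg, in its root corner
(`LegMap`). The atomic map is then no exception, the root-edge is the edge that follows the leg, and
the two root degrees count the darts other than the leg on the cycles through it.

Deleting the root-edge leaves either a connected map with a second leg or two separate maps; `add`
and `join` are the inverse operations. On the face permutation, restoring the edge amounts to
insertions and to multiplication by the transposition of the two legs (`face_attach`), so it splits
or merges cycles. By induction the genus of a connected map is nonnegative (`Conn.genus_nonneg`);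
hence the pieces of a planar map are planar, and the second leg lies in the root-face. Rooted maps
have no automorphism but the identity, so deletion is a bijection (`exists_bijective_deleted`).
Duality replaces `rot` by `rot * opp` and exchanges vertices and faces.

For `q = k` a positive integer, let Z be the partition function and T(x, y) the generating function
of maps with a given number of edges, weighted by Z. Then Z is the deletion term plus ν - 1 times
the contraction term. In the sum of the deletion terms, joined maps give the product of T(x, y) and
T(1, y). For added edges, the possible positions of the second leg give the geometric sum y + ... +
y^(df + 1), hence the divided difference in y. A root-edge that is a loop brings one more factor x,
which is corrected by x - 1 times a sum over loops; by planarity and duality, loops correspond to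
joined maps (`sum_loop`), and the correction is a product of T(x, y) and T(x, 1). The contraction
terms are treated in the same way on the dual maps, with the roles of x and y exchanged. These are
`sum_weightDel` and `sum_weightCon`, added in `total_succ`.

Finally, an identity of polynomial coefficients that holds for all positive integers `q` and all
rational values of the other variables is an identity in the ring (`powerSeries_eq_of_eval`). -/

noncomputable section

/-! ## Cycles of permutations -/

namespace PermCycles

open Equiv

variable {D : Type} {D' : Type}

/-- The transposition of `x` and `y`. -/
def trans (x y : D) : Perm D := @Equiv.swap D (Classical.decEq D) x y

@[simp] theorem trans_left (x y : D) : trans x y x = y := @Equiv.swap_apply_left D (Classical.decEq D) x y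

@[simp] theorem trans_right (x y : D) : trans x y y = x := @Equiv.swap_apply_right D (Classical.decEq D) x y

theorem trans_of_ne {x y z : D} (h : z ≠ x) (h' : z ≠ y) : trans x y z = z :=
  @Equiv.swap_apply_of_ne_of_ne D (Classical.decEq D) x y z h h'

@[simp] theorem trans_mul_self (x y : D) : trans x y * trans x y = 1 :=
  @Equiv.swap_mul_self D (Classical.decEq D) x y

@[simp] theorem mul_trans_mul_self (σ : Perm D) (x y : D) : σ * trans x y * trans x y = σ := by
  rw [mul_assoc, trans_mul_self, mul_one]

theorem trans_mul (σ : Perm D) (x y : D) : trans x y * σ = σ * trans (σ.symm x) (σ.symm y) :=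
  @Equiv.swap_mul_eq_mul_swap D (Classical.decEq D) σ x y

/-- The number of cycles. -/
def numCycles (σ : Perm D) : ℕ := Nat.card (Quotient (Perm.SameCycle.setoid σ))

/-- The cycle that contains `x`. -/
def cycle (σ : Perm D) (x : D) : Set D := {d | σ.SameCycle x d}

theorem mem_cycle {σ : Perm D} {x y : D} : y ∈ cycle σ x ↔ σ.SameCycle x y := Iff.rfl

/-- The colourings that are constant on the cycles of `σ`. -/
abbrev Inv (σ : Perm D) (X : Type) : Type := {c : D → X // ∀ d, c (σ d) = c d}

instance [Finite D] (σ : Perm D) (X : Type) [Finite X] : Fintype (Inv σ X) := Fintype.ofFinite _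

theorem eq_of_sameCycle {σ : Perm D} {X : Type*} {c : D → X} (hc : ∀ d, c (σ d) = c d) {x y : D}
    (h : σ.SameCycle x y) : c x = c y := by
  obtain ⟨n, rfl⟩ := h
  induction n with
  | zero => rfl
  | succ n ih => rw [add_comm, zpow_add, zpow_one, Perm.mul_apply, hc]; exact ih
  | pred n ih =>
    rw [ih, sub_eq_neg_add, zpow_add, zpow_neg_one, Perm.mul_apply, Perm.inv_def]
    conv_lhs => rw [← Equiv.apply_symm_apply σ ((σ ^ (-(n : ℤ))) x)]
    exact hc _

/-- The converse tests the property of lying on the cycle of `x`. In this form, a bijection between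
invariant colourings transports `SameCycle`. -/
theorem sameCycle_iff_forall {σ : Perm D} {x y : D} :
    σ.SameCycle x y ↔ ∀ c : D → Prop, (∀ d, c (σ d) = c d) → c x = c y := by
  refine ⟨fun h c hc => eq_of_sameCycle hc h, fun h => ?_⟩
  have := h (fun d => σ.SameCycle x d) (fun d => by simp)
  exact this ▸ Perm.SameCycle.refl σ x

/-- In a finite type nonnegative powers exhaust a cycle, so closure under `σ` alone is enough. -/
theorem sameCycle_of_closed [Finite D] {σ : Perm D} {x y : D} (h : σ.SameCycle x y) {S : Set D}
    (hS : ∀ d ∈ S, σ d ∈ S) (hx : x ∈ S) : y ∈ S := by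
  obtain ⟨n, rfl⟩ := h.exists_nat_pow_eq
  clear h
  induction n with
  | zero => exact hx
  | succ n ih => rw [pow_succ', Perm.mul_apply]; exact hS _ ih

/-- Invariant colourings are colourings of the set of cycles. -/
def invEquiv (σ : Perm D) (X : Type) : Inv σ X ≃ (Quotient (Perm.SameCycle.setoid σ) → X) where
  toFun c := Quotient.lift c.1 fun _ _ h => eq_of_sameCycle c.2 h
  invFun f := ⟨fun d => f (Quotient.mk _ d), fun d =>
    congrArg f (Quotient.sound (Perm.SameCycle.refl σ d).apply_left)⟩
  left_inv _ := rfl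
  right_inv f := by
    funext a
    induction a using Quotient.ind
    rfl

/-- Boolean colourings serve to count cycles: as `2 ^ n` determines `n`, a bijection between sets of
invariant colourings compares the numbers of cycles of two permutations. -/
theorem card_inv_bool [Finite D] (σ : Perm D) : Nat.card (Inv σ Bool) = 2 ^ numCycles σ := by
  rw [Nat.card_congr (invEquiv σ Bool), Nat.card_fun]
  simp [numCycles]

theorem numCycles_congr (π : D ≃ D') (σ : Perm D) (σ' : Perm D') (h : ∀ d, π (σ d) = σ' (π d)) :
    numCycles σ = numCycles σ' :=
  Nat.card_congr (DartMap.cyclesCongr π σ σ' h)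

theorem ncard_cycle_congr (π : D ≃ D') (σ : Perm D) (σ' : Perm D')
    (h : ∀ d, π (σ d) = σ' (π d)) (x : D) : (cycle σ x).ncard = (cycle σ' (π x)).ncard :=
  DartMap.ncard_cycle_eq π σ σ' h x

/-! ### Inserting a new element in a cycle -/

/-- The permutation obtained from `σ` by inserting `none` after `y`. -/
def insertAfter (σ : Perm D) (y : D) : Perm (Option D) :=
  optionCongr σ * trans none (some y)

@[simp] theorem insertAfter_none (σ : Perm D) (y : D) : insertAfter σ y none = some (σ y) := by
  simp [insertAfter]

@[simp] theorem insertAfter_self (σ : Perm D) (y : D) : insertAfter σ y (some y) = none := by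
  simp [insertAfter]

theorem insertAfter_of_ne (σ : Perm D) {y d : D} (h : d ≠ y) :
    insertAfter σ y (some d) = some (σ d) := by
  simp [insertAfter, trans_of_ne (x := none) (y := some y) (z := some d) (by simp) (by simpa)]

/-- The permutation obtained from `σ` by inserting `none` before `y`. -/
def insertBefore (σ : Perm D) (y : D) : Perm (Option D) :=
  trans none (some y) * optionCongr σ

theorem insertBefore_eq (σ : Perm D) (y : D) : insertBefore σ y = insertAfter σ (σ.symm y) := by
  rw [insertBefore, trans_mul, insertAfter]
  congr 2

@[simp] theorem insertBefore_none (σ : Perm D) (y : D) : insertBefore σ y none = some y := by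
  simp [insertBefore_eq]

theorem insertBefore_of_eq (σ : Perm D) {y d : D} (h : σ d = y) :
    insertBefore σ y (some d) = none := by
  subst h
  simp [insertBefore_eq]

theorem insertBefore_of_ne (σ : Perm D) {y d : D} (h : σ d ≠ y) :
    insertBefore σ y (some d) = some (σ d) := by
  rw [insertBefore_eq, insertAfter_of_ne]
  rintro rfl
  simp at h

/-- Colourings that are invariant under an insertion. -/
def invInsertAfter (σ : Perm D) (y : D) (X : Type) : Inv (insertAfter σ y) X ≃ Inv σ X where
  toFun c := ⟨fun d => c.1 (some d), fun d => by
    by_cases h : d = y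
    · subst h
      have h1 := c.2 none
      have h2 := c.2 (some d)
      rw [insertAfter_none] at h1
      rw [insertAfter_self] at h2
      exact h1.trans h2
    · have := c.2 (some d)
      rwa [insertAfter_of_ne σ h] at this⟩
  invFun c := ⟨fun o => o.elim (c.1 y) c.1, by
    rintro (_ | d)
    · simp [c.2]
    · by_cases h : d = y
      · subst h; simp
      · simp [insertAfter_of_ne σ h, c.2]⟩
  left_inv c := by
    refine Subtype.ext ?_
    funext o
    cases o with
    | none => change c.1 (some y) = c.1 none; rw [← insertAfter_self σ y, c.2]
    | some d => rfl
  right_inv c := rfl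

/-- Colourings that are invariant under an insertion. -/
def invInsertBefore (σ : Perm D) (y : D) (X : Type) : Inv (insertBefore σ y) X ≃ Inv σ X where
  toFun c := ⟨fun d => c.1 (some d), (invInsertAfter σ (σ.symm y) X
    ⟨c.1, by rw [← insertBefore_eq]; exact c.2⟩).2⟩
  invFun c := ⟨((invInsertAfter σ (σ.symm y) X).symm c).1, by
    rw [insertBefore_eq]; exact ((invInsertAfter σ (σ.symm y) X).symm c).2⟩
  left_inv c := by
    refine Subtype.ext ?_
    funext o
    cases o with
    | none =>
      have := c.2 (some (σ.symm y))
      rw [insertBefore_of_eq σ (Equiv.apply_symm_apply σ y)] at this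
      exact this.symm
    | some d => rfl
  right_inv _ := rfl

theorem numCycles_insertAfter [Finite D] (σ : Perm D) (y : D) :
    numCycles (insertAfter σ y) = numCycles σ := by
  have h := Nat.card_congr (invInsertAfter σ y Bool)
  rw [card_inv_bool, card_inv_bool] at h
  exact Nat.pow_right_injective le_rfl h

theorem numCycles_insertBefore [Finite D] (σ : Perm D) (y : D) :
    numCycles (insertBefore σ y) = numCycles σ := by
  rw [insertBefore_eq, numCycles_insertAfter]

theorem sameCycle_insertAfter_none (σ : Perm D) (y : D) :
    (insertAfter σ y).SameCycle (some y) none := by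
  have := (Perm.SameCycle.refl (insertAfter σ y) (some y)).apply_right
  rwa [insertAfter_self] at this

theorem sameCycle_insertAfter (σ : Perm D) (y u v : D) :
    (insertAfter σ y).SameCycle (some u) (some v) ↔ σ.SameCycle u v := by
  rw [sameCycle_iff_forall, sameCycle_iff_forall]
  exact ⟨fun h c hc => h ((invInsertAfter σ y Prop).symm ⟨c, hc⟩).1
    ((invInsertAfter σ y Prop).symm ⟨c, hc⟩).2,
    fun h c hc => h (invInsertAfter σ y Prop ⟨c, hc⟩).1 (invInsertAfter σ y Prop ⟨c, hc⟩).2⟩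

theorem sameCycle_insertAfter_some_none (σ : Perm D) (y u : D) :
    (insertAfter σ y).SameCycle (some u) none ↔ σ.SameCycle u y := by
  rw [← sameCycle_insertAfter σ y u y]
  exact ⟨fun h => h.trans (sameCycle_insertAfter_none σ y).symm,
    fun h => h.trans (sameCycle_insertAfter_none σ y)⟩

theorem sameCycle_insertBefore_some_none (σ : Perm D) (y u : D) :
    (insertBefore σ y).SameCycle (some u) none ↔ σ.SameCycle u y := by
  rw [insertBefore_eq, sameCycle_insertAfter_some_none]
  exact Perm.sameCycle_symm_apply_right

theorem cycle_insertAfter_of_sameCycle {σ : Perm D} {y u : D} (h : σ.SameCycle u y) :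
    cycle (insertAfter σ y) (some u) = insert none (some '' cycle σ u) := by
  ext o
  cases o with
  | none => simpa [mem_cycle, sameCycle_insertAfter_some_none] using h
  | some d => simp [mem_cycle, sameCycle_insertAfter]

theorem cycle_insertAfter_of_not_sameCycle {σ : Perm D} {y u : D} (h : ¬ σ.SameCycle u y) :
    cycle (insertAfter σ y) (some u) = some '' cycle σ u := by
  ext o
  cases o with
  | none => simpa [mem_cycle, sameCycle_insertAfter_some_none] using h
  | some d => simp [mem_cycle, sameCycle_insertAfter]

theorem ncard_cycle_insertAfter_of_sameCycle [Finite D] {σ : Perm D} {y u : D}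
    (h : σ.SameCycle u y) :
    (cycle (insertAfter σ y) (some u)).ncard = (cycle σ u).ncard + 1 := by
  rw [cycle_insertAfter_of_sameCycle h, Set.ncard_insert_of_notMem (by simp),
    Set.ncard_image_of_injective _ (Option.some_injective D)]

theorem ncard_cycle_insertAfter_of_not_sameCycle {σ : Perm D} {y u : D}
    (h : ¬ σ.SameCycle u y) :
    (cycle (insertAfter σ y) (some u)).ncard = (cycle σ u).ncard := by
  rw [cycle_insertAfter_of_not_sameCycle h,
    Set.ncard_image_of_injective _ (Option.some_injective D)]

theorem ncard_cycle_insertBefore_of_sameCycle [Finite D] {σ : Perm D} {y u : D}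
    (h : σ.SameCycle u y) :
    (cycle (insertBefore σ y) (some u)).ncard = (cycle σ u).ncard + 1 := by
  rw [insertBefore_eq, ncard_cycle_insertAfter_of_sameCycle]
  simpa using h

theorem ncard_cycle_insertBefore_of_not_sameCycle {σ : Perm D} {y u : D}
    (h : ¬ σ.SameCycle u y) :
    (cycle (insertBefore σ y) (some u)).ncard = (cycle σ u).ncard := by
  rw [insertBefore_eq, ncard_cycle_insertAfter_of_not_sameCycle]
  simpa using h

theorem ncard_cycle_insertBefore_none [Finite D] (σ : Perm D) (y : D) :
    (cycle (insertBefore σ y) none).ncard = (cycle σ y).ncard + 1 := by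
  rw [← ncard_cycle_insertBefore_of_sameCycle (Perm.SameCycle.refl σ y)]
  congr 1
  ext o
  rw [mem_cycle, mem_cycle, ← insertBefore_none σ y, Perm.sameCycle_apply_left]

theorem ncard_cycle_pos [Finite D] (σ : Perm D) (x : D) : 0 < (cycle σ x).ncard :=
  (Set.ncard_pos).2 ⟨x, Perm.SameCycle.refl σ x⟩

/-! ### Multiplying by a transposition -/

theorem inv_mul_trans {σ : Perm D} {X : Type*} {c : D → X} (hc : ∀ d, c (σ d) = c d) {x y : D}
    (h : c x = c y) (d : D) : c ((σ * trans x y) d) = c d := by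
  rw [Perm.mul_apply, hc]
  by_cases hx : d = x
  · subst hx; simp [h]
  by_cases hy : d = y
  · subst hy; simp [h]
  rw [trans_of_ne hx hy]

/-- The colourings that are invariant under `σ * trans x y` and agree at `x` and `y`. -/
def invMulTrans (σ : Perm D) (x y : D) (X : Type) :
    {c : Inv (σ * trans x y) X // c.1 x = c.1 y} ≃ {c : Inv σ X // c.1 x = c.1 y} where
  toFun c := ⟨⟨c.1.1, fun d => by simpa using inv_mul_trans c.1.2 c.2 d⟩, c.2⟩
  invFun c := ⟨⟨c.1.1, inv_mul_trans c.1.2 c.2⟩, c.2⟩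
  left_inv _ := rfl
  right_inv _ := rfl

/-- Otherwise the elements common to the `σ`-cycle of `x` and to the cycle of `y` under the product
would avoid both `x` and `y`. There the two permutations agree, so this set would be stable under
`σ`; it contains `σ x`, hence `x`, a contradiction. -/
theorem sameCycle_mul_trans_of_not [Finite D] {σ : Perm D} {x y : D} (h : ¬ σ.SameCycle x y) :
    (σ * trans x y).SameCycle x y := by
  by_contra h'
  have hxy : x ≠ y := by rintro rfl; exact h (Perm.SameCycle.refl _ _)
  let U : Set D := {d | σ.SameCycle x d ∧ (σ * trans x y).SameCycle y d}
  have hU : ∀ d ∈ U, σ d ∈ U := by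
    rintro d ⟨h1, h2⟩
    have hdy : d ≠ y := by rintro rfl; exact h h1
    have hdx : d ≠ x := by rintro rfl; exact h' h2.symm
    refine ⟨by simpa using h1, ?_⟩
    have : (σ * trans x y) d = σ d := by rw [Perm.mul_apply, trans_of_ne hdx hdy]
    rw [← this]
    exact h2.apply_right
  have hx : σ x ∈ U := by
    refine ⟨(Perm.SameCycle.refl σ x).apply_right, ?_⟩
    have : (σ * trans x y) y = σ x := by simp
    rw [← this]
    exact (Perm.SameCycle.refl _ y).apply_right
  have := sameCycle_of_closed (σ := σ) (x := σ x) (y := x)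
    (Perm.SameCycle.refl σ x).apply_left hU hx
  exact h' this.2.symm

/-- Colourings invariant under the product are the `σ`-invariant ones that agree at `x` and `y`.
Flipping the colour of the `σ`-cycle of `x` shows that they are half of all `σ`-invariant Boolean
colourings. -/
theorem numCycles_mul_trans_of_not [Finite D] {σ : Perm D} {x y : D} (h : ¬ σ.SameCycle x y) :
    numCycles (σ * trans x y) + 1 = numCycles σ := by
  classical
  have hs := sameCycle_mul_trans_of_not h
  let e1 : Inv (σ * trans x y) Bool ≃ {c : Inv σ Bool // c.1 x = c.1 y} :=
    (Equiv.subtypeUnivEquiv fun c => eq_of_sameCycle c.2 hs).symm.trans (invMulTrans σ x y Bool)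
  let flip (b : Bool) (c : Inv σ Bool) : Inv σ Bool :=
    ⟨fun d => xor (c.1 d) (b && decide (σ.SameCycle x d)), fun d => by simp [c.2]⟩
  have hflip : ∀ b c, flip b (flip b c) = c := fun b c => by
    refine Subtype.ext ?_
    funext d
    simp [flip]
  let e2 : Inv σ Bool ≃ Bool × {c : Inv σ Bool // c.1 x = c.1 y} :=
    { toFun := fun c => (xor (c.1 x) (c.1 y), ⟨flip (xor (c.1 x) (c.1 y)) c, by
        simp [flip, h, Perm.SameCycle.refl]⟩)
      invFun := fun p => flip p.1 p.2.1
      left_inv := fun c => hflip _ c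
      right_inv := fun ⟨b, c, hc⟩ => by
        have : xor ((flip b c).1 x) ((flip b c).1 y) = b := by
          cases b <;> simp [flip, h, hc, Perm.SameCycle.refl]
        ext1
        · exact this
        · refine Subtype.ext ?_
          change flip (xor ((flip b c).1 x) ((flip b c).1 y)) (flip b c) = c
          rw [this, hflip] }
  have h1 := Nat.card_congr e1
  have h2 := Nat.card_congr e2
  rw [Nat.card_prod, ← h1, card_inv_bool, card_inv_bool] at h2
  refine Nat.pow_right_injective le_rfl ?_
  change 2 ^ _ = 2 ^ _
  rw [h2, pow_succ, mul_comm]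
  simp

theorem cycle_mul_trans_of_not [Finite D] {σ : Perm D} {x y : D} (h : ¬ σ.SameCycle x y) :
    cycle (σ * trans x y) x = cycle σ x ∪ cycle σ y := by
  have hs := sameCycle_mul_trans_of_not h
  ext d
  constructor
  · intro hd
    refine sameCycle_of_closed (S := cycle σ x ∪ cycle σ y) hd ?_ (Or.inl (Perm.SameCycle.refl _ _))
    intro e he
    by_cases hx : e = x
    · subst hx; right; simp [mem_cycle, Perm.SameCycle.refl]
    by_cases hy : e = y
    · subst hy; left; simp [mem_cycle, Perm.SameCycle.refl]
    rw [Perm.mul_apply, trans_of_ne hx hy]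
    simpa [mem_cycle] using he
  · have key : ∀ z, (z = x ∨ z = y) → σ.SameCycle z d → (σ * trans x y).SameCycle z d := by
      intro z hz hd
      have hinv : ∀ e, (σ * trans x y).SameCycle z (σ e) ↔ (σ * trans x y).SameCycle z e := by
        intro e
        have hzx : (σ * trans x y).SameCycle z x := by
          rcases hz with rfl | rfl
          · exact Perm.SameCycle.refl _ _
          · exact hs.symm
        by_cases hx : e = x
        · subst hx
          have : (σ * trans e y) y = σ e := by simp
          rw [← this, Perm.sameCycle_apply_right]
          exact ⟨fun h => h.trans hs.symm, fun h => h.trans hs⟩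
        by_cases hy : e = y
        · subst hy
          have : (σ * trans x e) x = σ e := by simp
          rw [← this, Perm.sameCycle_apply_right]
          exact ⟨fun h => h.trans hs, fun h => h.trans hs.symm⟩
        have : (σ * trans x y) e = σ e := by rw [Perm.mul_apply, trans_of_ne hx hy]
        rw [← this, Perm.sameCycle_apply_right]
      have := eq_of_sameCycle (c := fun e => (σ * trans x y).SameCycle z e)
        (fun e => propext (hinv e)) hd
      exact this ▸ Perm.SameCycle.refl _ z
    rintro (hd | hd)
    · exact key x (Or.inl rfl) hd
    · exact hs.trans (key y (Or.inr rfl) hd)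

theorem ncard_cycle_mul_trans_of_not [Finite D] {σ : Perm D} {x y : D} (h : ¬ σ.SameCycle x y) :
    (cycle (σ * trans x y) x).ncard = (cycle σ x).ncard + (cycle σ y).ncard := by
  rw [cycle_mul_trans_of_not h, Set.ncard_union_eq]
  rw [Set.disjoint_left]
  exact fun d h1 h2 => h (h1.trans h2.symm)

/-! ### Powers along a cycle, and cutting a cycle -/

theorem isCycleOn_cycle (σ : Perm D) (x : D) : σ.IsCycleOn (cycle σ x) :=
  ⟨σ.bijOn fun d => by simp [mem_cycle], fun _ h1 _ h2 => h1.symm.trans h2⟩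

theorem pow_apply_eq_pow_apply [Finite D] (σ : Perm D) (x : D) {i j : ℕ} :
    (σ ^ i) x = (σ ^ j) x ↔ i ≡ j [MOD (cycle σ x).ncard] := by
  have hf := (cycle σ x).toFinite
  have h := isCycleOn_cycle σ x
  rw [← hf.coe_toFinset] at h
  rw [h.pow_apply_eq_pow_apply (by simp [mem_cycle, Perm.SameCycle.refl]),
    Set.ncard_eq_toFinset_card _ hf]

/-- With `L` the length of the cycle, exponents run over `1, …, L` and not `0, …, L - 1`: later they
count the steps from the leg to the dart before which a second leg is inserted, and `L` is the
return to the leg itself. -/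
theorem pow_injOn [Finite D] (σ : Perm D) (x : D) :
    Set.InjOn (fun k => (σ ^ k) x) (Set.Icc 1 (cycle σ x).ncard) := by
  rintro i ⟨hi, hi'⟩ j ⟨hj, hj'⟩ h
  have h : i ≡ j [MOD (cycle σ x).ncard] := (pow_apply_eq_pow_apply σ x).1 h
  rcases le_total i j with hij | hij
  · have := (Nat.modEq_iff_dvd' hij).1 h
    have := Nat.eq_zero_of_dvd_of_lt this (by omega)
    omega
  · have := (Nat.modEq_iff_dvd' hij).1 h.symm
    have := Nat.eq_zero_of_dvd_of_lt this (by omega)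
    omega

theorem exists_pow_eq [Finite D] {σ : Perm D} {x y : D} (h : σ.SameCycle x y) :
    ∃ k ∈ Set.Icc 1 (cycle σ x).ncard, (σ ^ k) x = y := by
  have hf := (cycle σ x).toFinite
  have hc := isCycleOn_cycle σ x
  rw [← hf.coe_toFinset] at hc
  obtain ⟨n, hn, rfl⟩ := hc.exists_pow_eq (a := x) (b := y)
    (by simp [mem_cycle, Perm.SameCycle.refl]) (by simpa [mem_cycle] using h)
  rw [← Set.ncard_eq_toFinset_card _ hf] at hn
  rcases Nat.eq_zero_or_pos n with rfl | h0
  · exact ⟨(cycle σ x).ncard, ⟨ncard_cycle_pos σ x, le_rfl⟩, (pow_apply_eq_pow_apply σ x).2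
      (by simp [Nat.ModEq])⟩
  · exact ⟨n, ⟨h0, hn.le⟩, rfl⟩

theorem pow_ncard_cycle [Finite D] (σ : Perm D) (x : D) : (σ ^ (cycle σ x).ncard) x = x := by
  have := (pow_apply_eq_pow_apply σ x (i := (cycle σ x).ncard) (j := 0)).2 (by simp [Nat.ModEq])
  simpa using this

theorem sameCycle_pow (σ : Perm D) (x : D) (k : ℕ) : σ.SameCycle x ((σ ^ k) x) :=
  Perm.sameCycle_pow_right.2 (Perm.SameCycle.refl σ x)

/-- The product sends `x` to `σ ^ (k + 1) x` and then follows `σ` up to `σ ^ L x = x`, where `L` is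
the length of the cycle; the powers `1, …, k` are cut off. -/
theorem cycle_mul_trans_pow [Finite D] (σ : Perm D) (x : D) {k : ℕ} (hk : 1 ≤ k)
    (hk' : k < (cycle σ x).ncard) :
    cycle (σ * trans x ((σ ^ k) x)) x =
      (fun j => (σ ^ j) x) '' Set.Ioc k (cycle σ x).ncard := by
  set L := (cycle σ x).ncard with hL
  set τ := σ * trans x ((σ ^ k) x) with hτ
  have hinj := pow_injOn σ x
  have hx := pow_ncard_cycle σ x
  have step : ∀ j, k < j → j < L → τ ((σ ^ j) x) = (σ ^ (j + 1)) x := by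
    intro j h1 h2
    rw [hτ, Perm.mul_apply, trans_of_ne, pow_succ', Perm.mul_apply]
    · intro h
      have := hinj (x₁ := j) (x₂ := L) ⟨by omega, h2.le⟩ ⟨by omega, le_rfl⟩ (h.trans hx.symm)
      omega
    · intro h
      have := hinj (x₁ := j) (x₂ := k) ⟨by omega, h2.le⟩ ⟨by omega, hk'.le⟩ h
      omega
  have step0 : τ x = (σ ^ (k + 1)) x := by
    rw [hτ, Perm.mul_apply, trans_left, pow_succ', Perm.mul_apply]
  ext d
  constructor
  · intro hd
    refine sameCycle_of_closed (S := (fun j => (σ ^ j) x) '' Set.Ioc k L) hd ?_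
      ⟨L, ⟨hk', le_rfl⟩, hx⟩
    rintro _ ⟨j, ⟨h1, h2⟩, rfl⟩
    rcases h2.lt_or_eq with h2 | rfl
    · exact ⟨j + 1, ⟨by omega, h2⟩, (step j h1 h2).symm⟩
    · refine ⟨k + 1, ⟨by omega, hk'⟩, ?_⟩
      change _ = τ ((σ ^ L) x)
      rw [hx, step0]
  · rintro ⟨j, ⟨h1, h2⟩, rfl⟩
    induction j, h1 using Nat.le_induction with
    | base =>
      change τ.SameCycle x ((σ ^ (k + 1)) x)
      rw [← step0]
      exact (Perm.SameCycle.refl τ x).apply_right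
    | succ j h1 ih =>
      change τ.SameCycle x ((σ ^ (j + 1)) x)
      rw [← step j h1 (by omega)]
      exact (ih (by omega)).apply_right

theorem ncard_cycle_mul_trans_pow [Finite D] (σ : Perm D) (x : D) {k : ℕ} (hk : 1 ≤ k)
    (hk' : k < (cycle σ x).ncard) :
    (cycle (σ * trans x ((σ ^ k) x)) x).ncard = (cycle σ x).ncard - k := by
  have hsub : Set.Ioc k (cycle σ x).ncard ⊆ Set.Icc 1 (cycle σ x).ncard :=
    fun j hj => ⟨by have := hj.1; omega, hj.2⟩
  rw [cycle_mul_trans_pow σ x hk hk', ((pow_injOn σ x).mono hsub).ncard_image,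
    ← Finset.coe_Ioc, Set.ncard_coe_finset, Nat.card_Ioc]

theorem not_sameCycle_mul_trans [Finite D] {σ : Perm D} {x y : D} (hxy : x ≠ y)
    (h : σ.SameCycle x y) : ¬ (σ * trans x y).SameCycle x y := by
  obtain ⟨k, ⟨hk, hk'⟩, rfl⟩ := exists_pow_eq h
  have hlt : k < (cycle σ x).ncard := by
    refine lt_of_le_of_ne hk' ?_
    rintro rfl
    exact hxy (pow_ncard_cycle σ x).symm
  intro h'
  have : (σ ^ k) x ∈ cycle (σ * trans x ((σ ^ k) x)) x := h'
  rw [cycle_mul_trans_pow σ x hk hlt] at this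
  obtain ⟨j, ⟨h1, h2⟩, h3⟩ := this
  have := pow_injOn σ x (x₁ := j) (x₂ := k) ⟨by omega, h2⟩ ⟨hk, hk'⟩ h3
  omega

/-- The transposition is an involution, so this is the merging of two cycles read backwards. -/
theorem numCycles_mul_trans_of_sameCycle [Finite D] {σ : Perm D} {x y : D} (hxy : x ≠ y)
    (h : σ.SameCycle x y) : numCycles (σ * trans x y) = numCycles σ + 1 := by
  have := numCycles_mul_trans_of_not (not_sameCycle_mul_trans hxy h)
  rw [mul_trans_mul_self] at this
  exact this.symm

theorem insertAfter_pow (σ : Perm D) {x y : D} {i : ℕ} (h : ∀ j < i, (σ ^ j) x ≠ y) :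
    (insertAfter σ y ^ i) (some x) = some ((σ ^ i) x) := by
  induction i with
  | zero => rfl
  | succ i ih =>
    rw [pow_succ', Perm.mul_apply, ih fun j hj => h j (by omega),
      insertAfter_of_ne σ (h i (by omega)), pow_succ', Perm.mul_apply]

/-- Splitting a cycle at an inserted element. -/
theorem ncard_cycle_split [Finite D] (σ : Perm D) (x : D) {k : ℕ}
    (hk : k ∈ Set.Icc 1 (cycle σ x).ncard) :
    (cycle (insertAfter (insertBefore σ ((σ ^ k) x)) none * trans (some (some x)) (some none))
      (some (some x))).ncard = (cycle σ x).ncard + 2 - k := by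
  obtain ⟨k, rfl⟩ : ∃ l, k = l + 1 := ⟨k - 1, by have := hk.1; omega⟩
  have hk' : k + 1 ≤ (cycle σ x).ncard := hk.2
  -- The predecessor of `σ ^ (k + 1) x` is `σ ^ k x`; inserting after it leaves the first `k` steps
  -- from `x` unchanged.
  have hy : insertBefore σ ((σ ^ (k + 1)) x) = insertAfter σ ((σ ^ k) x) := by
    rw [insertBefore_eq, pow_succ', Perm.mul_apply, Equiv.symm_apply_apply]
  rw [hy]
  have hne : ∀ j < k, (σ ^ j) x ≠ (σ ^ k) x := by
    intro j hj h
    have := (pow_apply_eq_pow_apply σ x).1 h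
    have := (Nat.modEq_iff_dvd' hj.le).1 this
    have := Nat.eq_zero_of_dvd_of_lt this (by omega)
    omega
  have h1 : ∀ j < k + 1, (insertAfter σ ((σ ^ k) x) ^ j) (some x) = some ((σ ^ j) x) :=
    fun j hj => insertAfter_pow σ fun i hi => hne i (by omega)
  have h2 : (insertAfter σ ((σ ^ k) x) ^ (k + 1)) (some x) = none := by
    rw [pow_succ', Perm.mul_apply, h1 k (by omega), insertAfter_self]
  -- The second insertion comes after the new leg and does not delay reaching it in `k + 1` steps.
  have h3 : (insertAfter (insertAfter σ ((σ ^ k) x)) none ^ (k + 1)) (some (some x)) =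
      some none := by
    rw [insertAfter_pow, h2]
    intro j hj
    rw [h1 j hj]
    simp
  have hs : σ.SameCycle x ((σ ^ k) x) := sameCycle_pow σ x k
  have hc : (cycle (insertAfter (insertAfter σ ((σ ^ k) x)) none) (some (some x))).ncard =
      (cycle σ x).ncard + 2 := by
    rw [ncard_cycle_insertAfter_of_sameCycle, ncard_cycle_insertAfter_of_sameCycle hs]
    rwa [sameCycle_insertAfter_some_none]
  rw [← h3, ncard_cycle_mul_trans_pow _ _ (by omega) (by omega), hc]

/-! ### Sums of permutations -/

theorem sameCycle_sumCongr_inl (σ : Perm D) (σ' : Perm D') (u v : D) :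
    (Perm.sumCongr σ σ').SameCycle (Sum.inl u) (Sum.inl v) ↔ σ.SameCycle u v := by
  rw [sameCycle_iff_forall, sameCycle_iff_forall]
  refine ⟨fun h c hc => h (Sum.elim c fun _ => True) ?_, fun h c hc => h (fun d => c (Sum.inl d)) ?_⟩
  · rintro (d | d) <;> simp [hc]
  · intro d
    exact hc (Sum.inl d)

theorem sameCycle_sumCongr_inr (σ : Perm D) (σ' : Perm D') (u v : D') :
    (Perm.sumCongr σ σ').SameCycle (Sum.inr u) (Sum.inr v) ↔ σ'.SameCycle u v := by
  rw [sameCycle_iff_forall, sameCycle_iff_forall]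
  refine ⟨fun h c hc => h (Sum.elim (fun _ => True) c) ?_, fun h c hc => h (fun d => c (Sum.inr d)) ?_⟩
  · rintro (d | d) <;> simp [hc]
  · intro d
    exact hc (Sum.inr d)

theorem not_sameCycle_sumCongr (σ : Perm D) (σ' : Perm D') (u : D) (v : D') :
    ¬ (Perm.sumCongr σ σ').SameCycle (Sum.inl u) (Sum.inr v) := by
  intro h
  have := eq_of_sameCycle (c := Sum.isLeft) (by rintro (d | d) <;> rfl) h
  simp at this

theorem ncard_cycle_sumCongr_inl (σ : Perm D) (σ' : Perm D') (u : D) :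
    (cycle (Perm.sumCongr σ σ') (Sum.inl u)).ncard = (cycle σ u).ncard := by
  rw [← Set.ncard_image_of_injective _ (Sum.inl_injective (α := D) (β := D'))]
  congr 1
  ext (d | d)
  · simp [mem_cycle, sameCycle_sumCongr_inl]
  · simp [mem_cycle, not_sameCycle_sumCongr]

theorem ncard_cycle_sumCongr_inr (σ : Perm D) (σ' : Perm D') (u : D') :
    (cycle (Perm.sumCongr σ σ') (Sum.inr u)).ncard = (cycle σ' u).ncard := by
  rw [← Set.ncard_image_of_injective _ (Sum.inr_injective (α := D) (β := D'))]
  congr 1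
  ext (d | d)
  · simpa [mem_cycle] using fun h => not_sameCycle_sumCongr σ σ' d u (Perm.SameCycle.symm h)
  · simp [mem_cycle, sameCycle_sumCongr_inr]

/-- The invariant colourings of a sum. -/
def invSumCongr (σ : Perm D) (σ' : Perm D') (X : Type) :
    Inv (Perm.sumCongr σ σ') X ≃ Inv σ X × Inv σ' X where
  toFun c := (⟨fun d => c.1 (Sum.inl d), fun d => c.2 (Sum.inl d)⟩,
    ⟨fun d => c.1 (Sum.inr d), fun d => c.2 (Sum.inr d)⟩)
  invFun p := ⟨Sum.elim p.1.1 p.2.1, by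
    rintro (d | d)
    · exact p.1.2 d
    · exact p.2.2 d⟩
  left_inv c := by
    refine Subtype.ext ?_
    funext d
    cases d <;> rfl
  right_inv p := rfl

theorem numCycles_sumCongr [Finite D] [Finite D'] (σ : Perm D) (σ' : Perm D') :
    numCycles (Perm.sumCongr σ σ') = numCycles σ + numCycles σ' := by
  have h := Nat.card_congr (invSumCongr σ σ' Bool)
  rw [Nat.card_prod, card_inv_bool, card_inv_bool, card_inv_bool, ← pow_add] at h
  exact Nat.pow_right_injective le_rfl h

end PermCycles

/-! ### Recognising insertions and transporting them along bijections -/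

namespace PermCycles

open Equiv

variable {D : Type} {D' : Type}

theorem optionCongr_mul (σ τ : Perm D) : optionCongr (σ * τ) = optionCongr σ * optionCongr τ := by
  ext1 o
  cases o <;> rfl

theorem exists_optionCongr {τ : Option D ≃ Option D'} (h : τ none = none) :
    ∃ σ : D ≃ D', τ = optionCongr σ := by
  refine ⟨removeNone τ, ?_⟩
  ext1 o
  cases o with
  | none => simpa using h
  | some d =>
    have : τ (some d) ≠ none := fun h' => by simpa using τ.injective (h'.trans h.symm)
    obtain ⟨e, he⟩ := Option.ne_none_iff_exists'.1 this
    exact (removeNone_some τ ⟨e, he⟩).symm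

theorem exists_insertAfter {τ : Perm (Option D)} {y : D} (h : τ (some y) = none) :
    ∃ σ : Perm D, τ = insertAfter σ y := by
  obtain ⟨σ, hσ⟩ := exists_optionCongr (τ := τ * trans none (some y)) (by simpa using h)
  refine ⟨σ, ?_⟩
  rw [insertAfter, ← hσ, mul_trans_mul_self]

theorem exists_insertBefore {τ : Perm (Option D)} {y : D} (h : τ none = some y) :
    ∃ σ : Perm D, τ = insertBefore σ y := by
  obtain ⟨σ, hσ⟩ := exists_optionCongr (τ := trans none (some y) * τ) (by simp [h])
  refine ⟨σ, ?_⟩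
  rw [insertBefore, ← hσ, ← mul_assoc, trans_mul_self, one_mul]

theorem map_insertAfter (π : D ≃ D') {σ : Perm D} {σ' : Perm D'} (h : ∀ d, π (σ d) = σ' (π d))
    (y : D) (o : Option D) :
    optionCongr π (insertAfter σ y o) = insertAfter σ' (π y) (optionCongr π o) := by
  cases o with
  | none => simp [h]
  | some d =>
    by_cases hd : d = y
    · subst hd; simp
    · simp [insertAfter_of_ne σ hd, insertAfter_of_ne σ' (π.injective.ne hd), h]

theorem map_insertBefore (π : D ≃ D') {σ : Perm D} {σ' : Perm D'} (h : ∀ d, π (σ d) = σ' (π d))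
    (y : D) (o : Option D) :
    optionCongr π (insertBefore σ y o) = insertBefore σ' (π y) (optionCongr π o) := by
  rw [insertBefore_eq, insertBefore_eq, map_insertAfter π h]
  congr 2
  rw [Equiv.eq_symm_apply, ← h, Equiv.apply_symm_apply]

theorem eq_of_map_insertAfter (π : D ≃ D') {σ : Perm D} {σ' : Perm D'} {y : D}
    (h : ∀ o, optionCongr π (insertAfter σ y o) = insertAfter σ' (π y) (optionCongr π o)) (d : D) :
    π (σ d) = σ' (π d) := by
  by_cases hd : d = y
  · subst hd
    simpa using h none
  · simpa [insertAfter_of_ne σ hd, insertAfter_of_ne σ' (π.injective.ne hd)] using h (some d)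

theorem eq_of_map_insertBefore (π : D ≃ D') {σ : Perm D} {σ' : Perm D'} {y : D} {y' : D'}
    (h : ∀ o, optionCongr π (insertBefore σ y o) = insertBefore σ' y' (optionCongr π o)) :
    π y = y' ∧ ∀ d, π (σ d) = σ' (π d) := by
  have hy : π y = y' := by simpa using h none
  refine ⟨hy, fun d => ?_⟩
  subst hy
  by_cases hd : σ d = y
  · have := h (some d)
    rw [insertBefore_of_eq σ hd] at this
    by_contra hne
    rw [hd] at hne
    simp [insertBefore_of_ne σ' (Ne.symm hne)] at this
  · by_cases hd' : σ' (π d) = π y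
    · have := h (some d)
      simp [insertBefore_of_ne σ hd, insertBefore_of_eq σ' hd'] at this
    · simpa [insertBefore_of_ne σ hd, insertBefore_of_ne σ' hd'] using h (some d)

/-- When `none` stands between `d` and `σ d`, two applications pass over it. -/
theorem closed_of_insertAfter {σ : Perm D} {y : D} {S : Set (Option D)}
    (h : ∀ d ∈ S, insertAfter σ y d ∈ S) (d : D) (hd : some d ∈ S) : some (σ d) ∈ S := by
  by_cases hy : d = y
  · subst hy
    have := h _ (h _ hd)
    simpa using this
  · simpa [insertAfter_of_ne σ hy] using h _ hd

theorem insertAfter_closed {σ : Perm D} {y : D} {S : Set D} (h : ∀ d ∈ S, σ d ∈ S) (hy : y ∈ S)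
    (o : Option D) (ho : o ∈ insert none (some '' S)) :
    insertAfter σ y o ∈ insert none (some '' S) := by
  rcases ho with rfl | ⟨d, hd, rfl⟩
  · simpa using h y hy
  · by_cases hdy : d = y
    · subst hdy; simp
    · simpa [insertAfter_of_ne σ hdy] using h d hd

end PermCycles

open PermCycles Equiv

/-! ## Maps with a marked corner -/

/-- A map with a dangling half-edge, the leg, in one of its corners. The leg is the dart `root`;
it is the only fixed point of `opp`. The atomic map is a leg alone. -/
structure LegMap (D : Type) where
  rot : Perm D
  opp : Perm D
  root : D

namespace LegMap

variable {D D' D'' K K' : Type}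

/-- The permutation whose cycles are the faces. -/
def face (M : LegMap D) : Perm D := M.rot * M.opp

/-- The second dart of the root-edge, that is, of the edge that follows the leg. -/
def mate (M : LegMap D) : D := M.opp (M.rot M.root)

/-- The dual map. -/
def dual (M : LegMap D) : LegMap D := ⟨M.rot * M.opp, M.opp, M.root⟩

/-- A connected map with a leg, on any surface. -/
structure Conn (M : LegMap D) : Prop where
  opp_opp : ∀ d, M.opp (M.opp d) = d
  opp_eq_iff : ∀ d, M.opp d = d ↔ d = M.root
  gen : ∀ S : Set D, M.root ∈ S → (∀ d ∈ S, M.rot d ∈ S) → (∀ d ∈ S, M.opp d ∈ S) → ∀ d, d ∈ S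

/-- Isomorphism of maps with a leg. -/
def Iso (M : LegMap D) (N : LegMap D') : Prop :=
  ∃ π : D ≃ D', (∀ d, π (M.rot d) = N.rot (π d)) ∧ (∀ d, π (M.opp d) = N.opp (π d)) ∧
    π M.root = N.root

/-- A connected planar map with a leg. -/
structure Planar [Finite D] (M : LegMap D) : Prop extends Conn M where
  euler : 2 * (numCycles M.rot + numCycles M.face) = Nat.card D + 3

theorem Conn.opp_root {M : LegMap D} (h : M.Conn) : M.opp M.root = M.root :=
  (h.opp_eq_iff _).2 rfl

theorem Iso.symm {M : LegMap D} {N : LegMap D'} (h : M.Iso N) : N.Iso M := by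
  obtain ⟨π, h1, h2, h3⟩ := h
  exact ⟨π.symm, fun d => π.injective (by simp [h1]), fun d => π.injective (by simp [h2]),
    by simp [← h3]⟩

theorem Iso.trans {M : LegMap D} {N : LegMap D'} {P : LegMap D''} (h : M.Iso N) (k : N.Iso P) :
    M.Iso P := by
  obtain ⟨π, h1, h2, h3⟩ := h
  obtain ⟨ρ, k1, k2, k3⟩ := k
  exact ⟨π.trans ρ, fun d => by simp [h1, k1], fun d => by simp [h2, k2], by simp [h3, k3]⟩

theorem Iso.dual {M : LegMap D} {N : LegMap D'} (h : M.Iso N) : M.dual.Iso N.dual := by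
  obtain ⟨π, h1, h2, h3⟩ := h
  exact ⟨π, fun d => by simp [LegMap.dual, h1, h2], h2, h3⟩

theorem Iso.card_eq {M : LegMap D} {N : LegMap D'} (h : M.Iso N) : Nat.card D = Nat.card D' :=
  Nat.card_congr h.choose

theorem Iso.numCycles_rot {M : LegMap D} {N : LegMap D'} (h : M.Iso N) :
    numCycles M.rot = numCycles N.rot := by
  obtain ⟨π, h1, -, -⟩ := h
  exact numCycles_congr π _ _ h1

theorem Iso.numCycles_face {M : LegMap D} {N : LegMap D'} (h : M.Iso N) :
    numCycles M.face = numCycles N.face :=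
  h.dual.numCycles_rot

theorem Iso.conn {M : LegMap D} {N : LegMap D'} (h : M.Iso N) (hM : M.Conn) : N.Conn := by
  obtain ⟨π, h1, h2, h3⟩ := h
  refine ⟨fun d => ?_, fun d => ?_, fun S hr hrot hopp d => ?_⟩
  · obtain ⟨d, rfl⟩ := π.surjective d
    rw [← h2, ← h2, hM.opp_opp]
  · obtain ⟨d, rfl⟩ := π.surjective d
    rw [← h2, ← h3, π.injective.eq_iff, π.injective.eq_iff, hM.opp_eq_iff]
  · obtain ⟨d, rfl⟩ := π.surjective d
    exact hM.gen (π ⁻¹' S) (by simpa [h3] using hr)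
      (fun d hd => by simpa [h1] using hrot _ hd) (fun d hd => by simpa [h2] using hopp _ hd) d

theorem Iso.planar [Finite D] [Finite D'] {M : LegMap D} {N : LegMap D'} (h : M.Iso N)
    (hM : M.Planar) : N.Planar where
  toConn := h.conn hM.toConn
  euler := by rw [← h.numCycles_rot, ← h.numCycles_face, hM.euler, h.card_eq]

theorem Conn.dual_dual {M : LegMap D} (h : M.Conn) : M.dual.dual = M := by
  cases M with
  | mk rot opp root =>
    simp only [LegMap.dual, LegMap.mk.injEq, and_true]
    ext1 d
    simp [h.opp_opp d]

theorem Conn.face_dual {M : LegMap D} (h : M.Conn) : M.dual.face = M.rot :=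
  congrArg LegMap.rot h.dual_dual

theorem Conn.dual {M : LegMap D} (h : M.Conn) : M.dual.Conn where
  opp_opp := h.opp_opp
  opp_eq_iff := h.opp_eq_iff
  gen S hr hrot hopp := h.gen S hr (fun d hd => by
    have := hrot _ (hopp d hd)
    simp only [LegMap.dual, Perm.mul_apply] at this
    rwa [h.opp_opp] at this) hopp

theorem Planar.dual [Finite D] {M : LegMap D} (h : M.Planar) : M.dual.Planar where
  toConn := h.toConn.dual
  euler := by
    rw [h.toConn.face_dual, ← h.euler]
    change 2 * (numCycles M.face + _) = _
    ring

theorem Conn.mate_dual {M : LegMap D} (h : M.Conn) : M.dual.mate = M.mate := by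
  simp [LegMap.dual, mate, h.opp_root]

/-- The image of a map under a bijection. -/
def map (M : LegMap D) (π : D ≃ D') : LegMap D' :=
  ⟨π.permCongr M.rot, π.permCongr M.opp, π M.root⟩

theorem iso_map (M : LegMap D) (π : D ≃ D') : M.Iso (M.map π) :=
  ⟨π, fun d => by simp [map], fun d => by simp [map], rfl⟩

/-- An automorphism of a connected map that fixes the root is the identity. -/
theorem Conn.eq_of_automorphism {M : LegMap D} (h : M.Conn) {π : D → D}
    (h1 : ∀ d, π (M.rot d) = M.rot (π d)) (h2 : ∀ d, π (M.opp d) = M.opp (π d))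
    (h3 : π M.root = M.root) (d : D) : π d = d :=
  h.gen {d | π d = d} h3 (fun d (hd : π d = d) => by simp [h1, hd])
    (fun d (hd : π d = d) => by simp [h2, hd]) d

/-- If the root-edge has two darts, the root is not fixed by the rotation. -/
theorem Conn.rot_root_ne [Finite D] {M : LegMap D} (h : M.Conn) (hD : 1 < Nat.card D) :
    M.rot M.root ≠ M.root := by
  intro hr
  have := h.gen {M.root} rfl (by simpa using hr) (by simpa using h.opp_root)
  have hs : Subsingleton D := ⟨fun a b => (this a).trans (this b).symm⟩
  have := Finite.card_le_one_iff_subsingleton.2 hs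
  omega

/-! ### Attaching a root-edge -/

/-- The map obtained from a structure with two legs `r` and `b` by completing `b` to an edge,
whose other dart is inserted after `r`. -/
def attach (ρ ω : Perm K) (r b : K) : LegMap (Option K) :=
  ⟨insertAfter ρ r, insertAfter ω b, some r⟩

/-- The structures with two legs that give connected maps. -/
structure TwoLegs (ρ ω : Perm K) (r b : K) : Prop where
  ne : r ≠ b
  opp_opp : ∀ d, ω (ω d) = d
  opp_eq_iff : ∀ d, ω d = d ↔ d = r ∨ d = b
  gen : ∀ S : Set K, r ∈ S → b ∈ S → (∀ d ∈ S, ρ d ∈ S) → (∀ d ∈ S, ω d ∈ S) → ∀ d, d ∈ S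

theorem TwoLegs.opp_left {ρ ω : Perm K} {r b : K} (h : TwoLegs ρ ω r b) : ω r = r :=
  (h.opp_eq_iff r).2 (Or.inl rfl)

theorem TwoLegs.opp_right {ρ ω : Perm K} {r b : K} (h : TwoLegs ρ ω r b) : ω b = b :=
  (h.opp_eq_iff b).2 (Or.inr rfl)

theorem TwoLegs.conn {ρ ω : Perm K} {r b : K} (h : TwoLegs ρ ω r b) : (attach ρ ω r b).Conn where
  opp_opp := by
    rintro (_ | d)
    · simp [attach, h.opp_right]
    · by_cases hd : d = b
      · subst hd; simp [attach, h.opp_right]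
      · have : ω d ≠ b := fun h' => hd (ω.injective (h'.trans h.opp_right.symm))
        simp [attach, insertAfter_of_ne ω hd, insertAfter_of_ne ω this, h.opp_opp]
  opp_eq_iff := by
    rintro (_ | d)
    · simp [attach]
    · by_cases hd : d = b
      · subst hd; simp [attach, h.ne.symm]
      · simp [attach, insertAfter_of_ne ω hd, h.opp_eq_iff, hd]
  gen S hr hrot hopp := by
    have hr' : some r ∈ S := hr
    have h0 : none ∈ S := by simpa [attach] using hrot _ hr'
    have hb : some b ∈ S := by simpa [attach, h.opp_right] using hopp _ h0
    rintro (_ | d)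
    · exact h0
    · exact h.gen (some ⁻¹' S) hr hb (fun d hd => closed_of_insertAfter hrot d hd)
        (fun d hd => closed_of_insertAfter hopp d hd) d

theorem twoLegs_of_conn {ρ ω : Perm K} {r b : K} (h : (attach ρ ω r b).Conn) (hb : ω b = b)
    (hrb : r ≠ b) : TwoLegs ρ ω r b where
  ne := hrb
  opp_opp d := by
    by_cases hd : d = b
    · subst hd; simp [hb]
    · have : ω d ≠ b := fun h' => hd (ω.injective (h'.trans hb.symm))
      simpa [attach, insertAfter_of_ne ω hd, insertAfter_of_ne ω this] using h.opp_opp (some d)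
  opp_eq_iff d := by
    by_cases hd : d = b
    · subst hd; simp [hb]
    · simpa [attach, insertAfter_of_ne ω hd, hd] using h.opp_eq_iff (some d)
  gen S hr hb hrot hopp d := by
    have := h.gen (insert none (some '' S)) (by simpa [attach] using hr)
      (insertAfter_closed hrot hr) (insertAfter_closed hopp hb) (some d)
    simpa using this

/-- Both legs are fixed by `ω`, so `ρ * ω` sends them to `ρ r` and `ρ b`. In the attached map `r` is
followed by the new dart and then by `ρ b`, while `b` is followed by `ρ r`: up to an insertion, the
successors of the legs are exchanged. The effect of an edge on the faces is thus that of a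
transposition on cycles. -/
theorem face_attach {ρ ω : Perm K} {r b : K} (h : TwoLegs ρ ω r b) :
    (attach ρ ω r b).face = insertAfter (ρ * ω) b * PermCycles.trans (some r) (some b) := by
  ext1 o
  rw [face, Perm.mul_apply, Perm.mul_apply]
  cases o with
  | none =>
    rw [trans_of_ne (by simp) (by simp)]
    simp [attach, h.opp_right, insertAfter_of_ne ρ h.ne.symm]
  | some d =>
    by_cases hr : d = r
    · subst hr
      simp [attach, insertAfter_of_ne ω h.ne, h.opp_left]
    by_cases hb : d = b
    · subst hb
      simp [attach, insertAfter_of_ne (ρ * ω) h.ne, h.opp_left]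
    have : ω d ≠ r := fun h' => hr (ω.injective (h'.trans h.opp_left.symm))
    rw [trans_of_ne (by simpa) (by simpa), insertAfter_of_ne _ hb]
    simp [attach, insertAfter_of_ne ω hb, insertAfter_of_ne ρ this]

@[simp] theorem attach_rot (ρ ω : Perm K) (r b : K) : (attach ρ ω r b).rot = insertAfter ρ r := rfl

@[simp] theorem attach_opp (ρ ω : Perm K) (r b : K) : (attach ρ ω r b).opp = insertAfter ω b := rfl

@[simp] theorem attach_root (ρ ω : Perm K) (r b : K) : (attach ρ ω r b).root = some r := rfl

theorem TwoLegs.mate_attach {ρ ω : Perm K} {r b : K} (h : TwoLegs ρ ω r b) :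
    (attach ρ ω r b).mate = some b := by
  simp [attach, mate, h.opp_right]

theorem attach_iso (π : K ≃ K') {ρ ω : Perm K} {ρ' ω' : Perm K'} (h1 : ∀ d, π (ρ d) = ρ' (π d))
    (h2 : ∀ d, π (ω d) = ω' (π d)) (r b : K) :
    (attach ρ ω r b).Iso (attach ρ' ω' (π r) (π b)) :=
  ⟨optionCongr π, map_insertAfter π h1 r, map_insertAfter π h2 b, rfl⟩

/-- Isomorphisms of maps with a root-edge restrict to the structures with two legs. -/
theorem exists_of_iso_attach {ρ ω : Perm K} {r b : K} {ρ' ω' : Perm K'} {r' b' : K'}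
    (h : TwoLegs ρ ω r b) (h' : TwoLegs ρ' ω' r' b')
    (hi : (attach ρ ω r b).Iso (attach ρ' ω' r' b')) :
    ∃ π : K ≃ K', (∀ d, π (ρ d) = ρ' (π d)) ∧ (∀ d, π (ω d) = ω' (π d)) ∧ π r = r' ∧ π b = b' := by
  obtain ⟨θ, h1, h2, h3⟩ := hi
  simp only [attach_rot, attach_opp, attach_root] at h1 h2 h3
  -- The new dart is the one that follows the leg, so it is preserved.
  have h0 : θ none = none := by
    have := h1 (some r)
    rwa [insertAfter_self, h3, insertAfter_self] at this
  obtain ⟨π, rfl⟩ := exists_optionCongr h0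
  have hr : π r = r' := by simpa using h3
  have hb : π b = b' := by
    have := h2 none
    simpa [h.opp_right, h'.opp_right] using this
  subst hr hb
  exact ⟨π, eq_of_map_insertAfter π h1, eq_of_map_insertAfter π h2, rfl, rfl⟩

/-- Every connected map with at least one edge is obtained by attaching a root-edge. -/
theorem Conn.exists_attach [Finite D] {M : LegMap D} (h : M.Conn) (hD : 1 < Nat.card D) :
    ∃ (K : Type) (_ : Finite K) (ρ ω : Perm K) (r b : K), TwoLegs ρ ω r b ∧
      M.Iso (attach ρ ω r b) := by
  classical
  let e : D ≃ Option {x // x ≠ M.rot M.root} := (Equiv.optionSubtypeNe (M.rot M.root)).symm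
  have hi := M.iso_map e
  have hc := hi.conn h
  have hrr := h.rot_root_ne hD
  generalize hN : M.map e = N at *
  have he : e (M.rot M.root) = none := by
    rw [Equiv.symm_apply_eq]
    rfl
  have h1 : N.rot N.root = none := by
    rw [← hN]
    simpa [LegMap.map] using he
  have h2 : N.root ≠ none := by
    rw [← hN]
    intro h'
    exact hrr (e.injective (he.trans h'.symm))
  obtain ⟨r, hr⟩ := Option.ne_none_iff_exists'.1 h2
  have h3 : N.opp none ≠ none := by
    rw [Ne, hc.opp_eq_iff]
    exact h2.symm
  obtain ⟨b, hb⟩ := Option.ne_none_iff_exists'.1 h3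
  have hb' : N.opp (some b) = none := by rw [← hb, hc.opp_opp]
  obtain ⟨ρ, hρ⟩ := exists_insertAfter (hr ▸ h1)
  obtain ⟨ω, hω⟩ := exists_insertAfter hb'
  have hNa : N = attach ρ ω r b := by
    rw [attach, ← hρ, ← hω, ← hr]
  have hrb : r ≠ b := by
    rintro rfl
    have := hc.opp_root
    rw [hr, hb'] at this
    simp at this
  have hωb : ω b = b := by
    rw [hω] at hb
    simpa using hb
  rw [hNa] at hc hi
  exact ⟨_, inferInstance, ρ, ω, r, b, twoLegs_of_conn hc hωb hrb, hi⟩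

/-! ### Adding a root-edge to a map -/

/-- The structure with two legs obtained by inserting a second leg before `d`. -/
def add (M : LegMap D) (d : D) : LegMap (Option (Option D)) :=
  attach (insertBefore M.rot d) (optionCongr M.opp) (some M.root) none

/-- Insertion before `y` is a multiplication on the left, so it passes through a multiplication on
the right. Hence a leg inserted before a dart around its vertex also precedes it along its face. -/
theorem insertBefore_mul_optionCongr (σ τ : Perm D) (y : D) :
    insertBefore σ y * optionCongr τ = insertBefore (σ * τ) y := by
  rw [insertBefore, insertBefore, optionCongr_mul, mul_assoc]

theorem Conn.twoLegs {M : LegMap D} (h : M.Conn) (d : D) :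
    TwoLegs (insertBefore M.rot d) (optionCongr M.opp) (some M.root) none where
  ne := by simp
  opp_opp := by rintro (_ | e) <;> simp [h.opp_opp]
  opp_eq_iff := by rintro (_ | e) <;> simp [h.opp_eq_iff]
  gen S hr hb hrot hopp := by
    rw [insertBefore_eq] at hrot
    rintro (_ | e)
    · exact hb
    · exact h.gen (some ⁻¹' S) hr (fun e he => closed_of_insertAfter hrot e he)
        (fun e he => hopp _ he) e

theorem Conn.add {M : LegMap D} (h : M.Conn) (d : D) : (M.add d).Conn := (h.twoLegs d).conn

theorem Conn.mate_add {M : LegMap D} (h : M.Conn) (d : D) : (M.add d).mate = some none :=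
  (h.twoLegs d).mate_attach

theorem Conn.face_add {M : LegMap D} (h : M.Conn) (d : D) : (M.add d).face =
    insertAfter (insertBefore M.face d) none *
      PermCycles.trans (some (some M.root)) (some none) := by
  rw [LegMap.add, face_attach (h.twoLegs d), insertBefore_mul_optionCongr, face]

/-- A structure with two legs in which all darts are connected to the first leg is obtained by
inserting a leg. -/
theorem TwoLegs.exists_add [Finite K] {ρ ω : Perm K} {r b : K} (h : TwoLegs ρ ω r b)
    (hg : ∀ S : Set K, r ∈ S → (∀ d ∈ S, ρ d ∈ S) → (∀ d ∈ S, ω d ∈ S) → b ∈ S) :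
    ∃ (D : Type) (_ : Finite D) (M : LegMap D) (d : D), M.Conn ∧
      (attach ρ ω r b).Iso (M.add d) := by
  classical
  let e : K ≃ Option {x // x ≠ b} := (Equiv.optionSubtypeNe b).symm
  have heb : e b = none := by
    rw [Equiv.symm_apply_eq]
    rfl
  have hi := attach_iso e (ρ := ρ) (ω := ω) (ρ' := e.permCongr ρ) (ω' := e.permCongr ω)
    (by simp) (by simp) r b
  rw [heb] at hi
  have hr0 : e r ≠ none := fun h' => h.ne (e.injective (h'.trans heb.symm))
  obtain ⟨r', hr'⟩ := Option.ne_none_iff_exists'.1 hr0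
  have hω0 : e.permCongr ω none = none := by
    rw [← heb]; simp [h.opp_right]
  -- If the second leg were alone at its vertex, the complement of `b` would be stable, and `hg`
  -- would put `b` in it.
  have hρ0 : e.permCongr ρ none ≠ none := by
    rw [← heb]
    simp only [permCongr_apply, symm_apply_apply, Ne, e.injective.eq_iff]
    intro hb
    have hb' : ρ.symm b = b := by rw [Equiv.symm_apply_eq, hb]
    have := hg {b}ᶜ (by simpa using h.ne)
      (fun d hd h' => hd (by simpa [hb'] using (Equiv.eq_symm_apply ρ).2 h'))
      (fun d hd h' => hd (ω.injective ((h' : ω d = b).trans h.opp_right.symm)))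
    exact this rfl
  obtain ⟨d, hd⟩ := Option.ne_none_iff_exists'.1 hρ0
  obtain ⟨σ, hσ⟩ := exists_insertBefore hd
  obtain ⟨τ, hτ⟩ := exists_optionCongr hω0
  have hρe : ∀ x, insertBefore σ d (e x) = e (ρ x) := fun x => by rw [← hσ]; simp
  have hωe : ∀ x, optionCongr τ (e x) = e (ω x) := fun x => by rw [← hτ]; simp
  refine ⟨_, inferInstance, ⟨σ, τ, r'⟩, d, ⟨fun x => ?_, fun x => ?_, fun S hr hS1 hS2 x => ?_⟩, ?_⟩
  · obtain ⟨y, hy⟩ := e.surjective (some x)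
    have : optionCongr τ (optionCongr τ (some x)) = some x := by
      rw [← hy, hωe, hωe, h.opp_opp]
    simpa using this
  · obtain ⟨y, hy⟩ := e.surjective (some x)
    have hyb : y ≠ b := by rintro rfl; rw [heb] at hy; simp at hy
    have : optionCongr τ (some x) = some x ↔ some x = some r' := by
      rw [← hy, hωe, e.injective.eq_iff, h.opp_eq_iff, ← hr', e.injective.eq_iff]
      simp [hyb]
    simpa using this
  -- Membership in `S` is extended to the removed leg by giving it the status of the dart `d` that
  -- follows it.
  · let P : Option {x // x ≠ b} → Prop := fun o => o.elim (d ∈ S) (· ∈ S)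
    have hP1 : ∀ k, P (e k) → P (e (ρ k)) := by
      intro k
      rw [← hρe]
      cases e k with
      | none => exact fun hk => by simpa [P] using hk
      | some y =>
        intro hy
        have hy' : σ y ∈ S := hS1 y hy
        by_cases hyd : σ y = d
        · rw [insertBefore_of_eq σ hyd]
          change d ∈ S
          rwa [← hyd]
        · rw [insertBefore_of_ne σ hyd]
          exact hy'
    have hP2 : ∀ k, P (e k) → P (e (ω k)) := by
      intro k
      rw [← hωe]
      cases e k with
      | none => exact id
      | some y => exact hS2 y
    have hP3 : P (e r) := by rw [hr']; exact hr
    have hP4 : P (e b) := hg {k | P (e k)} hP3 hP1 hP2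
    obtain ⟨y, hy⟩ := e.surjective (some x)
    have := h.gen {k | P (e k)} hP3 hP4 hP1 hP2 y
    simpa [hy, P] using this
  · rwa [hσ, hτ, hr'] at hi

/-! ### Joining two maps by a root-edge -/

/-- Two maps joined by a root-edge. -/
def join (A : LegMap D) (B : LegMap D') : LegMap (Option (D ⊕ D')) :=
  attach (Perm.sumCongr A.rot B.rot) (Perm.sumCongr A.opp B.opp) (Sum.inl A.root) (Sum.inr B.root)

theorem Conn.twoLegs_sum {A : LegMap D} {B : LegMap D'} (hA : A.Conn) (hB : B.Conn) :
    TwoLegs (Perm.sumCongr A.rot B.rot) (Perm.sumCongr A.opp B.opp) (Sum.inl A.root)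
      (Sum.inr B.root) where
  ne := by simp
  opp_opp := by rintro (d | d) <;> simp [hA.opp_opp, hB.opp_opp]
  opp_eq_iff := by rintro (d | d) <;> simp [hA.opp_eq_iff, hB.opp_eq_iff]
  gen S hr hb hrot hopp := by
    rintro (d | d)
    · exact hA.gen (Sum.inl ⁻¹' S) hr (fun d hd => hrot _ hd) (fun d hd => hopp _ hd) d
    · exact hB.gen (Sum.inr ⁻¹' S) hb (fun d hd => hrot _ hd) (fun d hd => hopp _ hd) d

theorem Conn.join {A : LegMap D} {B : LegMap D'} (hA : A.Conn) (hB : B.Conn) : (A.join B).Conn :=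
  (hA.twoLegs_sum hB).conn

theorem Conn.face_join {A : LegMap D} {B : LegMap D'} (hA : A.Conn) (hB : B.Conn) :
    (A.join B).face = insertAfter (Perm.sumCongr A.face B.face) (Sum.inr B.root) *
      PermCycles.trans (some (Sum.inl A.root)) (some (Sum.inr B.root)) := by
  rw [LegMap.join, face_attach (hA.twoLegs_sum hB), Perm.sumCongr_mul, face, face]

theorem Conn.mate_join {A : LegMap D} {B : LegMap D'} (hA : A.Conn) (hB : B.Conn) :
    (A.join B).mate = some (Sum.inr B.root) :=
  (hA.twoLegs_sum hB).mate_attach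

theorem TwoLegs.symm {ρ ω : Perm K} {r b : K} (h : TwoLegs ρ ω r b) : TwoLegs ρ ω b r :=
  ⟨h.ne.symm, h.opp_opp, fun d => by rw [h.opp_eq_iff, or_comm],
    fun S hr hb => h.gen S hb hr⟩

/-- The component of a leg, when the two legs are not connected. -/
theorem TwoLegs.conn_component {ρ ω : Perm K} {r b : K} (h : TwoLegs ρ ω r b) {p : K → Prop}
    (hρ : ∀ d, p (ρ d) ↔ p d) (hω : ∀ d, p (ω d) ↔ p d) (hr : p r) (hb : ¬ p b) :
    Conn ⟨ρ.subtypePerm hρ, ω.subtypePerm hω, (⟨r, hr⟩ : {d // p d})⟩ where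
  opp_opp d := Subtype.ext (by simp [h.opp_opp])
  opp_eq_iff d := by
    have : (d : K) ≠ b := fun h' => hb (h' ▸ d.2)
    simp [Subtype.ext_iff, h.opp_eq_iff, this]
  gen S hrS hrot hopp d := by
    have := h.gen {d | ∀ hd : p d, (⟨d, hd⟩ : {d // p d}) ∈ S} (fun _ => hrS)
      (fun hd => absurd hd hb) (fun d hd hd' => hrot _ (hd ((hρ d).1 hd')))
      (fun d hd hd' => hopp _ (hd ((hω d).1 hd'))) d.1
    exact this d.2

theorem mem_iff_of_closed [Finite K] {σ : Perm K} {S : Set K} (h : ∀ d ∈ S, σ d ∈ S) (d : K) :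
    σ d ∈ S ↔ d ∈ S :=
  ⟨fun hd => sameCycle_of_closed (Perm.SameCycle.refl σ d).apply_left h hd, h d⟩

/-- A structure with two legs that are not connected to each other is a sum of two maps. -/
theorem TwoLegs.exists_join [Finite K] {ρ ω : Perm K} {r b : K} (h : TwoLegs ρ ω r b)
    (hg : ¬ ∀ S : Set K, r ∈ S → (∀ d ∈ S, ρ d ∈ S) → (∀ d ∈ S, ω d ∈ S) → b ∈ S) :
    ∃ (D D' : Type) (_ : Finite D) (_ : Finite D') (A : LegMap D) (B : LegMap D'),
      A.Conn ∧ B.Conn ∧ (attach ρ ω r b).Iso (A.join B) := by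
  classical
  push Not at hg
  obtain ⟨S, hr, hS1, hS2, hb⟩ := hg
  have h1 : ∀ d, ρ d ∈ S ↔ d ∈ S := mem_iff_of_closed hS1
  have h2 : ∀ d, ω d ∈ S ↔ d ∈ S := mem_iff_of_closed hS2
  have hA := h.conn_component h1 h2 hr hb
  have hB := h.symm.conn_component (p := fun d => d ∉ S) (fun d => not_congr (h1 d))
    (fun d => not_congr (h2 d)) hb (by simpa using hr)
  refine ⟨_, _, inferInstance, inferInstance, _, _, hA, hB, ?_⟩
  refine Iso.symm (attach_iso (ρ' := ρ) (ω' := ω) (Equiv.sumCompl (· ∈ S)) ?_ ?_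
    (Sum.inl ⟨r, hr⟩) (Sum.inr ⟨b, hb⟩))
  · rintro (d | d) <;> rfl
  · rintro (d | d) <;> rfl

/-- Deletion of the root-edge: a connected map with at least one edge is obtained either by adding
a root-edge to a connected map, or by joining two connected maps. -/
theorem Conn.exists_add_or_join [Finite D] {M : LegMap D} (h : M.Conn) (hD : 1 < Nat.card D) :
    (∃ (D' : Type) (_ : Finite D') (N : LegMap D') (d : D'), N.Conn ∧ M.Iso (N.add d)) ∨
    (∃ (D₁ D₂ : Type) (_ : Finite D₁) (_ : Finite D₂) (A : LegMap D₁) (B : LegMap D₂),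
      A.Conn ∧ B.Conn ∧ M.Iso (A.join B)) := by
  obtain ⟨K, _, ρ, ω, r, b, hK, hi⟩ := h.exists_attach hD
  by_cases hg : ∀ S : Set K, r ∈ S → (∀ d ∈ S, ρ d ∈ S) → (∀ d ∈ S, ω d ∈ S) → b ∈ S
  · obtain ⟨D', _, N, d, hN, hi'⟩ := hK.exists_add hg
    exact Or.inl ⟨D', ‹_›, N, d, hN, hi.trans hi'⟩
  · obtain ⟨D₁, D₂, _, _, A, B, hA, hB, hi'⟩ := hK.exists_join hg
    exact Or.inr ⟨D₁, D₂, ‹_›, ‹_›, A, B, hA, hB, hi.trans hi'⟩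

/-! ### Vertices and faces -/

theorem numCycles_rot_add [Finite D] (M : LegMap D) (d : D) :
    numCycles (M.add d).rot = numCycles M.rot := by
  rw [add, attach_rot, numCycles_insertAfter, numCycles_insertBefore]

theorem numCycles_rot_join [Finite D] [Finite D'] (A : LegMap D) (B : LegMap D') :
    numCycles (A.join B).rot = numCycles A.rot + numCycles B.rot := by
  rw [join, attach_rot, numCycles_insertAfter, numCycles_sumCongr]

theorem Conn.sameCycle_inserted (M : LegMap D) (d : D) :
    (insertAfter (insertBefore M.face d) none).SameCycle (some (some M.root)) (some none) ↔
      M.face.SameCycle M.root d := by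
  rw [sameCycle_insertAfter, sameCycle_insertBefore_some_none]

/-- Both legs lie in the root-face, which the new edge cuts in two. -/
theorem Conn.numCycles_face_add [Finite D] {M : LegMap D} (h : M.Conn) {d : D}
    (hd : M.face.SameCycle M.root d) :
    numCycles (M.add d).face = numCycles M.face + 1 := by
  rw [h.face_add, numCycles_mul_trans_of_sameCycle (by simp) ((Conn.sameCycle_inserted M d).2 hd),
    numCycles_insertAfter, numCycles_insertBefore]

/-- The new edge links two different faces and merges them, which adds a handle. -/
theorem Conn.numCycles_face_add_of_not [Finite D] {M : LegMap D} (h : M.Conn) {d : D}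
    (hd : ¬ M.face.SameCycle M.root d) :
    numCycles (M.add d).face + 1 = numCycles M.face := by
  rw [h.face_add, numCycles_mul_trans_of_not (fun h' => hd ((Conn.sameCycle_inserted M d).1 h')),
    numCycles_insertAfter, numCycles_insertBefore]

theorem not_sameCycle_sum (A : LegMap D) (B : LegMap D') :
    ¬ (insertAfter (Perm.sumCongr A.face B.face) (Sum.inr B.root)).SameCycle
      (some (Sum.inl A.root)) (some (Sum.inr B.root)) := by
  rw [sameCycle_insertAfter]
  exact not_sameCycle_sumCongr _ _ _ _

theorem Conn.numCycles_face_join [Finite D] [Finite D'] {A : LegMap D} {B : LegMap D'}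
    (hA : A.Conn) (hB : B.Conn) :
    numCycles (A.join B).face + 1 = numCycles A.face + numCycles B.face := by
  rw [hA.face_join hB, numCycles_mul_trans_of_not (not_sameCycle_sum A B), numCycles_insertAfter,
    numCycles_sumCongr]

theorem card_add [Finite D] : Nat.card (Option (Option D)) = Nat.card D + 2 := by
  rw [Finite.card_option, Finite.card_option]

theorem card_join [Finite D] [Finite D'] :
    Nat.card (Option (D ⊕ D')) = Nat.card D + Nat.card D' + 1 := by
  rw [Finite.card_option, Nat.card_sum]

/-- The genus of a connected map is nonnegative. -/
theorem Conn.genus_nonneg [Finite D] {M : LegMap D} (h : M.Conn) :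
    2 * (numCycles M.rot + numCycles M.face) ≤ Nat.card D + 3 := by
  generalize hn : Nat.card D = n
  induction n using Nat.strong_induction_on generalizing D with
  | _ n ih =>
  subst hn
  by_cases hD : 1 < Nat.card D
  · rcases h.exists_add_or_join hD with ⟨D', _, N, d, hN, hi⟩ | ⟨D₁, D₂, _, _, A, B, hA, hB, hi⟩
    · have hc := hi.card_eq
      rw [card_add] at hc
      rw [hi.numCycles_rot, hi.numCycles_face, numCycles_rot_add]
      have := ih _ (by omega) hN rfl
      -- The new edge preserves the genus in the first case and raises it by one in the second.
      by_cases hd : N.face.SameCycle N.root d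
      · have := hN.numCycles_face_add hd
        omega
      · have := hN.numCycles_face_add_of_not hd
        omega
    · have hc := hi.card_eq
      rw [card_join] at hc
      rw [hi.numCycles_rot, hi.numCycles_face, numCycles_rot_join]
      have := hA.numCycles_face_join hB
      have := ih _ (by omega) hA rfl
      have := ih _ (by omega) hB rfl
      omega
  -- The leg alone has at most one vertex and one face.
  · have h1 : ∀ σ : Perm D, numCycles σ ≤ Nat.card D := fun σ =>
      Nat.card_le_card_of_surjective _ Quotient.mk_surjective
    have := h1 M.rot
    have := h1 M.face
    omega

/-- Adding a root-edge in the root-face preserves planarity. -/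
theorem Planar.add [Finite D] {M : LegMap D} (h : M.Planar) {d : D}
    (hd : M.face.SameCycle M.root d) : (M.add d).Planar where
  toConn := h.toConn.add d
  euler := by
    rw [numCycles_rot_add, h.toConn.numCycles_face_add hd, card_add]
    have := h.euler
    omega

theorem Planar.join [Finite D] [Finite D'] {A : LegMap D} {B : LegMap D'} (hA : A.Planar)
    (hB : B.Planar) : (A.join B).Planar where
  toConn := hA.toConn.join hB.toConn
  euler := by
    rw [numCycles_rot_join, card_join]
    have := hA.toConn.numCycles_face_join hB.toConn
    have := hA.euler
    have := hB.euler
    omega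

/-- Deletion of the root-edge of a planar map. -/
theorem Planar.exists_add_or_join [Finite D] {M : LegMap D} (h : M.Planar) (hD : 1 < Nat.card D) :
    (∃ (D' : Type) (_ : Finite D') (N : LegMap D') (d : D'), N.Planar ∧
      N.face.SameCycle N.root d ∧ M.Iso (N.add d)) ∨
    (∃ (D₁ D₂ : Type) (_ : Finite D₁) (_ : Finite D₂) (A : LegMap D₁) (B : LegMap D₂),
      A.Planar ∧ B.Planar ∧ M.Iso (A.join B)) := by
  have he := h.euler
  rcases h.toConn.exists_add_or_join hD with
    ⟨D', _, N, d, hN, hi⟩ | ⟨D₁, D₂, _, _, A, B, hA, hB, hi⟩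
  · have hc := hi.card_eq
    rw [card_add] at hc
    rw [hi.numCycles_rot, hi.numCycles_face, numCycles_rot_add] at he
    have hg := hN.genus_nonneg
    by_cases hd : N.face.SameCycle N.root d
    · have := hN.numCycles_face_add hd
      exact Or.inl ⟨D', ‹_›, N, d, ⟨hN, by omega⟩, hd, hi⟩
    -- A second leg outside the root-face would make the genus of the whole map positive.
    · have := hN.numCycles_face_add_of_not hd
      omega
  · have hc := hi.card_eq
    rw [card_join] at hc
    rw [hi.numCycles_rot, hi.numCycles_face, numCycles_rot_join] at he
    -- Genera add up under `join` and are nonnegative, so both vanish.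
    have := hA.numCycles_face_join hB
    have := hA.genus_nonneg
    have := hB.genus_nonneg
    exact Or.inr ⟨D₁, D₂, ‹_›, ‹_›, A, B, ⟨hA, by omega⟩, ⟨hB, by omega⟩, hi⟩

/-! ### Loops and isthmuses -/

/-- The root-edge is a loop. -/
def Loop (M : LegMap D) : Prop := M.rot.SameCycle M.root M.mate

/-- The root-edge is an isthmus: the root-face lies on both sides of it. -/
def Isthmus (M : LegMap D) : Prop := M.face.SameCycle M.root M.mate

theorem Iso.map_mate {M : LegMap D} {N : LegMap D'} {π : D ≃ D'}
    (h1 : ∀ d, π (M.rot d) = N.rot (π d)) (h2 : ∀ d, π (M.opp d) = N.opp (π d))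
    (h3 : π M.root = N.root) : π M.mate = N.mate := by
  rw [mate, h2, h1, h3, mate]

theorem Iso.loop_iff {M : LegMap D} {N : LegMap D'} (h : M.Iso N) : M.Loop ↔ N.Loop := by
  obtain ⟨π, h1, h2, h3⟩ := h
  rw [Loop, Loop, DartMap.sameCycle_iff π _ _ h1, h3, Iso.map_mate h1 h2 h3]

theorem Conn.loop_dual {M : LegMap D} (h : M.Conn) : M.dual.Loop ↔ M.Isthmus := by
  rw [Loop, Isthmus, h.mate_dual]
  rfl

theorem Iso.isthmus_iff {M : LegMap D} {N : LegMap D'} (h : M.Iso N) :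
    M.Isthmus ↔ N.Isthmus := by
  obtain ⟨π, h1, h2, h3⟩ := h
  rw [Isthmus, Isthmus, DartMap.sameCycle_iff π M.face N.face (fun d => by simp [face, h1, h2]),
    h3, Iso.map_mate h1 h2 h3]

theorem Conn.loop_add {M : LegMap D} (h : M.Conn) (d : D) :
    (M.add d).Loop ↔ M.rot.SameCycle M.root d := by
  rw [Loop, h.mate_add, LegMap.add, attach_rot, attach_root, sameCycle_insertAfter,
    sameCycle_insertBefore_some_none]

/-- The transposition cuts the root-face between the two legs and leaves them on different cycles.
-/
theorem Conn.not_isthmus_add [Finite D] {M : LegMap D} (h : M.Conn) {d : D}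
    (hd : M.face.SameCycle M.root d) : ¬ (M.add d).Isthmus := by
  rw [Isthmus, h.mate_add, h.face_add]
  exact not_sameCycle_mul_trans (by simp) ((Conn.sameCycle_inserted M d).2 hd)

/-- The edge merges the two root-faces into one, which lies on both of its sides. -/
theorem Conn.isthmus_join [Finite D] [Finite D'] {A : LegMap D} {B : LegMap D'} (hA : A.Conn)
    (hB : B.Conn) : (A.join B).Isthmus := by
  rw [Isthmus, hA.mate_join hB, hA.face_join hB]
  exact sameCycle_mul_trans_of_not (not_sameCycle_sum A B)

theorem Conn.not_loop_join {A : LegMap D} {B : LegMap D'} (hA : A.Conn)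
    (hB : B.Conn) : ¬ (A.join B).Loop := by
  rw [Loop, hA.mate_join hB, LegMap.join, attach_rot, attach_root, sameCycle_insertAfter]
  exact not_sameCycle_sumCongr _ _ _ _

/-! ### Degrees of the root-vertex and of the root-face -/

/-- The degree of the root-vertex, without the leg. -/
def dv (M : LegMap D) : ℕ := (cycle M.rot M.root).ncard - 1

/-- The degree of the root-face, without the leg. -/
def df (M : LegMap D) : ℕ := (cycle M.face M.root).ncard - 1

theorem df_eq_dv_dual (M : LegMap D) : M.df = M.dual.dv := rfl

theorem Conn.df_dual {M : LegMap D} (h : M.Conn) : M.dual.df = M.dv := by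
  rw [df, h.face_dual]; rfl

theorem ncard_rot [Finite D] (M : LegMap D) : (cycle M.rot M.root).ncard = M.dv + 1 := by
  have := ncard_cycle_pos M.rot M.root
  rw [dv]; omega

theorem ncard_face [Finite D] (M : LegMap D) : (cycle M.face M.root).ncard = M.df + 1 :=
  ncard_rot M.dual

theorem Iso.dv_eq {M : LegMap D} {N : LegMap D'} (h : M.Iso N) : M.dv = N.dv := by
  obtain ⟨π, h1, h2, h3⟩ := h
  rw [dv, dv, ncard_cycle_congr π _ _ h1, h3]

theorem Iso.df_eq {M : LegMap D} {N : LegMap D'} (h : M.Iso N) : M.df = N.df := h.dual.dv_eq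

/-- The root-vertex receives the new dart after the leg and, here, the second dart of the edge as
well. -/
theorem dv_add_of_sameCycle [Finite D] (M : LegMap D) {d : D} (hd : M.rot.SameCycle M.root d) :
    (M.add d).dv = M.dv + 2 := by
  rw [dv, add, attach_rot, attach_root,
    ncard_cycle_insertAfter_of_sameCycle (Perm.SameCycle.refl _ _),
    ncard_cycle_insertBefore_of_sameCycle hd, ncard_rot]
  rfl

theorem dv_add_of_not_sameCycle [Finite D] (M : LegMap D) {d : D}
    (hd : ¬ M.rot.SameCycle M.root d) : (M.add d).dv = M.dv + 1 := by
  rw [dv, add, attach_rot, attach_root,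
    ncard_cycle_insertAfter_of_sameCycle (Perm.SameCycle.refl _ _),
    ncard_cycle_insertBefore_of_not_sameCycle hd, ncard_rot]
  rfl

/-- The insertions bring the root cycle to length `df + 3`. The cut removes the `k` darts up to the
second leg, and the leg itself is not counted in the degree. -/
theorem Conn.df_add [Finite D] {M : LegMap D} (h : M.Conn) {k : ℕ}
    (hk : k ∈ Set.Icc 1 (M.df + 1)) :
    (M.add ((M.face ^ k) M.root)).df = M.df + 2 - k := by
  rw [← ncard_face] at hk
  have hk2 := hk.2
  rw [ncard_face] at hk2
  rw [df, h.face_add]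
  change (cycle _ (some (some M.root))).ncard - 1 = _
  rw [ncard_cycle_split _ _ hk, ncard_face]
  omega

theorem dv_join [Finite D] [Finite D'] (A : LegMap D) (B : LegMap D') :
    (A.join B).dv = A.dv + 1 := by
  rw [dv, join, attach_rot, attach_root,
    ncard_cycle_insertAfter_of_sameCycle (Perm.SameCycle.refl _ _),
    ncard_cycle_sumCongr_inl, ncard_rot]
  rfl

/-- Besides the darts of the two root-faces, the merged face counts both darts of the new edge:
`none` and the former leg of `B`. -/
theorem Conn.df_join [Finite D] [Finite D'] {A : LegMap D} {B : LegMap D'} (hA : A.Conn)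
    (hB : B.Conn) : (A.join B).df = A.df + B.df + 2 := by
  rw [df, hA.face_join hB]
  change (cycle _ (some (Sum.inl A.root))).ncard - 1 = _
  rw [ncard_cycle_mul_trans_of_not (not_sameCycle_sum A B),
    ncard_cycle_insertAfter_of_not_sameCycle (not_sameCycle_sumCongr _ _ _ _),
    ncard_cycle_insertAfter_of_sameCycle (Perm.SameCycle.refl _ _),
    ncard_cycle_sumCongr_inl, ncard_cycle_sumCongr_inr, ncard_face, ncard_face]
  omega

/-- The sum over the ways of adding a root-edge in the root-face. -/
theorem Conn.sum_df_add [Finite D] {M : LegMap D} (h : M.Conn) [Fintype (cycle M.face M.root)]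
    {R : Type*} [AddCommMonoid R] (f : ℕ → R) :
    ∑ d : cycle M.face M.root, f (M.add d).df = ∑ j ∈ Finset.range (M.df + 1), f (j + 1) := by
  -- The position `k = j + 1` gives the degree `df + 1 - j`, so the sum is taken in reverse order.
  rw [← Finset.sum_range_reflect]
  refine (Finset.sum_bij (fun j _ => (⟨(M.face ^ (j + 1)) M.root,
    sameCycle_pow _ _ _⟩ : cycle M.face M.root)) ?_ ?_ ?_ ?_).symm
  · simp
  · intro i hi j hj hij
    have := pow_injOn M.face M.root (x₁ := i + 1) (x₂ := j + 1)
      (by rw [ncard_face]; simp at hi ⊢; omega) (by rw [ncard_face]; simp at hj ⊢; omega)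
      (congrArg Subtype.val hij)
    omega
  · rintro ⟨d, hd⟩ -
    obtain ⟨k, hk, rfl⟩ := exists_pow_eq (mem_cycle.1 hd)
    rw [ncard_face] at hk
    obtain ⟨h1, h2⟩ := hk
    exact ⟨k - 1, by simp; omega, by simp [Nat.sub_add_cancel h1]⟩
  · intro j hj
    have hj' : j < M.df + 1 := by simpa using hj
    rw [h.df_add ⟨by omega, by omega⟩]
    congr 1
    omega

instance [Finite D] (σ : Perm D) (x : D) : Fintype (cycle σ x) := Fintype.ofFinite _

/-! ### Isomorphisms and deletion of the root-edge -/

theorem Conn.exists_of_iso_add {M : LegMap D} {N : LegMap D'} (hM : M.Conn) (hN : N.Conn) {d : D}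
    {d' : D'} (h : (M.add d).Iso (N.add d')) :
    ∃ π : D ≃ D', (∀ e, π (M.rot e) = N.rot (π e)) ∧ (∀ e, π (M.opp e) = N.opp (π e)) ∧
      π M.root = N.root ∧ π d = d' := by
  obtain ⟨π, h1, h2, h3, h4⟩ := exists_of_iso_attach (hM.twoLegs d) (hN.twoLegs d') h
  obtain ⟨π, rfl⟩ := exists_optionCongr h4
  obtain ⟨h5, h6⟩ := eq_of_map_insertBefore π h1
  exact ⟨π, h6, fun e => by simpa using h2 (some e), by simpa using h3, h5⟩

theorem iso_add (M : LegMap D) (N : LegMap D') {π : D ≃ D'} (h1 : ∀ e, π (M.rot e) = N.rot (π e))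
    (h2 : ∀ e, π (M.opp e) = N.opp (π e)) (h3 : π M.root = N.root) (d : D) :
    (M.add d).Iso (N.add (π d)) := by
  have := attach_iso (optionCongr π) (map_insertBefore π h1 d)
    (ω := optionCongr M.opp) (ω' := optionCongr N.opp) (by rintro (_ | e) <;> simp [h2])
    (some M.root) none
  rw [add, add, ← h3]
  exact this

theorem Iso.join {A : LegMap D} {B : LegMap D'} {A' : LegMap K} {B' : LegMap K'} (hA : A.Iso A')
    (hB : B.Iso B') : (A.join B).Iso (A'.join B') := by
  obtain ⟨π, h1, h2, h3⟩ := hA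
  obtain ⟨ρ, k1, k2, k3⟩ := hB
  have := attach_iso (Equiv.sumCongr π ρ) (ρ := Perm.sumCongr A.rot B.rot)
    (ρ' := Perm.sumCongr A'.rot B'.rot) (ω := Perm.sumCongr A.opp B.opp)
    (ω' := Perm.sumCongr A'.opp B'.opp) (by rintro (d | d) <;> simp [h1, k1])
    (by rintro (d | d) <;> simp [h2, k2]) (Sum.inl A.root) (Sum.inr B.root)
  rw [LegMap.join, LegMap.join, ← h3, ← k3]
  exact this

/-- The isomorphism respects the two legs and therefore, by connectivity, the two components. -/
theorem Conn.iso_of_iso_join {A : LegMap D} {B : LegMap D'} {A' : LegMap K} {B' : LegMap K'}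
    (hA : A.Conn) (hB : B.Conn) (hA' : A'.Conn) (hB' : B'.Conn)
    (h : (A.join B).Iso (A'.join B')) : A.Iso A' ∧ B.Iso B' := by
  obtain ⟨π, h1, h2, h3, h4⟩ :=
    exists_of_iso_attach (hA.twoLegs_sum hB) (hA'.twoLegs_sum hB') h
  have hl : ∀ d, ∃ e, π (Sum.inl d) = Sum.inl e := by
    refine hA.gen {d | ∃ e, π (Sum.inl d) = Sum.inl e} ⟨_, h3⟩ ?_ ?_
    · rintro d ⟨e, he⟩
      have := h1 (Sum.inl d)
      rw [he] at this
      exact ⟨_, this⟩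
    · rintro d ⟨e, he⟩
      have := h2 (Sum.inl d)
      rw [he] at this
      exact ⟨_, this⟩
  have hr : ∀ d, ∃ e, π (Sum.inr d) = Sum.inr e := by
    refine hB.gen {d | ∃ e, π (Sum.inr d) = Sum.inr e} ⟨_, h4⟩ ?_ ?_
    · rintro d ⟨e, he⟩
      have := h1 (Sum.inr d)
      rw [he] at this
      exact ⟨_, this⟩
    · rintro d ⟨e, he⟩
      have := h2 (Sum.inr d)
      rw [he] at this
      exact ⟨_, this⟩
  choose f hf using hl
  choose g hg using hr
  have hfb : Function.Bijective f := by
    refine ⟨fun a b hab => ?_, fun e => ?_⟩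
    · have : π (Sum.inl a) = π (Sum.inl b) := by rw [hf, hf, hab]
      simpa using this
    · obtain ⟨d | d, hd⟩ := π.surjective (Sum.inl e)
      · exact ⟨d, by simpa [hf] using hd⟩
      · simp [hg] at hd
  have hgb : Function.Bijective g := by
    refine ⟨fun a b hab => ?_, fun e => ?_⟩
    · have : π (Sum.inr a) = π (Sum.inr b) := by rw [hg, hg, hab]
      simpa using this
    · obtain ⟨d | d, hd⟩ := π.surjective (Sum.inr e)
      · simp [hf] at hd
      · exact ⟨d, by simpa [hg] using hd⟩
  refine ⟨⟨Equiv.ofBijective f hfb, fun d => ?_, fun d => ?_, ?_⟩,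
    ⟨Equiv.ofBijective g hgb, fun d => ?_, fun d => ?_, ?_⟩⟩
  · simpa [hf] using h1 (Sum.inl d)
  · simpa [hf] using h2 (Sum.inl d)
  · simpa [hf] using h3
  · simpa [hg] using h1 (Sum.inr d)
  · simpa [hg] using h2 (Sum.inr d)
  · simpa [hg] using h4

/-! ### Maps with a leg and rooted maps -/

/-- The map obtained from a rooted map by inserting a leg before the root. -/
def ofDartMap [Finite D] (m : DartMap D) : LegMap (Option D) :=
  ⟨insertBefore m.rot m.root, optionCongr m.opp, none⟩

theorem face_ofDartMap [Finite D] (m : DartMap D) :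
    (ofDartMap m).face = insertBefore (m.rot * m.opp) m.root :=
  insertBefore_mul_optionCongr _ _ _

theorem mem_iff_of_mem_closure [Finite D] {s : Set (Perm D)} {S : Set D}
    (h : ∀ σ ∈ s, ∀ d ∈ S, σ d ∈ S) {g : Perm D} (hg : g ∈ Subgroup.closure s) (d : D) :
    g d ∈ S ↔ d ∈ S := by
  induction hg using Subgroup.closure_induction generalizing d with
  | mem σ hσ => exact mem_iff_of_closed (h σ hσ) d
  | one => rfl
  | mul a b _ _ iha ihb => rw [Perm.mul_apply, iha, ihb]
  | inv a _ ih => rw [← ih (a⁻¹ d)]; simp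

/-- The leg adds one dart and changes no number of cycles, which turns the `+ 4` of Euler's relation
into `+ 3`. -/
theorem ofDartMap_planar [Finite D] (m : DartMap D) : (ofDartMap m).Planar where
  opp_opp := by rintro (_ | d) <;> simp [ofDartMap, m.opp_opp]
  opp_eq_iff := by rintro (_ | d) <;> simp [ofDartMap, m.opp_ne]
  gen S hr hrot hopp := by
    simp only [ofDartMap, insertBefore_eq] at hr hrot hopp
    have hroot : some m.root ∈ S := by simpa using hrot _ hr
    rintro (_ | d)
    · exact hr
    · obtain ⟨g, hg, rfl⟩ := m.connected m.root d
      refine (mem_iff_of_mem_closure (S := some ⁻¹' S) ?_ hg m.root).2 hroot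
      rintro σ (rfl | rfl) d hd
      · exact closed_of_insertAfter hrot d hd
      · exact hopp _ hd
  euler := by
    rw [face_ofDartMap]
    simp only [ofDartMap, numCycles_insertBefore, Finite.card_option]
    exact m.euler

theorem exists_ofDartMap [Finite D] {N : LegMap (Option D)} (hN : N.Planar) (h0 : N.root = none)
    (hD : 1 < Nat.card (Option D)) : ∃ m : DartMap D, N = ofDartMap m := by
  have h1 : N.rot none ≠ none := by simpa [h0] using hN.toConn.rot_root_ne hD
  obtain ⟨i, hi⟩ := Option.ne_none_iff_exists'.1 h1
  obtain ⟨σ, hσ⟩ := exists_insertBefore hi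
  obtain ⟨ω, hω⟩ := exists_optionCongr (τ := N.opp) (by simpa [h0] using hN.toConn.opp_root)
  have hreach : ∀ d, ∃ g ∈ Subgroup.closure {σ, ω}, g i = d := by
    have hmem : ∀ τ ∈ ({σ, ω} : Set (Perm D)), ∀ d ∈ {d | ∃ g ∈ Subgroup.closure {σ, ω}, g i = d},
        τ d ∈ {d | ∃ g ∈ Subgroup.closure {σ, ω}, g i = d} := by
      rintro τ hτ _ ⟨g, hg, rfl⟩
      exact ⟨τ * g, mul_mem (Subgroup.subset_closure hτ) hg, rfl⟩
    have hi' : i ∈ {d | ∃ g ∈ Subgroup.closure {σ, ω}, g i = d} := ⟨1, one_mem _, rfl⟩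
    intro d
    -- The leg and the orbit of `i` under the group generated by `σ` and `ω` form a stable set,
    -- hence everything.
    have := hN.gen (insert none (some '' {d | ∃ g ∈ Subgroup.closure {σ, ω}, g i = d}))
      (by simp [h0]) (by
        rw [hσ, insertBefore_eq]
        refine insertAfter_closed (hmem σ (by simp)) ?_
        exact (mem_iff_of_closed (hmem σ (by simp)) _).1 (by simpa using hi')) (by
        rw [hω]
        rintro _ (rfl | ⟨d, hd, rfl⟩)
        · simp
        · exact Or.inr ⟨_, hmem ω (by simp) d hd, rfl⟩) (some d)
    simpa using this
  refine ⟨⟨σ, ω, i, fun d => ?_, fun d => ?_, fun d d' => ?_, ?_⟩, ?_⟩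
  · simpa [hω] using hN.opp_opp (some d)
  · intro h
    have := (hN.opp_eq_iff (some d)).1 (by simp [hω, h])
    simp [h0] at this
  · obtain ⟨g, hg, rfl⟩ := hreach d
    obtain ⟨g', hg', rfl⟩ := hreach d'
    exact ⟨g' * g⁻¹, mul_mem hg' (inv_mem hg), by simp⟩
  · have := hN.euler
    rw [face, hσ, hω, insertBefore_mul_optionCongr, numCycles_insertBefore, numCycles_insertBefore,
      Finite.card_option] at this
    exact this
  · cases N
    cases h0
    cases hσ
    cases hω
    rfl

theorem iso_ofDartMap [Finite D] [Finite D'] {m : DartMap D} {m' : DartMap D'} :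
    (ofDartMap m).Iso (ofDartMap m') ↔ m.Iso m' := by
  constructor
  · rintro ⟨π, h1, h2, h3⟩
    obtain ⟨π, rfl⟩ := exists_optionCongr h3
    obtain ⟨h4, h5⟩ := eq_of_map_insertBefore π h1
    exact ⟨π, h5, fun d => by simpa [ofDartMap] using h2 (some d), h4⟩
  · rintro ⟨π, h1, h2, h3⟩
    refine ⟨optionCongr π, ?_, ?_, rfl⟩
    · simpa [ofDartMap, h3] using map_insertBefore π h1 m.root
    · rintro (_ | d) <;> simp [ofDartMap, h2]

/-- A map with a leg that represents a rooted planar map. -/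
def rep : {n : ℕ} → RootedPlanarMap n → LegMap (Option (Fin (2 * n)))
  | 0, _ => ⟨1, 1, none⟩
  | n + 1, c => ofDartMap (Quotient.out (s := DartMap.isoSetoid (Fin (2 * (n + 1)))) c)

theorem rep_planar : {n : ℕ} → (c : RootedPlanarMap n) → (rep c).Planar
  | 0, _ => by
    have hs : Subsingleton (Option (Fin (2 * 0))) := ⟨by rintro (_ | a) (_ | b); rfl; exact b.elim0; exact a.elim0; exact a.elim0⟩
    have h1 : ∀ σ : Perm (Option (Fin (2 * 0))), numCycles σ = 1 := fun σ => by
      rw [numCycles, Nat.card_eq_one_iff_unique]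
      exact ⟨⟨fun a b => by
        induction a using Quotient.ind
        induction b using Quotient.ind
        exact congrArg _ (Subsingleton.elim _ _)⟩, ⟨Quotient.mk _ none⟩⟩
    refine ⟨⟨fun _ => rfl, fun d => ?_, fun S hr _ _ d => ?_⟩, ?_⟩
    · simpa [rep] using Subsingleton.elim d none
    · exact Subsingleton.elim d none ▸ hr
    · rw [h1, h1]; simp
  | n + 1, c => ofDartMap_planar _

theorem eq_of_iso_rep : {n : ℕ} → {c c' : RootedPlanarMap n} → (rep c).Iso (rep c') → c = c'
  | 0, _, _, _ => rfl
  | n + 1, c, c', h => by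
    have h := iso_ofDartMap.1 h
    have := Quotient.sound (s := DartMap.isoSetoid (Fin (2 * (n + 1)))) h
    exact (Quotient.out_eq _).symm.trans (this.trans (Quotient.out_eq _))

theorem exists_iso_rep [Finite D] {M : LegMap D} (hM : M.Planar) {n : ℕ}
    (hD : Nat.card D = 2 * n + 1) : ∃ c : RootedPlanarMap n, M.Iso (rep c) := by
  classical
  have hcard : Nat.card {x // x ≠ M.root} = Nat.card (Fin (2 * n)) := by
    have := Nat.card_congr (Equiv.optionSubtypeNe M.root)
    rw [Finite.card_option] at this
    rw [Nat.card_fin]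
    omega
  obtain ⟨e'⟩ : Nonempty ({x // x ≠ M.root} ≃ Fin (2 * n)) := Finite.card_eq.1 hcard
  let e : D ≃ Option (Fin (2 * n)) := (Equiv.optionSubtypeNe M.root).symm.trans (optionCongr e')
  have he : e M.root = none := by simp [e]
  have hi := M.iso_map e
  have hN := hi.planar hM
  have h0 : (M.map e).root = none := he
  cases n with
  | zero =>
    have hs : Subsingleton (Option (Fin (2 * 0))) := by
      rw [← Finite.card_le_one_iff_subsingleton]; simp
    exact ⟨(), hi.trans ⟨Equiv.refl _, fun _ => Subsingleton.elim _ _,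
      fun _ => Subsingleton.elim _ _, Subsingleton.elim _ _⟩⟩
  | succ n =>
    obtain ⟨m, hm⟩ := exists_ofDartMap hN h0 (by simp)
    refine ⟨Quotient.mk (DartMap.isoSetoid (Fin (2 * (n + 1)))) m, hi.trans ?_⟩
    rw [hm]
    exact (iso_ofDartMap.2 (Quotient.mk_out (s := DartMap.isoSetoid (Fin (2 * (n + 1)))) m)).symm

/-- A parity consequence of Euler's relation; it supplies the numbers of edges of the two parts of a
joined map. -/
theorem Planar.odd_card [Finite D] {M : LegMap D} (h : M.Planar) : Odd (Nat.card D) := by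
  have := h.euler
  have : 0 < Nat.card D := Nat.card_pos_iff.2 ⟨⟨M.root⟩, inferInstance⟩
  exact ⟨numCycles M.rot + numCycles M.face - 2, by omega⟩

theorem card_darts (n : ℕ) : Nat.card (Option (Fin (2 * n))) = 2 * n + 1 := by
  simp

/-! ### Deletion of the root-edge as a bijection -/

/-- The data of a planar map from which the root-edge has been deleted. -/
abbrev Deleted (n : ℕ) : Type :=
  (Σ c : RootedPlanarMap n, cycle (rep c).face (rep c).root) ⊕
    (Σ p : Finset.HasAntidiagonal.antidiagonal n, RootedPlanarMap p.1.1 × RootedPlanarMap p.1.2)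

/-- The bijection given by the deletion of the root-edge. -/
theorem exists_bijective_deleted (n : ℕ) : ∃ F : Deleted n → RootedPlanarMap (n + 1),
    Function.Bijective F ∧ (∀ c d, ((rep c).add d.1).Iso (rep (F (Sum.inl ⟨c, d⟩)))) ∧
    ∀ p a b, ((rep a).join (rep b)).Iso (rep (F (Sum.inr ⟨p, a, b⟩))) := by
  have h1 : ∀ q : (Σ c : RootedPlanarMap n, cycle (rep c).face (rep c).root),
      ∃ c' : RootedPlanarMap (n + 1), ((rep q.1).add q.2.1).Iso (rep c') := fun q =>
    exists_iso_rep ((rep_planar q.1).add q.2.2) (by rw [card_add, card_darts]; ring)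
  have h2 : ∀ q : (Σ p : Finset.HasAntidiagonal.antidiagonal n, RootedPlanarMap p.1.1 × RootedPlanarMap p.1.2),
      ∃ c' : RootedPlanarMap (n + 1), ((rep q.2.1).join (rep q.2.2)).Iso (rep c') := fun q =>
    exists_iso_rep ((rep_planar q.2.1).join (rep_planar q.2.2)) (by
      have := Finset.HasAntidiagonal.mem_antidiagonal.1 q.1.2
      rw [card_join, card_darts, card_darts]; omega)
  choose F1 hF1 using h1
  choose F2 hF2 using h2
  -- The root-edge is an isthmus in joined maps and never in added ones.
  have hne : ∀ q q', F1 q ≠ F2 q' := by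
    intro q q' h
    have h1 := hF1 q
    rw [h] at h1
    have h2 := (hF2 q').isthmus_iff.1
      ((rep_planar q'.2.1).toConn.isthmus_join (rep_planar q'.2.2).toConn)
    exact (rep_planar q.1).toConn.not_isthmus_add q.2.2 (h1.isthmus_iff.2 h2)
  refine ⟨Sum.elim F1 F2, ⟨?_, ?_⟩, fun c d => hF1 ⟨c, d⟩, fun p a b => hF2 ⟨p, a, b⟩⟩
  · rintro (⟨c, d, hd⟩ | ⟨⟨⟨i, j⟩, hij⟩, a, b⟩) (⟨c', d', hd'⟩ | ⟨⟨⟨i', j'⟩, hij'⟩, a', b'⟩) h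
    · have h : F1 _ = F1 _ := h
      have hi := (hF1 ⟨c, d, hd⟩).trans (h ▸ (hF1 ⟨c', d', hd'⟩).symm)
      obtain ⟨π, k1, k2, k3, k4⟩ :=
        (rep_planar c).toConn.exists_of_iso_add (rep_planar c').toConn hi
      obtain rfl := eq_of_iso_rep ⟨π, k1, k2, k3⟩
      -- As an automorphism of a rooted map `π` is the identity, so the position of the second leg
      -- is determined.
      have := (rep_planar c).toConn.eq_of_automorphism k1 k2 k3 d
      obtain rfl : d = d' := this.symm.trans k4
      rfl
    · exact absurd h (hne _ _)
    · exact absurd h.symm (hne _ _)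
    · have h : F2 _ = F2 _ := h
      have hi := (hF2 ⟨⟨⟨i, j⟩, hij⟩, a, b⟩).trans (h ▸ (hF2 ⟨⟨⟨i', j'⟩, hij'⟩, a', b'⟩).symm)
      obtain ⟨ha, hb⟩ := (rep_planar a).toConn.iso_of_iso_join (rep_planar b).toConn
        (rep_planar a').toConn (rep_planar b').toConn hi
      have hca := ha.card_eq
      have hcb := hb.card_eq
      rw [card_darts, card_darts] at hca hcb
      obtain rfl : i = i' := by simpa using hca
      obtain rfl : j = j' := by simpa using hcb
      obtain rfl := eq_of_iso_rep ha
      obtain rfl := eq_of_iso_rep hb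
      rfl
  · intro c
    rcases (rep_planar c).exists_add_or_join (by rw [card_darts]; omega) with
      ⟨D', _, N, d, hN, hd, hi⟩ | ⟨D₁, D₂, _, _, A, B, hA, hB, hi⟩
    · have hc := hi.card_eq
      rw [card_darts, card_add] at hc
      obtain ⟨c', π, k1, k2, k3⟩ := exists_iso_rep hN (n := n) (by omega)
      have hd' : π d ∈ cycle (rep c').face (rep c').root := by
        rw [mem_cycle, ← k3, ← DartMap.sameCycle_iff π N.face _ (fun e => by simp [face, k1, k2])]
        exact hd
      refine ⟨Sum.inl ⟨c', π d, hd'⟩, (eq_of_iso_rep ?_).symm⟩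
      exact (hi.trans (iso_add N (rep c') k1 k2 k3 d)).trans (hF1 ⟨c', π d, hd'⟩)
    · have hc := hi.card_eq
      rw [card_darts, card_join] at hc
      obtain ⟨i, hi1⟩ := hA.odd_card
      obtain ⟨j, hj1⟩ := hB.odd_card
      obtain ⟨a, ha⟩ := exists_iso_rep hA hi1
      obtain ⟨b, hb⟩ := exists_iso_rep hB hj1
      have hij : (i, j) ∈ Finset.HasAntidiagonal.antidiagonal n := by
        rw [Finset.HasAntidiagonal.mem_antidiagonal]
        change i + j = n
        omega
      exact ⟨Sum.inr ⟨⟨(i, j), hij⟩, a, b⟩,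
        (eq_of_iso_rep ((hi.trans (ha.join hb)).trans (hF2 ⟨⟨(i, j), hij⟩, a, b⟩))).symm⟩

/-- Sums over planar maps, according to the deletion of the root-edge. -/
theorem sum_rep_succ {R : Type*} [AddCommMonoid R] (g : ∀ (D : Type) [Finite D], LegMap D → R)
    (hg : ∀ (D D' : Type) [Finite D] [Finite D'] (M : LegMap D) (N : LegMap D'), M.Iso N →
      g D M = g D' N) (n : ℕ) :
    ∑ c : RootedPlanarMap (n + 1), g _ (rep c) =
      ∑ c : RootedPlanarMap n, ∑ d : cycle (rep c).face (rep c).root, g _ ((rep c).add d.1) +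
      ∑ p ∈ Finset.HasAntidiagonal.antidiagonal n, ∑ a : RootedPlanarMap p.1, ∑ b : RootedPlanarMap p.2,
        g _ ((rep a).join (rep b)) := by
  obtain ⟨F, hF, h1, h2⟩ := exists_bijective_deleted n
  rw [← Fintype.sum_bijective F hF (fun q => g _ (rep (F q))) _ fun _ => rfl,
    Fintype.sum_sum_type, Fintype.sum_sigma, Fintype.sum_sigma,
    ← Finset.sum_coe_sort (Finset.HasAntidiagonal.antidiagonal n)]
  congr 1
  · exact Finset.sum_congr rfl fun c _ => Finset.sum_congr rfl fun d _ =>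
      (hg _ _ _ _ (h1 c d)).symm
  · refine Finset.sum_congr rfl fun p _ => ?_
    rw [Fintype.sum_prod_type]
    exact Finset.sum_congr rfl fun a _ => Finset.sum_congr rfl fun b _ =>
      (hg _ _ _ _ (h2 p a b)).symm

/-- Duality is an involution that preserves the number of edges, so it permutes a finite set of
isomorphism classes. -/
theorem sum_rep_dual {R : Type*} [AddCommMonoid R] (g : ∀ (D : Type) [Finite D], LegMap D → R)
    (hg : ∀ (D D' : Type) [Finite D] [Finite D'] (M : LegMap D) (N : LegMap D'), M.Iso N →
      g D M = g D' N) (n : ℕ) :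
    ∑ c : RootedPlanarMap n, g _ (rep c).dual = ∑ c : RootedPlanarMap n, g _ (rep c) := by
  have h : ∀ c : RootedPlanarMap n, ∃ c' : RootedPlanarMap n, (rep c).dual.Iso (rep c') :=
    fun c => exists_iso_rep (rep_planar c).dual (card_darts n)
  choose F hF using h
  have hinj : Function.Injective F := by
    intro c c' h
    have hi := ((hF c).trans (h ▸ (hF c').symm)).dual
    rw [(rep_planar c).toConn.dual_dual, (rep_planar c').toConn.dual_dual] at hi
    exact eq_of_iso_rep hi
  exact Fintype.sum_bijective F (Finite.injective_iff_bijective.1 hinj) _ _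
    fun c => hg _ _ _ _ (hF c)

end LegMap

/-! ### Sums over invariant colourings -/

namespace PermCycles

variable {D D' X : Type}

/-- The sum of `f` over the colourings that are constant on the cycles of `σ`. -/
def sumInv [Finite D] [Finite X] (σ : Perm D) (f : (D → X) → ℚ) : ℚ := ∑ c : Inv σ X, f c.1

variable [Finite D] [Finite D'] [Finite X]

theorem sumInv_congr {σ : Perm D} {f g : (D → X) → ℚ} (h : ∀ c, (∀ d, c (σ d) = c d) → f c = g c) :
    sumInv σ f = sumInv σ g :=
  Finset.sum_congr rfl fun c _ => h c.1 c.2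

theorem sumInv_insertAfter (σ : Perm D) (y : D) (f : (D → X) → ℚ) :
    sumInv (insertAfter σ y) (fun c => f fun d => c (some d)) = sumInv σ f :=
  Fintype.sum_equiv (invInsertAfter σ y X) _ _ fun _ => rfl

theorem sumInv_insertBefore (σ : Perm D) (y : D) (f : (D → X) → ℚ) :
    sumInv (insertBefore σ y) (fun c => f fun d => c (some d)) = sumInv σ f :=
  Fintype.sum_equiv (invInsertBefore σ y X) _ _ fun _ => rfl

theorem sumInv_ite (σ : Perm D) (p : (D → X) → Prop) [DecidablePred p] (f : (D → X) → ℚ) :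
    sumInv σ (fun c => if p c then f c else 0) = ∑ᶠ c : {c : Inv σ X // p c.1}, f c.1.1 := by
  rw [finsum_eq_sum_of_fintype, sumInv, ← Finset.sum_filter]
  exact Finset.sum_subtype _ (by simp) _

/-- For colourings that agree at `x` and `y`, invariance under `σ` and under `σ * trans x y` are the
same condition. -/
theorem sumInv_mul_trans [DecidableEq X] (σ : Perm D) (x y : D) (f : (D → X) → ℚ) :
    sumInv (σ * trans x y) (fun c => if c x = c y then f c else 0) =
      sumInv σ (fun c => if c x = c y then f c else 0) := by
  rw [sumInv_ite, sumInv_ite]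
  exact finsum_eq_of_bijective _ (invMulTrans σ x y X).bijective fun _ => rfl

theorem sumInv_congr_equiv (π : D ≃ D') {σ : Perm D} {σ' : Perm D'}
    (h : ∀ d, π (σ d) = σ' (π d)) (f : (D → X) → ℚ) :
    sumInv σ' (fun c => f fun d => c (π d)) = sumInv σ f := by
  refine Fintype.sum_equiv ⟨fun c => ⟨fun d => c.1 (π d), fun d => by
      change c.1 (π (σ d)) = c.1 (π d)
      rw [h, c.2]⟩,
    fun c => ⟨fun d => c.1 (π.symm d), fun d => by
      obtain ⟨d, rfl⟩ := π.surjective d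
      rw [← h]
      change c.1 (π.symm (π (σ d))) = c.1 (π.symm (π d))
      rw [Equiv.symm_apply_apply, Equiv.symm_apply_apply, c.2]⟩, fun c => ?_, fun c => ?_⟩
    _ _ fun _ => rfl
  · exact Subtype.ext (funext fun d => congrArg c.1 (π.apply_symm_apply d))
  · exact Subtype.ext (funext fun d => congrArg c.1 (π.symm_apply_apply d))

theorem sumInv_sumCongr (σ : Perm D) (σ' : Perm D') (f : (D → X) → (D' → X) → ℚ) :
    sumInv (Perm.sumCongr σ σ') (fun c => f (fun d => c (Sum.inl d)) (fun d => c (Sum.inr d))) =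
      sumInv σ' (fun c' => sumInv σ (fun c => f c c')) := by
  refine (Fintype.sum_equiv (invSumCongr σ σ' X) _ (fun p => f p.1.1 p.2.1) fun _ => rfl).trans ?_
  rw [Fintype.sum_prod_type_right]
  rfl

theorem sumInv_mul_left (σ : Perm D) (a : ℚ) (f : (D → X) → ℚ) :
    sumInv σ (fun c => a * f c) = a * sumInv σ f :=
  (Finset.mul_sum _ _ _).symm

theorem sumInv_mul_right (σ : Perm D) (a : ℚ) (f : (D → X) → ℚ) :
    sumInv σ (fun c => f c * a) = sumInv σ f * a :=
  (Finset.sum_mul _ _ _).symm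

/-- By symmetry of the colours, prescribing the colour of one element divides the sum by the number
of colours. -/
theorem card_mul_sumInv {k : ℕ} (σ : Perm D) (r : D) (i : Fin k) {f : (D → Fin k) → ℚ}
    (hf : ∀ (τ : Perm (Fin k)) c, f (fun d => τ (c d)) = f c) :
    k * sumInv σ (fun c => if c r = i then f c else 0) = sumInv σ f := by
  have hsymm : ∀ j, sumInv σ (fun c => if c r = j then f c else 0) =
      sumInv σ (fun c => if c r = i then f c else 0) := by
    intro j
    refine Fintype.sum_equiv ⟨fun c => ⟨fun d => Equiv.swap i j (c.1 d), fun d => congrArg _ (c.2 d)⟩,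
      fun c => ⟨fun d => Equiv.swap i j (c.1 d), fun d => congrArg _ (c.2 d)⟩, fun c => ?_, fun c => ?_⟩
      _ _ fun c => ?_
    · exact Subtype.ext (by simp)
    · exact Subtype.ext (by simp)
    · simp only [Equiv.coe_fn_mk, hf]
      congr 1
      rw [Equiv.swap_apply_eq_iff, Equiv.swap_apply_left]
  have h2 : ∑ j, sumInv σ (fun c => if c r = j then f c else 0) = sumInv σ f := by
    simp only [sumInv]
    rw [Finset.sum_comm]
    exact Finset.sum_congr rfl fun c _ => by simp
  rw [← h2, Finset.sum_congr rfl fun j _ => hsymm j]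
  simp

end PermCycles

namespace LegMap

variable {D D' K : Type} {k : ℕ} {X : Type}

/-! ### Potts partition functions -/

/-- The number of monochromatic edges of a colouring. -/
def mono (M : LegMap D) (c : D → X) : ℕ := {d | c (M.opp d) = c d}.ncard / 2

/-- The number of monochromatic edges of a colouring, apart from the root-edge. -/
def monoDel (M : LegMap D) (c : D → X) : ℕ :=
  {d | d ≠ M.rot M.root ∧ d ≠ M.mate ∧ c (M.opp d) = c d}.ncard / 2

/-- The partition function of the `k`-state Potts model. -/
def pottsZ [Finite D] (k : ℕ) (ν : ℚ) (M : LegMap D) : ℚ :=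
  sumInv M.rot fun c : D → Fin k => ν ^ M.mono c

/-- The partition function after deletion of the root-edge. -/
def pottsDel [Finite D] (k : ℕ) (ν : ℚ) (M : LegMap D) : ℚ :=
  sumInv M.rot fun c : D → Fin k => ν ^ M.monoDel c

/-- The partition function after contraction of the root-edge. -/
def pottsCon [Finite D] (k : ℕ) (ν : ℚ) (M : LegMap D) : ℚ :=
  sumInv M.rot fun c : D → Fin k => if c M.root = c M.mate then ν ^ M.monoDel c else 0

theorem mono_comp (M : LegMap D) (c : D → X) {X' : Type} {τ : X → X'} (hτ : Function.Injective τ) :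
    (M.mono fun d => τ (c d)) = M.mono c := by
  simp [mono, hτ.eq_iff]

theorem Conn.mono_eq [Finite D] {M : LegMap D} (h : M.Conn) (h0 : M.rot M.root ≠ M.root) {c : D → X}
    [DecidableEq X] (hc : ∀ d, c (M.rot d) = c d) :
    M.mono c = M.monoDel c + if c M.root = c M.mate then 1 else 0 := by
  have hne : M.rot M.root ≠ M.mate := fun h' => h0 ((h.opp_eq_iff _).1 h'.symm)
  have hmate : M.opp M.mate = M.rot M.root := h.opp_opp _
  have hmate' : M.opp (M.rot M.root) = M.mate := rfl
  -- The dart `M.rot M.root` has the colour of the leg, so the two darts of the root-edge both count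
  -- or both fail to count according to `heq`.
  by_cases heq : c M.root = c M.mate
  · have : {d | c (M.opp d) = c d} = insert (M.rot M.root) (insert M.mate
        {d | d ≠ M.rot M.root ∧ d ≠ M.mate ∧ c (M.opp d) = c d}) := by
      ext d
      simp only [Set.mem_ofPred_eq, Set.mem_insert_iff]
      by_cases h1 : d = M.rot M.root
      · subst h1; simp [hmate', hc, heq]
      by_cases h2 : d = M.mate
      · subst h2; simp [hmate, hc, heq]
      simp [h1, h2]
    rw [mono, this, Set.ncard_insert_of_notMem (by simp [hne]),
      Set.ncard_insert_of_notMem (by simp), monoDel, if_pos heq]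
    omega
  · have : {d | c (M.opp d) = c d} =
        {d | d ≠ M.rot M.root ∧ d ≠ M.mate ∧ c (M.opp d) = c d} := by
      ext d
      simp only [Set.mem_ofPred_eq]
      by_cases h1 : d = M.rot M.root
      · subst h1; simp [hmate', hc, Ne.symm heq]
      by_cases h2 : d = M.mate
      · subst h2; simp [hmate, hc, heq]
      simp [h1, h2]
    rw [mono, this, if_neg heq]
    rfl

/-- Deletion and contraction of the root-edge. -/
theorem Conn.pottsZ_eq [Finite D] {M : LegMap D} (h : M.Conn) (h0 : M.rot M.root ≠ M.root)
    (k : ℕ) (ν : ℚ) : M.pottsZ k ν = M.pottsDel k ν + (ν - 1) * M.pottsCon k ν := by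
  rw [pottsZ, pottsDel, pottsCon, ← sumInv_mul_left, sumInv, sumInv, sumInv,
    ← Finset.sum_add_distrib]
  refine Finset.sum_congr rfl fun c _ => ?_
  rw [h.mono_eq h0 c.2]
  split_ifs
  · ring
  · ring

theorem ncard_setOf_comp (π : D ≃ D') (p : D' → Prop) : {d | p (π d)}.ncard = {d | p d}.ncard := by
  rw [← Set.ncard_image_of_injective _ π.injective]
  congr 1
  ext d
  simp only [Set.mem_image, Set.mem_ofPred_eq]
  exact ⟨by rintro ⟨d, hd, rfl⟩; exact hd, fun hd => ⟨π.symm d, by simpa using hd, by simp⟩⟩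

theorem mono_map {M : LegMap D} {N : LegMap D'} {π : D ≃ D'}
    (h2 : ∀ d, π (M.opp d) = N.opp (π d)) (c : D' → X) :
    (M.mono fun d => c (π d)) = N.mono c := by
  simp only [mono, h2]
  rw [ncard_setOf_comp π fun d => c (N.opp d) = c d]

theorem monoDel_map {M : LegMap D} {N : LegMap D'} {π : D ≃ D'}
    (h1 : ∀ d, π (M.rot d) = N.rot (π d)) (h2 : ∀ d, π (M.opp d) = N.opp (π d))
    (h3 : π M.root = N.root) (c : D' → X) :
    (M.monoDel fun d => c (π d)) = N.monoDel c := by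
  rw [monoDel, monoDel, ← ncard_setOf_comp π]
  simp only [← Iso.map_mate h1 h2 h3, ← h3, ← h1, ← h2, Ne, π.injective.eq_iff]

theorem Iso.pottsZ_eq [Finite D] [Finite D'] {M : LegMap D} {N : LegMap D'} (h : M.Iso N) (k : ℕ)
    (ν : ℚ) : M.pottsZ k ν = N.pottsZ k ν := by
  obtain ⟨π, h1, h2, h3⟩ := h
  rw [pottsZ, pottsZ, ← sumInv_congr_equiv π h1]
  simp only [mono_map h2]

theorem Iso.pottsDel_eq [Finite D] [Finite D'] {M : LegMap D} {N : LegMap D'} (h : M.Iso N) (k : ℕ)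
    (ν : ℚ) : M.pottsDel k ν = N.pottsDel k ν := by
  obtain ⟨π, h1, h2, h3⟩ := h
  rw [pottsDel, pottsDel, ← sumInv_congr_equiv π h1]
  simp only [monoDel_map h1 h2 h3]

theorem Iso.pottsCon_eq [Finite D] [Finite D'] {M : LegMap D} {N : LegMap D'} (h : M.Iso N) (k : ℕ)
    (ν : ℚ) : M.pottsCon k ν = N.pottsCon k ν := by
  obtain ⟨π, h1, h2, h3⟩ := h
  rw [pottsCon, pottsCon, ← sumInv_congr_equiv π h1]
  simp only [monoDel_map h1 h2 h3, h3, Iso.map_mate h1 h2 h3]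

theorem Conn.monoDel_dual {M : LegMap D} (h : M.Conn) (c : D → X) :
    M.dual.monoDel c = M.monoDel c := by
  rw [monoDel, monoDel, h.mate_dual]
  simp [LegMap.dual, h.opp_root]

/-- The root-edge consists of `none` and the former leg `b`; on the other darts `opp` is still `ω`.
-/
theorem TwoLegs.monoDel_attach {ρ ω : Perm K} {r b : K} (h : TwoLegs ρ ω r b) (c : Option K → X) :
    (attach ρ ω r b).monoDel c = {d | d ≠ b ∧ c (some (ω d)) = c (some d)}.ncard / 2 := by
  rw [monoDel, h.mate_attach, ← Set.ncard_image_of_injective _ (Option.some_injective K)]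
  congr 2
  ext o
  cases o with
  | none => simp
  | some d =>
    by_cases hd : d = b
    · simp [hd]
    · simp [hd, insertAfter_of_ne ω hd]

theorem Conn.monoDel_add {M : LegMap D} (h : M.Conn) (d : D) (c : Option (Option D) → X) :
    (M.add d).monoDel c = M.mono fun e => c (some (some e)) := by
  rw [LegMap.add, (h.twoLegs d).monoDel_attach, mono,
    ← Set.ncard_image_of_injective _ (Option.some_injective D)]
  congr 2
  ext o
  cases o <;> simp

/-- A set of darts that is stable under `opp` and contains the leg has odd cardinality. -/
theorem Conn.odd_ncard [Finite D] {M : LegMap D} (h : M.Conn) {S : Set D} (hr : M.root ∈ S)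
    (hS : ∀ d ∈ S, M.opp d ∈ S) : Odd S.ncard := by
  classical
  have := Fintype.ofFinite D
  -- The darts of `S` other than the leg are paired by `opp`, so their number vanishes modulo 2.
  have h2 : (((S \ {M.root}).toFinset.card : ℕ) : ZMod 2) = 0 := by
    rw [Finset.card_eq_sum_ones, Nat.cast_sum]
    refine Finset.sum_involution (fun d _ => M.opp d) (fun d _ => by decide) (fun d hd _ => ?_)
      (fun d hd => ?_) (fun d _ => h.opp_opp d)
    · rw [Ne, h.opp_eq_iff]
      simp only [Set.mem_toFinset, Set.mem_sdiff, Set.mem_singleton_iff] at hd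
      exact hd.2
    · simp only [Set.mem_toFinset, Set.mem_sdiff, Set.mem_singleton_iff] at hd ⊢
      exact ⟨hS d hd.1, fun h' => hd.2 (M.opp.injective (h'.trans h.opp_root.symm))⟩
  rw [ZMod.natCast_eq_zero_iff_even, ← Set.ncard_eq_toFinset_card'] at h2
  rw [← Set.ncard_sdiff_singleton_add_one hr]
  exact h2.add_one

/-- The leg always counts, so the two sides have `2 * i + 1` and `2 * j + 1` monochromatic darts.
Deleting the edge removes the leg of `B` only, and the truncated half of what remains is `i + j`. -/
theorem Conn.monoDel_join [Finite D] [Finite D'] {A : LegMap D} {B : LegMap D'} (hA : A.Conn)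
    (hB : B.Conn) (c : Option (D ⊕ D') → X) : (A.join B).monoDel c =
      A.mono (fun e => c (some (Sum.inl e))) + B.mono fun e => c (some (Sum.inr e)) := by
  rw [LegMap.join, (hA.twoLegs_sum hB).monoDel_attach, mono, mono]
  set S := {d | c (some (Sum.inl (A.opp d))) = c (some (Sum.inl d))} with hS
  set S' := {d | c (some (Sum.inr (B.opp d))) = c (some (Sum.inr d))} with hS'
  have hr : B.root ∈ S' := by simp [hS', hB.opp_root]
  have ho : Odd S.ncard := hA.odd_ncard (by simp [hS, hA.opp_root])
    (fun d hd => by simpa [hS, hA.opp_opp] using Eq.symm hd)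
  have ho' : Odd S'.ncard := hB.odd_ncard hr
    (fun d hd => by simpa [hS', hB.opp_opp] using Eq.symm hd)
  have : {d : D ⊕ D' | d ≠ Sum.inr B.root ∧
      c (some (Perm.sumCongr A.opp B.opp d)) = c (some d)} =
      Sum.inl '' S ∪ Sum.inr '' (S' \ {B.root}) := by
    ext (d | d)
    · simp [hS]
    · simp [hS', and_comm]
  rw [this, Set.ncard_union_eq (by
    rw [Set.disjoint_left]; rintro _ ⟨d, -, rfl⟩ ⟨d', -, h⟩; simp at h),
    Set.ncard_image_of_injective _ Sum.inl_injective,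
    Set.ncard_image_of_injective _ Sum.inr_injective, Set.ncard_sdiff_singleton_of_mem hr]
  obtain ⟨i, hi⟩ := ho
  obtain ⟨j, hj⟩ := ho'
  omega

/-! ### Deletion and contraction for added and joined maps -/

theorem Conn.pottsDel_add [Finite D] {M : LegMap D} (h : M.Conn) (d : D) (k : ℕ) (ν : ℚ) :
    (M.add d).pottsDel k ν = M.pottsZ k ν := by
  simp only [pottsDel, h.monoDel_add, pottsZ]
  rw [LegMap.add, attach_rot, sumInv_insertAfter _ _ fun c => ν ^ M.mono fun e => c (some e),
    sumInv_insertBefore _ _ fun c => ν ^ M.mono c]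

/-- On colourings that agree at the two legs, the transposition in the face permutation has no
effect and can be dropped. What remains is the face permutation of `M` with insertions, for which
the agreement is automatic because both legs lie in one face. -/
theorem Conn.pottsCon_dual_add [Finite D] {M : LegMap D} (h : M.Conn) {d : D}
    (hd : M.face.SameCycle M.root d) (k : ℕ) (ν : ℚ) :
    (M.add d).dual.pottsCon k ν = M.dual.pottsZ k ν := by
  simp only [pottsCon, (h.add d).monoDel_dual, h.monoDel_add, (h.add d).mate_dual, h.mate_add]
  change sumInv (M.add d).face (fun c => if c (some (some M.root)) = c (some none) then _ else 0) = _
  rw [h.face_add, sumInv_mul_trans]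
  rw [sumInv_congr (g := fun c => ν ^ M.mono fun e => c (some (some e)))
    fun c hc => if_pos (eq_of_sameCycle hc ((Conn.sameCycle_inserted M d).2 hd)),
    sumInv_insertAfter _ _ fun c => ν ^ M.mono fun e => c (some e),
    sumInv_insertBefore _ _ fun c => ν ^ M.mono c]
  rfl

theorem Conn.pottsDel_join [Finite D] [Finite D'] {A : LegMap D} {B : LegMap D'} (hA : A.Conn)
    (hB : B.Conn) (k : ℕ) (ν : ℚ) :
    (A.join B).pottsDel k ν = A.pottsZ k ν * B.pottsZ k ν := by
  simp only [pottsDel, hA.monoDel_join hB]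
  rw [LegMap.join, attach_rot, sumInv_insertAfter _ _ fun c =>
    ν ^ (A.mono (fun e => c (Sum.inl e)) + B.mono fun e => c (Sum.inr e)),
    sumInv_sumCongr _ _ fun c c' => ν ^ (A.mono c + B.mono c')]
  simp only [pow_add, sumInv_mul_right, sumInv_mul_left]
  rfl

/-- Two maps glued at a vertex: once the colours of `B` are chosen, the colour of the leg of `A` is
prescribed, which by symmetry of the colours divides its sum by `k`. The permutations are arbitrary,
so the lemma applies to vertices and to faces. -/
theorem card_mul_sumInv_glue [Finite D] [Finite D'] (A : LegMap D) (B : LegMap D') (k : ℕ) (ν : ℚ)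
    (σ : Perm D) (σ' : Perm D') :
    k * sumInv (Perm.sumCongr σ σ') (fun c : D ⊕ D' → Fin k =>
      if c (Sum.inl A.root) = c (Sum.inr B.root) then
        ν ^ (A.mono (fun e => c (Sum.inl e)) + B.mono fun e => c (Sum.inr e)) else 0) =
    sumInv σ (fun c : D → Fin k => ν ^ A.mono c) *
      sumInv σ' (fun c : D' → Fin k => ν ^ B.mono c) := by
  rw [sumInv_sumCongr _ _ fun c c' => if c A.root = c' B.root then ν ^ (A.mono c + B.mono c') else 0,
    ← sumInv_mul_left, ← sumInv_mul_left]
  refine sumInv_congr fun c' _ => ?_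
  rw [← card_mul_sumInv (f := fun c => ν ^ A.mono c) σ A.root (c' B.root)
    fun τ c => by rw [A.mono_comp c τ.injective], mul_assoc, ← sumInv_mul_right]
  simp only [ite_mul, zero_mul, pow_add]

theorem Conn.pottsCon_join [Finite D] [Finite D'] {A : LegMap D} {B : LegMap D'} (hA : A.Conn)
    (hB : B.Conn) (k : ℕ) (ν : ℚ) :
    k * (A.join B).pottsCon k ν = A.pottsZ k ν * B.pottsZ k ν := by
  simp only [pottsCon, hA.monoDel_join hB, hA.mate_join hB]
  rw [LegMap.join, attach_rot, attach_root, sumInv_insertAfter _ _ fun c =>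
    if c (Sum.inl A.root) = c (Sum.inr B.root) then
      ν ^ (A.mono (fun e => c (Sum.inl e)) + B.mono fun e => c (Sum.inr e)) else 0]
  exact card_mul_sumInv_glue A B k ν _ _

theorem Conn.pottsCon_dual_join [Finite D] [Finite D'] {A : LegMap D} {B : LegMap D'} (hA : A.Conn)
    (hB : B.Conn) (k : ℕ) (ν : ℚ) :
    k * (A.join B).dual.pottsCon k ν = A.dual.pottsZ k ν * B.dual.pottsZ k ν := by
  have hJ := hA.join hB
  simp only [pottsCon, hJ.monoDel_dual, hA.monoDel_join hB, hJ.mate_dual, hA.mate_join hB]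
  change k * sumInv (A.join B).face
    (fun c => if c (some (Sum.inl A.root)) = c (some (Sum.inr B.root)) then _ else 0) = _
  rw [hA.face_join hB, sumInv_mul_trans, sumInv_insertAfter _ _ fun c =>
    if c (Sum.inl A.root) = c (Sum.inr B.root) then
      ν ^ (A.mono (fun e => c (Sum.inl e)) + B.mono fun e => c (Sum.inr e)) else 0]
  exact card_mul_sumInv_glue A B k ν _ _

/-- In the dual the joining edge is a loop, so the constraint in the contraction term is void. -/
theorem Conn.pottsDel_dual_join [Finite D] [Finite D'] {A : LegMap D} {B : LegMap D'} (hA : A.Conn)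
    (hB : B.Conn) (k : ℕ) (ν : ℚ) :
    k * (A.join B).dual.pottsDel k ν = A.dual.pottsZ k ν * B.dual.pottsZ k ν := by
  rw [← hA.pottsCon_dual_join hB, pottsDel, pottsCon]
  congr 1
  refine sumInv_congr fun c hc => (if_pos ?_).symm
  rw [(hA.join hB).mate_dual]
  exact eq_of_sameCycle hc (hA.isthmus_join hB)

end LegMap

namespace LegMap

variable {D D' : Type}

/-! ### The functional equation, coefficient by coefficient -/

open Finset.HasAntidiagonal (antidiagonal)

theorem numCycles_pos [Finite D] (σ : Perm D) (d : D) : 0 < numCycles σ :=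
  Nat.card_pos_iff.2 ⟨⟨Quotient.mk _ d⟩, inferInstance⟩

/-- Planar maps whose root-edge is a loop, as joined maps up to duality. -/
theorem sum_loop (g : ∀ (D : Type) [Finite D], LegMap D → ℚ)
    (hg : ∀ (D D' : Type) [Finite D] [Finite D'] (M : LegMap D) (N : LegMap D'), M.Iso N →
      g D M = g D' N) (n : ℕ) :
    (open scoped Classical in
    ∑ c : RootedPlanarMap n, ∑ d : cycle (rep c).face (rep c).root,
      if ((rep c).add d.1).Loop then g _ ((rep c).add d.1) else 0) =
      ∑ p ∈ antidiagonal n, ∑ a : RootedPlanarMap p.1, ∑ b : RootedPlanarMap p.2,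
        g _ ((rep a).join (rep b)).dual := by
  classical
  -- Only added maps can have a loop as root-edge, and only joined maps have one in the dual;
  -- duality equates the two sums over all maps with `n + 1` edges.
  have h1 := sum_rep_succ (fun D _ M => if M.Loop then g D M else 0)
    (fun D D' _ _ M N h => by rw [hg D D' M N h, h.loop_iff]) n
  have h2 := sum_rep_succ (fun D _ M => if M.dual.Loop then g D M.dual else 0)
    (fun D D' _ _ M N h => by rw [hg D D' _ _ h.dual, h.dual.loop_iff]) n
  have h3 := sum_rep_dual (fun D _ M => if M.Loop then g D M else 0)
    (fun D D' _ _ M N h => by rw [hg D D' M N h, h.loop_iff]) (n + 1)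
  have e1 : ∀ (p : ℕ × ℕ) (a : RootedPlanarMap p.1) (b : RootedPlanarMap p.2),
      ¬ ((rep a).join (rep b)).Loop := fun p a b =>
    (rep_planar a).toConn.not_loop_join (rep_planar b).toConn
  have e2 : ∀ (c : RootedPlanarMap n) (d : cycle (rep c).face (rep c).root),
      ¬ ((rep c).add d.1).dual.Loop := fun c d h =>
    (rep_planar c).toConn.not_isthmus_add (mem_cycle.1 d.2)
      (((rep_planar c).toConn.add d.1).loop_dual.1 h)
  have e3 : ∀ (p : ℕ × ℕ) (a : RootedPlanarMap p.1) (b : RootedPlanarMap p.2),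
      ((rep a).join (rep b)).dual.Loop := fun p a b =>
    ((rep_planar a).toConn.join (rep_planar b).toConn).loop_dual.2
      ((rep_planar a).toConn.isthmus_join (rep_planar b).toConn)
  simp only [e1, e2, e3, if_true, if_false, Finset.sum_const_zero, add_zero, zero_add] at h1 h2
  rw [← h1, ← h2, ← h3]

/-- The contribution of a map to the generating function. -/
def weight (k : ℕ) (ν w x y : ℚ) [Finite D] (M : LegMap D) : ℚ :=
  w ^ (numCycles M.rot - 1) * x ^ M.dv * y ^ M.df * M.pottsZ k ν

theorem Iso.weight_eq [Finite D] [Finite D'] {M : LegMap D} {N : LegMap D'} (h : M.Iso N) (k : ℕ)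
    (ν w x y : ℚ) : M.weight k ν w x y = N.weight k ν w x y := by
  rw [weight, weight, h.numCycles_rot, h.dv_eq, h.df_eq, h.pottsZ_eq]

/-- The generating function of maps with `n` edges. -/
def total (k : ℕ) (ν w : ℚ) (n : ℕ) (x y : ℚ) : ℚ :=
  ∑ c : RootedPlanarMap n, (rep c).weight k ν w x y

theorem sum_weight_dual (k : ℕ) (ν w : ℚ) (n : ℕ) (x y : ℚ) :
    ∑ c : RootedPlanarMap n, (rep c).dual.weight k ν w x y = total k ν w n x y :=
  sum_rep_dual (fun _ _ M => M.weight k ν w x y) (fun _ _ _ _ _ _ h => h.weight_eq k ν w x y) n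

theorem sum_mul_weight (k : ℕ) (ν w : ℚ) (n : ℕ) (C x y x' y' : ℚ) :
    (∑ p ∈ antidiagonal n, ∑ a : RootedPlanarMap p.1, ∑ b : RootedPlanarMap p.2,
      C * ((rep a).weight k ν w x y * (rep b).weight k ν w x' y')) =
    C * ∑ p ∈ antidiagonal n, total k ν w p.1 x y * total k ν w p.2 x' y' := by
  rw [Finset.mul_sum]
  refine Finset.sum_congr rfl fun _ _ => ?_
  rw [total, total, Finset.sum_mul_sum, Finset.mul_sum]
  exact Finset.sum_congr rfl fun _ _ => (Finset.mul_sum _ _ _).symm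

theorem sum_mul_weight_dual (k : ℕ) (ν w : ℚ) (n : ℕ) (C x y x' y' : ℚ) :
    (∑ p ∈ antidiagonal n, ∑ a : RootedPlanarMap p.1, ∑ b : RootedPlanarMap p.2,
      C * ((rep a).dual.weight k ν w x y * (rep b).dual.weight k ν w x' y')) =
    C * ∑ p ∈ antidiagonal n, total k ν w p.1 x y * total k ν w p.2 x' y' := by
  rw [Finset.mul_sum]
  refine Finset.sum_congr rfl fun _ _ => ?_
  rw [← sum_weight_dual, ← sum_weight_dual, Finset.sum_mul_sum, Finset.mul_sum]
  exact Finset.sum_congr rfl fun _ _ => (Finset.mul_sum _ _ _).symm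

theorem mul_geom_sum_succ (y : ℚ) (n : ℕ) :
    (y - 1) * ∑ j ∈ Finset.range (n + 1), y ^ (j + 1) = y * (y * y ^ n - 1) := by
  have := mul_geom_sum y (n + 1)
  rw [Finset.sum_congr rfl fun j _ => pow_succ' y j, ← Finset.mul_sum]
  linear_combination y * this

/-- For each map the new root-face degree runs over `1, …, df + 1`, and the geometric sum is the
source of the divided difference. Multiplying by `y - 1` instead of dividing keeps `y = 1`
admissible. -/
theorem sum_df_add_mul (n : ℕ) (y : ℚ) (f : RootedPlanarMap n → ℚ) :
    (y - 1) * ∑ c : RootedPlanarMap n, ∑ d : cycle (rep c).face (rep c).root,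
      f c * y ^ ((rep c).add d.1).df =
    y * (y * ∑ c : RootedPlanarMap n, f c * y ^ (rep c).df - ∑ c : RootedPlanarMap n, f c) := by
  rw [Finset.mul_sum, Finset.mul_sum, ← Finset.sum_sub_distrib, Finset.mul_sum]
  refine Finset.sum_congr rfl fun c _ => ?_
  rw [← Finset.mul_sum, (rep_planar c).toConn.sum_df_add fun j => y ^ j]
  linear_combination f c * mul_geom_sum_succ y (rep c).df

/-! ### Weights of joined and added maps -/

section

variable [Finite D] [Finite D'] {k : ℕ}

/-- The contribution of a map to the sum of the deletion terms. -/
def weightDel (k : ℕ) (ν w x y : ℚ) (M : LegMap D) : ℚ :=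
  w ^ (numCycles M.rot - 1) * x ^ M.dv * y ^ M.df * M.pottsDel k ν

/-- The contribution of a map to the sum of the contraction terms. -/
def weightCon (k : ℕ) (ν w x y : ℚ) (M : LegMap D) : ℚ :=
  w ^ (numCycles M.rot - 1) * x ^ M.dv * y ^ M.df * M.pottsCon k ν

theorem Iso.weightDel_eq {M : LegMap D} {N : LegMap D'} (h : M.Iso N) (ν w x y : ℚ) :
    M.weightDel k ν w x y = N.weightDel k ν w x y := by
  rw [weightDel, weightDel, h.numCycles_rot, h.dv_eq, h.df_eq, h.pottsDel_eq]

theorem Iso.weightCon_eq {M : LegMap D} {N : LegMap D'} (h : M.Iso N) (ν w x y : ℚ) :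
    M.weightCon k ν w x y = N.weightCon k ν w x y := by
  rw [weightCon, weightCon, h.numCycles_rot, h.dv_eq, h.df_eq, h.pottsCon_eq]

/-- Numbers of vertices add up, while each exponent omits one vertex: hence the extra `w`. -/
theorem pow_numCycles_join (A : LegMap D) (B : LegMap D') (w : ℚ) :
    w ^ (numCycles (A.join B).rot - 1) =
      w * w ^ (numCycles A.rot - 1) * w ^ (numCycles B.rot - 1) := by
  obtain ⟨i, hi⟩ := Nat.exists_eq_add_one.2 (numCycles_pos A.rot A.root)
  obtain ⟨j, hj⟩ := Nat.exists_eq_add_one.2 (numCycles_pos B.rot B.root)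
  rw [numCycles_rot_join, hi, hj, show i + 1 + (j + 1) - 1 = i + j + 1 by omega,
    Nat.add_sub_cancel, Nat.add_sub_cancel]
  ring

/-- In the dual the two maps share a vertex, which compensates for the omitted one. -/
theorem Conn.pow_numCycles_dual_join {A : LegMap D} {B : LegMap D'} (hA : A.Conn) (hB : B.Conn)
    (w : ℚ) : w ^ (numCycles (A.join B).dual.rot - 1) =
      w ^ (numCycles A.dual.rot - 1) * w ^ (numCycles B.dual.rot - 1) := by
  have h1 : 0 < numCycles A.dual.rot := numCycles_pos _ A.root
  have h2 : 0 < numCycles B.dual.rot := numCycles_pos _ B.root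
  have h3 : numCycles (A.join B).dual.rot + 1 = numCycles A.dual.rot + numCycles B.dual.rot :=
    hA.numCycles_face_join hB
  rw [← pow_add]
  congr 1
  omega

theorem Conn.dv_dual_join {A : LegMap D} {B : LegMap D'} (hA : A.Conn) (hB : B.Conn) :
    (A.join B).dual.dv = A.dual.dv + B.dual.dv + 2 :=
  hA.df_join hB

theorem Conn.df_dual_join {A : LegMap D} {B : LegMap D'} (hA : A.Conn) (hB : B.Conn) :
    (A.join B).dual.df = A.dual.df + 1 := by
  rw [(hA.join hB).df_dual, hA.df_dual, dv_join]

theorem Conn.pow_numCycles_dual_add {M : LegMap D} (h : M.Conn) {d : D}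
    (hd : M.face.SameCycle M.root d) (w : ℚ) :
    w ^ (numCycles (M.add d).dual.rot - 1) = w * w ^ (numCycles M.dual.rot - 1) := by
  have h1 : 0 < numCycles M.dual.rot := numCycles_pos _ M.root
  have h2 : numCycles (M.add d).dual.rot = numCycles M.dual.rot + 1 := h.numCycles_face_add hd
  rw [h2, ← pow_succ']
  congr 1
  omega

end

open scoped Classical

theorem Conn.dv_add [Finite D] {M : LegMap D} (h : M.Conn) (d : D) :
    (M.add d).dv = M.dv + 1 + if (M.add d).Loop then 1 else 0 := by
  by_cases hd : M.rot.SameCycle M.root d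
  · rw [if_pos ((h.loop_add d).2 hd), dv_add_of_sameCycle M hd]
  · rw [if_neg (fun h' => hd ((h.loop_add d).1 h')), dv_add_of_not_sameCycle M hd]

/-- The sum of the deletion terms. -/
theorem sum_weightDel {k : ℕ} (hk : (k : ℚ) ≠ 0) (ν w x y : ℚ) (n : ℕ) :
    (y - 1) * ∑ c : RootedPlanarMap (n + 1), (rep c).weightDel k ν w x y =
      x * y * (y * total k ν w n x y - total k ν w n x 1) +
      (y - 1) * ((x - 1) * x * y / k *
          ∑ p ∈ antidiagonal n, total k ν w p.1 x y * total k ν w p.2 x 1 +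
        x * y ^ 2 * w * ∑ p ∈ antidiagonal n, total k ν w p.1 x y * total k ν w p.2 1 y) := by
  -- A loop contributes `x ^ (dv + 2)`, with `dv` the degree before the addition, instead of `x ^
  -- (dv + 1)`. The excess is `x - 1` times the weight with exponent lowered by one.
  have hL := sum_loop (fun _ _ M => (x - 1) * (w ^ (numCycles M.rot - 1) * x ^ (M.dv - 1) *
    y ^ M.df * M.pottsDel k ν)) (fun _ _ _ _ M N h => by
      rw [h.numCycles_rot, h.dv_eq, h.df_eq, h.pottsDel_eq]) n
  have hdual : ∀ (p : ℕ × ℕ) (a : RootedPlanarMap p.1) (b : RootedPlanarMap p.2),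
      (x - 1) * (w ^ (numCycles ((rep a).join (rep b)).dual.rot - 1) *
        x ^ (((rep a).join (rep b)).dual.dv - 1) * y ^ ((rep a).join (rep b)).dual.df *
          ((rep a).join (rep b)).dual.pottsDel k ν) = (x - 1) * x * y / k *
        ((rep a).dual.weight k ν w x y * (rep b).dual.weight k ν w x 1) := by
    intro p a b
    have ha := (rep_planar a).toConn
    have hb := (rep_planar b).toConn
    rw [ha.pow_numCycles_dual_join hb, ha.dv_dual_join hb, ha.df_dual_join hb, weight, weight,
      Nat.add_sub_assoc (by norm_num)]
    have := ha.pottsDel_dual_join hb k ν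
    field_simp
    rw [mul_assoc _ _ (k : ℚ), mul_comm _ (k : ℚ), this]
    ring
  have hadd : ∀ (c : RootedPlanarMap n) (d : cycle (rep c).face (rep c).root),
      ((rep c).add d.1).weightDel k ν w x y =
        x * (rep c).weight k ν w x 1 * y ^ ((rep c).add d.1).df +
        if ((rep c).add d.1).Loop then (x - 1) * (w ^ (numCycles ((rep c).add d.1).rot - 1) *
          x ^ (((rep c).add d.1).dv - 1) * y ^ ((rep c).add d.1).df *
            ((rep c).add d.1).pottsDel k ν) else 0 := by
    intro c d
    have hc := (rep_planar c).toConn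
    rw [weightDel, weight, hc.pottsDel_add, numCycles_rot_add, hc.dv_add]
    split_ifs
    · rw [Nat.add_sub_cancel]; ring
    · ring
  have hjoin : ∀ (p : ℕ × ℕ) (a : RootedPlanarMap p.1) (b : RootedPlanarMap p.2),
      ((rep a).join (rep b)).weightDel k ν w x y =
        x * y ^ 2 * w * ((rep a).weight k ν w x y * (rep b).weight k ν w 1 y) := by
    intro p a b
    have ha := (rep_planar a).toConn
    have hb := (rep_planar b).toConn
    rw [weightDel, weight, weight, pow_numCycles_join, dv_join, ha.df_join hb, ha.pottsDel_join hb]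
    ring
  simp only [hdual, sum_mul_weight_dual] at hL
  rw [sum_rep_succ (fun _ _ M => M.weightDel k ν w x y)
    fun _ _ _ _ _ _ h => h.weightDel_eq ν w x y]
  simp only [hadd, hjoin, sum_mul_weight, Finset.sum_add_distrib]
  -- The old map is weighted at `y = 1`, as the degree of its root-face is replaced by that of the
  -- new one.
  rw [hL, mul_add, mul_add, sum_df_add_mul n y fun c => x * (rep c).weight k ν w x 1]
  have h1 : ∑ c : RootedPlanarMap n, x * (rep c).weight k ν w x 1 = x * total k ν w n x 1 :=
    (Finset.mul_sum _ _ _).symm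
  have h2 : ∑ c : RootedPlanarMap n, x * (rep c).weight k ν w x 1 * y ^ (rep c).df =
      x * total k ν w n x y := by
    rw [total, Finset.mul_sum]
    refine Finset.sum_congr rfl fun c _ => ?_
    rw [weight, weight]
    ring
  rw [h1, h2]
  ring

/-- The sum of the contraction terms. -/
theorem sum_weightCon {k : ℕ} (hk : (k : ℚ) ≠ 0) (ν w x y : ℚ) (n : ℕ) :
    (x - 1) * ∑ c : RootedPlanarMap (n + 1), (rep c).weightCon k ν w x y =
      x * y * w * (x * total k ν w n x y - total k ν w n 1 y) +
      (x - 1) * ((y - 1) * x * y * w / k *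
          ∑ p ∈ antidiagonal n, total k ν w p.1 x y * total k ν w p.2 1 y +
        x ^ 2 * y / k * ∑ p ∈ antidiagonal n, total k ν w p.1 x y * total k ν w p.2 x 1) := by
  -- The weights are those of the dual, whose root-face degree is `M.dv`: a loop of `M` brings an
  -- extra factor `y`.
  have hL := sum_loop (fun _ _ M => (y - 1) * (w ^ (numCycles M.dual.rot - 1) * x ^ M.dual.dv *
    y ^ (M.dv - 1) * M.dual.pottsCon k ν)) (fun _ _ _ _ M N h => by
      rw [h.dual.numCycles_rot, h.dual.dv_eq, h.dv_eq, h.dual.pottsCon_eq]) n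
  have hdual : ∀ (p : ℕ × ℕ) (a : RootedPlanarMap p.1) (b : RootedPlanarMap p.2),
      (y - 1) * (w ^ (numCycles ((rep a).join (rep b)).dual.dual.rot - 1) *
        x ^ ((rep a).join (rep b)).dual.dual.dv * y ^ (((rep a).join (rep b)).dual.dv - 1) *
          ((rep a).join (rep b)).dual.dual.pottsCon k ν) = (y - 1) * x * y * w / k *
        ((rep a).weight k ν w x y * (rep b).weight k ν w 1 y) := by
    intro p a b
    have ha := (rep_planar a).toConn
    have hb := (rep_planar b).toConn
    rw [(ha.join hb).dual_dual, pow_numCycles_join, dv_join, ha.dv_dual_join hb, weight, weight,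
      ← df_eq_dv_dual, ← df_eq_dv_dual, Nat.add_sub_assoc (by norm_num)]
    have := ha.pottsCon_join hb k ν
    field_simp
    rw [mul_assoc _ _ (k : ℚ), mul_comm _ (k : ℚ), this]
    ring
  have hadd : ∀ (c : RootedPlanarMap n) (d : cycle (rep c).face (rep c).root),
      ((rep c).add d.1).dual.weightCon k ν w x y =
        y * w * (rep c).dual.weight k ν w 1 y * x ^ ((rep c).add d.1).df +
        if ((rep c).add d.1).Loop then (y - 1) *
          (w ^ (numCycles ((rep c).add d.1).dual.rot - 1) * x ^ ((rep c).add d.1).dual.dv *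
            y ^ (((rep c).add d.1).dv - 1) * ((rep c).add d.1).dual.pottsCon k ν) else 0 := by
    intro c d
    have hc := (rep_planar c).toConn
    rw [weightCon, weight, hc.pottsCon_dual_add (mem_cycle.1 d.2),
      hc.pow_numCycles_dual_add (mem_cycle.1 d.2), (hc.add d.1).df_dual, hc.df_dual, hc.dv_add,
      ← df_eq_dv_dual]
    split_ifs
    · rw [Nat.add_sub_cancel]; ring
    · ring
  have hjoin : ∀ (p : ℕ × ℕ) (a : RootedPlanarMap p.1) (b : RootedPlanarMap p.2),
      ((rep a).join (rep b)).dual.weightCon k ν w x y =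
        x ^ 2 * y / k * ((rep a).dual.weight k ν w x y * (rep b).dual.weight k ν w x 1) := by
    intro p a b
    have ha := (rep_planar a).toConn
    have hb := (rep_planar b).toConn
    rw [weightCon, weight, weight, ha.pow_numCycles_dual_join hb, ha.dv_dual_join hb,
      ha.df_dual_join hb]
    have := ha.pottsCon_dual_join hb k ν
    field_simp
    rw [mul_assoc _ _ (k : ℚ), mul_comm _ (k : ℚ), this]
    ring
  simp only [hdual, sum_mul_weight] at hL
  -- The sum is taken over duals, because contraction in the dual undoes `add` and, up to the factor
  -- `k`, `join`.
  rw [← sum_rep_dual (fun _ _ M => M.weightCon k ν w x y)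
    fun _ _ _ _ _ _ h => h.weightCon_eq ν w x y]
  rw [sum_rep_succ (fun _ _ M => M.dual.weightCon k ν w x y)
    fun _ _ _ _ _ _ h => h.dual.weightCon_eq ν w x y]
  simp only [hadd, hjoin, sum_mul_weight_dual, Finset.sum_add_distrib]
  rw [hL, mul_add, mul_add, sum_df_add_mul n x fun c => y * w * (rep c).dual.weight k ν w 1 y]
  have h1 : ∑ c : RootedPlanarMap n, y * w * (rep c).dual.weight k ν w 1 y =
      y * w * total k ν w n 1 y := by
    rw [← sum_weight_dual, Finset.mul_sum]
  have h2 : ∑ c : RootedPlanarMap n, y * w * (rep c).dual.weight k ν w 1 y * x ^ (rep c).df =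
      y * w * total k ν w n x y := by
    rw [← sum_weight_dual, Finset.mul_sum]
    refine Finset.sum_congr rfl fun c _ => ?_
    rw [weight, weight, df_eq_dv_dual (rep c)]
    ring
  rw [h1, h2]
  ring

/-- The functional equation for the coefficients, without division by `k`. -/
theorem total_succ {k : ℕ} (hk : (k : ℚ) ≠ 0) (ν w x y : ℚ) (n : ℕ) :
    (x - 1) * (y - 1) * total k ν w (n + 1) x y =
      (x - 1) * (y - 1) * (x * y * w * (k * y + (ν - 1) * (y - 1)) / k *
        ∑ p ∈ antidiagonal n, total k ν w p.1 x y * total k ν w p.2 1 y) +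
      (x - 1) * (y - 1) * (x * y * (x * ν - 1) / k *
        ∑ p ∈ antidiagonal n, total k ν w p.1 x y * total k ν w p.2 x 1) +
      (y - 1) * (x * y * w * (ν - 1) * (x * total k ν w n x y - total k ν w n 1 y)) +
      (x - 1) * (x * y * (y * total k ν w n x y - total k ν w n x 1)) := by
  have h : total k ν w (n + 1) x y = ∑ c : RootedPlanarMap (n + 1), (rep c).weightDel k ν w x y +
      (ν - 1) * ∑ c : RootedPlanarMap (n + 1), (rep c).weightCon k ν w x y := by
    rw [total, Finset.mul_sum, ← Finset.sum_add_distrib]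
    refine Finset.sum_congr rfl fun c _ => ?_
    have hc := (rep_planar c).toConn
    rw [weight, hc.pottsZ_eq (hc.rot_root_ne (by rw [card_darts]; omega)), weightDel, weightCon]
    ring
  have h1 := sum_weightDel hk ν w x y n
  have h2 := sum_weightCon hk ν w x y n
  rw [h]
  field_simp at h1 h2 ⊢
  -- The product coefficients combine through `(x - 1) + (ν - 1) * x = x * ν - 1`.
  linear_combination (x - 1) * h1 + (ν - 1) * (y - 1) * h2

end LegMap

namespace LegMap

variable {D D' : Type}

/-! ### Comparison with rooted planar maps -/

theorem dv_ofDartMap [Finite D] (m : DartMap D) : (ofDartMap m).dv = m.rootVertexDegree := by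
  change (cycle (insertBefore m.rot m.root) none).ncard - 1 = _
  rw [ncard_cycle_insertBefore_none]
  rfl

theorem df_ofDartMap [Finite D] (m : DartMap D) : (ofDartMap m).df = m.rootFaceDegree := by
  rw [df, face_ofDartMap]
  change (cycle _ none).ncard - 1 = _
  rw [ncard_cycle_insertBefore_none]
  rfl

/-- The fibres of `m.edge` are the pairs of distinct darts `d`, `m.opp d`. -/
theorem ncard_preimage_edge [Finite D] (m : DartMap D) (S : Set m.Edge) :
    {d | m.edge d ∈ S}.ncard = 2 * S.ncard := by
  classical
  have := Fintype.ofFinite D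
  have := Fintype.ofFinite m.Edge
  rw [Set.ncard_eq_toFinset_card', Set.ncard_eq_toFinset_card',
    Finset.card_eq_sum_card_fiberwise (f := m.edge) (t := S.toFinset) (by intro d; simp),
    mul_comm, ← smul_eq_mul, ← Finset.sum_const]
  refine Finset.sum_congr rfl fun e he => ?_
  induction e using Quotient.ind with
  | _ d =>
  change m.edge d ∈ _ at he
  have h2 : m.edge (m.opp d) = m.edge d := Quotient.sound (by
    change m.opp.SameCycle (m.opp d) d
    simp [Perm.SameCycle.refl])
  rw [Finset.card_eq_two]
  refine ⟨d, m.opp d, (m.opp_ne d).symm, ?_⟩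
  ext d'
  simp only [Finset.mem_filter, Set.mem_toFinset, Set.mem_ofPred_eq, Finset.mem_insert,
    Finset.mem_singleton] at he ⊢
  constructor
  · rintro ⟨-, h⟩
    exact m.eq_or_eq_opp_of_edge_eq h.symm
  · rintro (rfl | rfl)
    · exact ⟨he, rfl⟩
    · exact ⟨h2 ▸ he, h2⟩

theorem ncard_monochromaticEdges [Finite D] (m : DartMap D) {k : ℕ} (c : V(m.graph) → Fin k) :
    2 * (monochromaticEdges m.graph c).ncard =
      {d | c ⟨m.origin (m.opp d), Set.mem_univ _⟩ = c ⟨m.origin d, Set.mem_univ _⟩}.ncard := by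
  rw [← ncard_preimage_edge]
  congr 1
  ext d
  constructor
  · rintro ⟨a, b, ⟨d', h1, h2, h3⟩, hc⟩
    have ha : a = ⟨m.origin d', Set.mem_univ _⟩ := Subtype.ext h2.symm
    have hb : b = ⟨m.origin (m.opp d'), Set.mem_univ _⟩ := Subtype.ext h3.symm
    subst ha hb
    rcases m.eq_or_eq_opp_of_edge_eq h1 with rfl | rfl
    · exact hc.symm
    · change c _ = c _
      simpa [m.opp_opp] using hc
  · intro hd
    exact ⟨_, _, ⟨d, rfl, rfl, rfl⟩, Eq.symm hd⟩

/-- The `+ 1` is the leg, fixed by `opp`. The other monochromatic darts come in pairs, so the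
truncated division discards it. -/
theorem mono_ofDartMap [Finite D] (m : DartMap D) {X : Type} (c : Option D → X) :
    (ofDartMap m).mono c = ({d | c (some (m.opp d)) = c (some d)}.ncard + 1) / 2 := by
  rw [mono, ← Set.ncard_image_of_injective _ (Option.some_injective D),
    ← Set.ncard_insert_of_notMem (a := none) (by simp)]
  congr 2
  ext o
  cases o <;> simp [ofDartMap]

/-- Vertex colourings are the dart colourings that are constant on the cycles of `rot`; the inserted
leg takes the colour of its vertex. -/
theorem pottsZ_ofDartMap [Finite D] (m : DartMap D) (k : ℕ) (ν : ℚ) :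
    (ofDartMap m).pottsZ k ν = (pottsPartition m.graph k).eval ν := by
  have : Fintype (V(m.graph) → Fin k) := Fintype.ofFinite _
  rw [pottsPartition, finsum_eq_sum_of_fintype, Polynomial.eval_finsetSum, pottsZ]
  simp only [mono_ofDartMap]
  change sumInv (insertBefore m.rot m.root) _ = _
  rw [sumInv_insertBefore _ _ fun c : D → Fin k => ν ^ (({d | c (m.opp d) = c d}.ncard + 1) / 2)]
  let e : (V(m.graph) → Fin k) ≃ Inv m.rot (Fin k) :=
    ((Equiv.Set.univ m.Vertex).arrowCongr (Equiv.refl _)).trans (invEquiv m.rot (Fin k)).symm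
  refine (Fintype.sum_equiv e _ _ fun c => ?_).symm
  have he : ∀ d, (e c).1 d = c ⟨m.origin d, Set.mem_univ _⟩ := fun d => rfl
  simp only [he, ← ncard_monochromaticEdges]
  rw [Polynomial.eval_pow, Polynomial.eval_X]
  congr 1
  omega

theorem mk_out {n : ℕ} (c : RootedPlanarMap (n + 1)) :
    @Eq (RootedPlanarMap (n + 1)) (Quotient.mk (DartMap.isoSetoid (Fin (2 * (n + 1))))
      (Quotient.out (s := DartMap.isoSetoid (Fin (2 * (n + 1)))) c)) c :=
  Quotient.out_eq _

theorem cycle_one (x : D) : cycle (1 : Perm D) x = {x} := by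
  ext d
  simp [mem_cycle, eq_comm]

theorem numCycles_rep : {n : ℕ} → (c : RootedPlanarMap n) → numCycles (rep c).rot = c.numVertices
  | 0, c => by
    have h := (rep_planar c).euler
    rw [card_darts] at h
    have h1 : numCycles (rep c).face = numCycles (rep c).rot := rfl
    change numCycles (rep c).rot = 1
    omega
  | n + 1, c => (numCycles_insertBefore _ _).trans (congrArg (RootedPlanarMap.numVertices (n := n + 1)) (mk_out c))

theorem dv_rep : {n : ℕ} → (c : RootedPlanarMap n) → (rep c).dv = c.rootVertexDegree
  | 0, c => by
    change (cycle 1 none).ncard - 1 = 0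
    simp [cycle_one]
  | n + 1, c => (dv_ofDartMap _).trans (congrArg (RootedPlanarMap.rootVertexDegree (n := n + 1)) (mk_out c))

theorem df_rep : {n : ℕ} → (c : RootedPlanarMap n) → (rep c).df = c.rootFaceDegree
  | 0, c => by
    change (cycle 1 none).ncard - 1 = 0
    simp [cycle_one]
  | n + 1, c => (df_ofDartMap _).trans (congrArg (RootedPlanarMap.rootFaceDegree (n := n + 1)) (mk_out c))

theorem pottsZ_rep_zero (c : RootedPlanarMap 0) (k : ℕ) (ν : ℚ) : (rep c).pottsZ k ν = k := by
  have hm : ∀ f : Option (Fin (2 * 0)) → Fin k, (rep c).mono f = 0 := fun f => by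
    have h1 : {d | f ((rep c).opp d) = f d} = {none} := by
      ext o
      cases o with
      | none => simp [rep]
      | some i => exact i.elim0
    rw [mono, h1, Set.ncard_singleton]
  simp only [pottsZ, hm, sumInv, pow_zero, Finset.sum_const, Finset.card_univ, nsmul_eq_mul,
    mul_one]
  rw [← Nat.card_eq_fintype_card, Nat.card_congr (invEquiv _ _), Nat.card_fun, Nat.card_fin]
  change ((k ^ numCycles (rep c).rot : ℕ) : ℚ) = k
  rw [numCycles_rep]
  change ((k ^ 1 : ℕ) : ℚ) = k
  rw [pow_one]

theorem pottsZ_rep : {n : ℕ} → (c : RootedPlanarMap n) → (k : ℕ) → (ν : ℚ) →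
    (rep c).pottsZ k ν = (c.potts.eval (k : ℚ[X])).eval ν
  | 0, c, k, ν => by
    have hs : ∀ f : V(RootedPlanarMap.atomicGraph) → Fin k,
        monochromaticEdges RootedPlanarMap.atomicGraph f = ∅ :=
      fun f => Set.eq_empty_of_forall_notMem fun e => e.elim
    have : Fintype (V(RootedPlanarMap.atomicGraph) → Fin k) := Fintype.ofFinite _
    have hc : Nat.card V(RootedPlanarMap.atomicGraph) = 1 := by
      simp [RootedPlanarMap.atomicGraph]
    change _ = ((pottsPolynomial RootedPlanarMap.atomicGraph).eval (k : ℚ[X])).eval ν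
    rw [pottsPolynomial_eval, pottsPartition, finsum_eq_sum_of_fintype, pottsZ_rep_zero]
    simp only [hs, Set.ncard_empty, pow_zero, Finset.sum_const, Finset.card_univ, nsmul_eq_mul,
      mul_one]
    rw [← Nat.card_eq_fintype_card, Nat.card_fun, hc, Nat.card_fin, pow_one,
      Polynomial.eval_natCast]
  | n + 1, c, k, ν => by
    have h := congrArg (fun c : RootedPlanarMap (n + 1) =>
      ((RootedPlanarMap.potts c).eval (k : ℚ[X])).eval ν) (mk_out c)
    refine Eq.trans ?_ h
    change _ = ((pottsPolynomial (DartMap.graph _)).eval (k : ℚ[X])).eval ν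
    rw [pottsPolynomial_eval, ← pottsZ_ofDartMap]
    rfl

theorem total_zero (k : ℕ) (ν w x y : ℚ) : total k ν w 0 x y = k := by
  let _ : Unique (RootedPlanarMap 0) := inferInstanceAs (Unique Unit)
  rw [total, Fintype.sum_unique, weight, numCycles_rep, dv_rep, df_rep, pottsZ_rep_zero]
  change w ^ 0 * x ^ 0 * y ^ 0 * (k : ℚ) = k
  simp

end LegMap

open LegMap

/-! ## The functional equation -/

theorem eval_pottsIncl (s : PottsVar → ℚ) (k : ℕ) (hs : s PottsVar.q = k) (P : ℚ[X][X]) :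
    MvPolynomial.eval s (pottsIncl P) = (P.eval (k : ℚ[X])).eval (s PottsVar.nu) := by
  have : (MvPolynomial.eval s).comp pottsIncl =
      (Polynomial.evalRingHom (s PottsVar.nu)).comp (Polynomial.evalRingHom (k : ℚ[X])) := by
    ext1
    · ext1
      · exact Subsingleton.elim _ _
      · simp [pottsIncl]
    · simp [pottsIncl, hs]
  exact congrArg (fun g => g P) this

/-- The division by `k` is the normalisation by `1 / q`, absent from `total`. -/
theorem map_eval_pottsGF (s : PottsVar → ℚ) {k : ℕ} (hk : (k : ℚ) ≠ 0) (hs : s PottsVar.q = k)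
    (a b : PottsRing) : PowerSeries.map (MvPolynomial.eval s) (pottsGF a b) =
      PowerSeries.mk fun n => total k (s PottsVar.nu) (s PottsVar.w) n
        (MvPolynomial.eval s a) (MvPolynomial.eval s b) / k := by
  ext n
  rw [PowerSeries.coeff_map, pottsGF, PowerSeries.coeff_mk, PowerSeries.coeff_mk, map_sum, total,
    Finset.sum_div]
  refine Finset.sum_congr rfl fun c _ => ?_
  have h : (k : ℚ) * MvPolynomial.eval s (pottsIncl c.pottsDivQ) =
      (rep c).pottsZ k (s PottsVar.nu) := by
    rw [pottsZ_rep, ← eval_pottsIncl s k hs, ← RootedPlanarMap.q_mul_pottsDivQ, map_mul, map_mul,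
      ← hs]
    simp [pottsIncl]
  rw [weight, ← h, numCycles_rep, dv_rep, df_rep]
  simp only [map_mul, map_pow, MvPolynomial.eval_X]
  field_simp

/-- Power series that agree for all positive integers `q` are equal. -/
theorem powerSeries_eq_of_eval {F G : PottsRing⟦X⟧}
    (h : ∀ (s : PottsVar → ℚ) (k : ℕ), (k : ℚ) ≠ 0 → s PottsVar.q = k →
      PowerSeries.map (MvPolynomial.eval s) F = PowerSeries.map (MvPolynomial.eval s) G) :
    F = G := by
  classical
  ext1 n
  -- The points whose `q` is a positive integer form a product of infinite sets, on which a
  -- polynomial is determined by its values.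
  refine MvPolynomial.funext_set
    (fun i => if i = PottsVar.q then Set.range fun k : ℕ => ((k + 1 : ℕ) : ℚ) else Set.univ)
    (fun i => ?_) fun s hs => ?_
  · change (if _ then _ else _ : Set ℚ).Infinite
    split_ifs
    · exact Set.infinite_range_of_injective
        (Nat.cast_injective.comp (add_left_injective 1))
    · exact Set.infinite_univ
  · obtain ⟨k, hk⟩ : ∃ k : ℕ, ((k + 1 : ℕ) : ℚ) = s PottsVar.q := by
      simpa using hs PottsVar.q (Set.mem_univ _)
    have := congrArg (PowerSeries.coeff n) (h s (k + 1) (by positivity) hk.symm)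
    rwa [PowerSeries.coeff_map, PowerSeries.coeff_map] at this

/-- Cleared of denominators, the equation lives in the power series ring and can be checked
coefficient by coefficient at every rational point, `x = 1` and `y = 1` included. -/
theorem pottsGF_functional_equation :
    let q : PottsRing⟦X⟧ := PowerSeries.C (MvPolynomial.X PottsVar.q)
    let ν : PottsRing⟦X⟧ := PowerSeries.C (MvPolynomial.X PottsVar.nu)
    let w : PottsRing⟦X⟧ := PowerSeries.C (MvPolynomial.X PottsVar.w)
    let x : PottsRing⟦X⟧ := PowerSeries.C (MvPolynomial.X PottsVar.x)
    let y : PottsRing⟦X⟧ := PowerSeries.C (MvPolynomial.X PottsVar.y)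
    let t : PottsRing⟦X⟧ := PowerSeries.X
    let Mxy := pottsGF (MvPolynomial.X PottsVar.x) (MvPolynomial.X PottsVar.y)
    let M1y := pottsGF 1 (MvPolynomial.X PottsVar.y)
    let Mx1 := pottsGF (MvPolynomial.X PottsVar.x) 1
    (x - 1) * (y - 1) * Mxy = (x - 1) * (y - 1) *
      (1 + t * (x * y * w * (q * y + (ν - 1) * (y - 1)) * (Mxy * M1y) +
        x * y * (x * ν - 1) * (Mxy * Mx1))) +
      t * ((y - 1) * (x * y * w * (ν - 1) * (x * Mxy - M1y)) +
        (x - 1) * (x * y * (y * Mxy - Mx1))) := by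
  intro q ν w x y t Mxy M1y Mx1
  refine powerSeries_eq_of_eval fun s k hk hs => ?_
  simp only [q, ν, w, x, y, t, Mxy, M1y, Mx1, map_mul, map_add, map_sub, map_one,
    PowerSeries.map_C, PowerSeries.map_X, MvPolynomial.eval_X, map_eval_pottsGF s hk hs, hs]
  generalize s PottsVar.nu = ν
  generalize s PottsVar.w = w
  generalize s PottsVar.x = x
  generalize s PottsVar.y = y
  simp only [← map_one (PowerSeries.C (R := ℚ)), ← map_sub, ← map_mul, ← map_add]
  ext n
  cases n with
  -- The atomic map contributes `k / k = 1`.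
  | zero => simp [total_zero, hk]
  | succ n =>
    have h := total_succ hk ν w x y n
    -- With `t` moved to the front, the coefficient of `t ^ (n + 1)` becomes one of `t ^ n`.
    rw [mul_add (PowerSeries.C _), mul_left_comm _ PowerSeries.X]
    simp only [map_add (PowerSeries.coeff _), map_sub (PowerSeries.coeff _),
      PowerSeries.coeff_succ_X_mul, PowerSeries.coeff_C_mul, PowerSeries.coeff_mk,
      PowerSeries.coeff_C, Nat.succ_ne_zero, if_false]
    simp only [PowerSeries.coeff_mul, PowerSeries.coeff_mk, div_mul_div_comm, ← Finset.sum_div]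
    field_simp at h ⊢
    linear_combination h

end

/-! ### Divided differences in the fraction field -/

theorem mainTheorem6 :
    let q : PottsField := pottsConst (MvPolynomial.X PottsVar.q)
    let ν : PottsField := pottsConst (MvPolynomial.X PottsVar.nu)
    let w : PottsField := pottsConst (MvPolynomial.X PottsVar.w)
    let x : PottsField := pottsConst (MvPolynomial.X PottsVar.x)
    let y : PottsField := pottsConst (MvPolynomial.X PottsVar.y)
    let t : PottsField := algebraMap (PowerSeries PottsRing) PottsField PowerSeries.X
    let Mxy : PottsField := algebraMap (PowerSeries PottsRing) PottsField
      (pottsGF (MvPolynomial.X PottsVar.x) (MvPolynomial.X PottsVar.y))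
    let M1y : PottsField := algebraMap (PowerSeries PottsRing) PottsField
      (pottsGF 1 (MvPolynomial.X PottsVar.y))
    let Mx1 : PottsField := algebraMap (PowerSeries PottsRing) PottsField
      (pottsGF (MvPolynomial.X PottsVar.x) 1)
    Mxy = 1 + x * y * w * t * (q * y + (ν - 1) * (y - 1)) * Mxy * M1y
      + x * y * t * (x * ν - 1) * Mxy * Mx1
      + x * y * w * t * (ν - 1) * ((x * Mxy - M1y) / (x - 1))
      + x * y * t * ((y * Mxy - Mx1) / (y - 1)) := by
  intro q ν w x y t Mxy M1y Mx1
  have hx : x - 1 ≠ 0 := pottsConst_X_sub_one_ne_zero PottsVar.x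
  have hy : y - 1 ≠ 0 := pottsConst_X_sub_one_ne_zero PottsVar.y
  have h := congrArg (algebraMap (PowerSeries PottsRing) PottsField) pottsGF_functional_equation
  simp only [map_mul, map_add, map_sub, map_one] at h
  change (x - 1) * (y - 1) * Mxy = (x - 1) * (y - 1) *
      (1 + t * (x * y * w * (q * y + (ν - 1) * (y - 1)) * (Mxy * M1y) +
        x * y * (x * ν - 1) * (Mxy * Mx1))) +
      t * ((y - 1) * (x * y * w * (ν - 1) * (x * Mxy - M1y)) +
        (x - 1) * (x * y * (y * Mxy - Mx1))) at h
  clear_value q ν w x y t Mxy M1y Mx1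
  field_simp
  linear_combination h
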